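/- \textbf{Definitions.} A \emph{quantum algorithm} is a classical (deterministic, multi-stack) Turing machine that, on an input string $x$, writes down a quantum circuit over the universal gate set $\{H,T,\mathrm{CNOT}\}$; the circuit is run on $|0\cdots0\rangle$ and one qubit is measured. Its running time on $x$ is the number of steps of the machine (which also bounds the circuit size up to a constant factor). It decides with bounded error: yes-instances are accepted with probability at least $2/3$ and no-instances with probability at most $1/3$. A parameterized promise problem is in \emph{FPQT} if some quantum algorithm decides it with bounded error, on every instance $x$ (in the promise) with parameter $k$, in time $f(k)\,p(|x|)$, where $f$ is a computable function and $p$ a polynomial. An $n$-qubit state $|\psi\rangle$ (a unit vector) has \emph{weight} $k$ if it is supported on computational basis states of Hamming weight $k$. Let $\ell\in\mathbb N$ and $a,b:\mathbb N\to\mathbb R$. \emph{Weight-$k$ $\ell$-Local Hamiltonian$(a,b)$} is the following parameterized promise problem. Instance: $k$ and a Hamiltonian $H=\sum_i H_i$ on $n$ qubits with at most polynomially (in $n$) many Hermitian terms $H_i$, each acting on at most $\ell$ qubits, with operator norm $\|H_i\|\le 1$ (and matrix entries in $\mathbb Q(i)$, written in binary). Parameter: $k$. Yes: some weight-$k$ state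 satisfies $\langle\psi|H|\psi\rangle\le a(n)$. No: every weight-$k$ state satisfies $\langle\psi|H|\psi\rangle\ge b(n)$. The problem is said to be in FPQT if, for every polynomial $q$, its restriction to Hamiltonians with at most $q(n)$ terms is in FPQT. A \emph{weft-$1$ Boolean circuit} is a Boolean circuit (with fan-out and one output) made of arbitrary one- and two-bit gates and of large gates (AND, OR or generalised Toffoli gates of unbounded fan-in) such that every path from an input to the output goes through at most one large gate. Its \emph{total description size} is the least $D$ such that the number of inputs and the number of gates are both at most $D$. \emph{QCETH} (the quantum-classical exponential time hypothesis) states: there is no quantum algorithm with running time $2^{o(n)}$ that decides, with bounded error, for a weft-$1$ Boolean circuit $C$ of total description size $n$, whether there is an input vector $x$ with $C(x)=1$. \textbf{Theorem.} Let $\ell\ge 2$ and let $a,b:\mathbb N\to\mathbb R$ be such that $a(n)<b(n)$ for all $n$ and $|a(n)|,|b(n)|$ are bounded by a polynomial in $n$. If Weight-$k$ $\ell$-Local Hamiltonian$(a,b)$ is in FPQT, then QCETH is false. -/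

import Mathlib

/-! ### Self-delimiting binary encodings -/

/-- Unary code of a natural number: `n` ones followed by a zero. -/
def encUnary (n : ℕ) : List Bool :=
  List.replicate n true ++ [false]

/-- Self-delimiting binary code of a natural number: every binary digit is preceded by a one,
and a zero marks the end. -/
def encBinary (n : ℕ) : List Bool :=
  n.bits.flatMap (fun b => [true, b]) ++ [false]

/-- Code of a rational number in lowest terms: sign, numerator and denominator in binary. -/
def encRat (q : ℚ) : List Bool :=
  decide (q.num < 0) :: (encBinary q.num.natAbs ++ encBinary q.den)

/-! ### Quantum circuits -/

/-- A computational basis state of `n` qubits. -/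
abbrev Bits (n : ℕ) : Type := Fin n → Fin 2

/-- Gates on `m` qubits from the universal gate set consisting of the Hadamard gate,
the `π/8` gate `T = diag(1, exp(iπ/4))` and the controlled-NOT gate. -/
inductive QGate (m : ℕ) : Type
  | hadamard (q : Fin m)
  | tGate (q : Fin m)
  | cnot (control target : Fin m) (hne : control ≠ target)

/-- The action of a gate on a vector of amplitudes. -/
noncomputable def QGate.apply {m : ℕ} : QGate m → (Bits m → ℂ) → (Bits m → ℂ)
  | .hadamard q, ψ => fun x =>
      (1 / (Real.sqrt 2 : ℂ)) *
        (ψ (Function.update x q 0) + (-1 : ℂ) ^ (x q : ℕ) * ψ (Function.update x q 1))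
  | .tGate q, ψ => fun x =>
      (if x q = 1 then Complex.exp (Complex.I * (Real.pi : ℂ) / 4) else 1) * ψ x
  | .cnot c t _, ψ => fun x => ψ (Function.update x t (x t + x c))

def QGate.encode {m : ℕ} : QGate m → List Bool
  | .hadamard q => [false, false] ++ encUnary q
  | .tGate q => [false, true] ++ encUnary q
  | .cnot c t _ => [true, false] ++ (encUnary c ++ encUnary t)

/-- A quantum circuit without input, on `extra + 1` qubits (so that there is a qubit `0`). -/
structure QCircuit where
  extra : ℕ
  gates : List (QGate (extra + 1))

/-- The state produced from `|0⋯0⟩` by applying the gates one after the other. -/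
noncomputable def QCircuit.finalState (Q : QCircuit) : Bits (Q.extra + 1) → ℂ :=
  Q.gates.foldl (fun ψ g => g.apply ψ) (Pi.single 0 1)

/-- The probability that measuring qubit `0` of the final state gives `1`. -/
noncomputable def QCircuit.acceptProb (Q : QCircuit) : ℝ :=
  ∑ x : Bits (Q.extra + 1), if x 0 = 1 then ‖Q.finalState x‖ ^ 2 else 0

def QCircuit.encode (Q : QCircuit) : List Bool :=
  encUnary Q.extra ++ (encUnary Q.gates.length ++ Q.gates.flatMap QGate.encode)

/-! ### Quantum algorithms and their running time -/

/-- A quantum algorithm (in the uniform-circuit model): a classical Turing machine that, on an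
input string, writes down a quantum circuit, which is then run once on `|0⋯0⟩` and measured.
The machine writes boundedly many symbols per step, so its number of steps bounds the size of
the circuit up to a constant factor, and accounts for the running time of the algorithm. -/
abbrev QuantumAlgorithm : Type 1 := Turing.TM2ComputableAux Bool Bool

/-- On the input string `x`, the algorithm `A` produces the circuit `Q` within `t` steps. -/
def QuantumAlgorithm.ProducesInTime (A : QuantumAlgorithm) (x : List Bool) (Q : QCircuit)
    (t : ℕ) : Prop :=
  Nonempty (Turing.TM2OutputsInTime A.tm (x.map A.inputAlphabet.invFun)
    (some (Q.encode.map A.outputAlphabet.invFun)) t)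

/-- `A` runs in time `t` on `x` and accepts with probability at least `2/3`. -/
def QuantumAlgorithm.AcceptsInTime (A : QuantumAlgorithm) (x : List Bool) (t : ℕ) : Prop :=
  ∃ Q : QCircuit, A.ProducesInTime x Q t ∧ 2 / 3 ≤ Q.acceptProb

/-- `A` runs in time `t` on `x` and accepts with probability at most `1/3`. -/
def QuantumAlgorithm.RejectsInTime (A : QuantumAlgorithm) (x : List Bool) (t : ℕ) : Prop :=
  ∃ Q : QCircuit, A.ProducesInTime x Q t ∧ Q.acceptProb ≤ 1 / 3

/-! ### Parameterized promise problems and the class FPQT -/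

/-- A parameterized promise problem: instances with their binary encoding and their parameter,
and the sets of yes-instances and of no-instances. -/
structure ParamPromiseProblem where
  Inst : Type
  encode : Inst → List Bool
  param : Inst → ℕ
  yes : Set Inst
  no : Set Inst

/-- Fixed-parameter quantum tractability: some quantum algorithm decides the problem with bounded
error in time `f(k) · p(|x|)`, where `f` is computable, `p` is a polynomial, `k` is the parameter
and `|x|` is the length of the encoding (nothing is asked outside of the promise). -/
def ParamPromiseProblem.InFPQT (P : ParamPromiseProblem) : Prop :=
  ∃ (A : QuantumAlgorithm) (f : ℕ → ℕ) (p : Polynomial ℕ), Computable f ∧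
    (∀ I ∈ P.yes, A.AcceptsInTime (P.encode I) (f (P.param I) * p.eval (P.encode I).length)) ∧
    (∀ I ∈ P.no, A.RejectsInTime (P.encode I) (f (P.param I) * p.eval (P.encode I).length))

/-! ### The weighted local Hamiltonian problem -/

/-- The complex matrix with the given rational real and imaginary parts. -/
noncomputable def complexMatrix {ι : Type} (A B : Matrix ι ι ℚ) : Matrix ι ι ℂ :=
  fun x y => ((A x y : ℚ) : ℂ) + ((B x y : ℚ) : ℂ) * Complex.I

/-- An `ℓ`-local term on `n` qubits: a Hermitian operator of operator norm at most one on at most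
`ℓ` chosen distinct qubits; its matrix entries are Gaussian rationals. -/
structure LocalTerm (ℓ n : ℕ) where
  arity : ℕ
  arity_le : arity ≤ ℓ
  site : Fin arity ↪ Fin n
  re : Matrix (Bits arity) (Bits arity) ℚ
  im : Matrix (Bits arity) (Bits arity) ℚ
  hermitian : (complexMatrix re im).IsHermitian
  norm_le : ‖Matrix.toEuclideanCLM (𝕜 := ℂ) (complexMatrix re im)‖ ≤ 1

/-- The operator on all `n` qubits: the given operator on the chosen qubits, tensored with the
identity on the others. -/
noncomputable def LocalTerm.op {ℓ n : ℕ} (h : LocalTerm ℓ n) : Matrix (Bits n) (Bits n) ℂ :=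
  open Classical in
  fun x y => if ∀ q, q ∉ Set.range h.site → x q = y q
    then complexMatrix h.re h.im (x ∘ h.site) (y ∘ h.site) else 0

/-- Code of a square matrix of rationals: its entries row by row, where the basis states of `r`
qubits are numbered in binary. -/
def encMatrix {r : ℕ} (A : Matrix (Bits r) (Bits r) ℚ) : List Bool :=
  (List.finRange (2 ^ r)).flatMap fun i => (List.finRange (2 ^ r)).flatMap fun j =>
    encRat (A (finFunctionFinEquiv.symm i) (finFunctionFinEquiv.symm j))

def LocalTerm.encode {ℓ n : ℕ} (h : LocalTerm ℓ n) : List Bool :=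
  encUnary h.arity ++ ((List.finRange h.arity).flatMap (fun i => encUnary (h.site i)) ++
    (encMatrix h.re ++ encMatrix h.im))

/-- An `ℓ`-local Hamiltonian on `n` qubits, given by the list of its terms. -/
structure LocalHamiltonian (ℓ : ℕ) where
  n : ℕ
  terms : List (LocalTerm ℓ n)

noncomputable def LocalHamiltonian.op {ℓ : ℕ} (H : LocalHamiltonian ℓ) :
    Matrix (Bits H.n) (Bits H.n) ℂ :=
  (H.terms.map LocalTerm.op).sum

/-- The energy `⟨ψ|H|ψ⟩`, which is a real number as `H` is Hermitian. -/
noncomputable def LocalHamiltonian.energy {ℓ : ℕ} (H : LocalHamiltonian ℓ)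
    (ψ : EuclideanSpace ℂ (Bits H.n)) : ℝ :=
  (inner ℂ ψ (Matrix.toEuclideanCLM (𝕜 := ℂ) H.op ψ)).re

/-- `ψ` is an `n`-qubit quantum state of weight `k`: a unit vector supported on the basis states
of Hamming weight `k`. -/
def IsWeightState {n : ℕ} (k : ℕ) (ψ : EuclideanSpace ℂ (Bits n)) : Prop :=
  ‖ψ‖ = 1 ∧ ∀ x : Bits n, (Finset.univ.filter fun i => x i = 1).card ≠ k → ψ x = 0

/-- Weight-`k` `ℓ`-Local Hamiltonian with energy thresholds `a(n)` and `b(n)`, for Hamiltonians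
with at most `q(n)` terms. An instance is a Hamiltonian together with `k`, the parameter. -/
def weightLocalHamiltonian (ℓ : ℕ) (q : Polynomial ℕ) (a b : ℕ → ℝ) : ParamPromiseProblem where
  Inst := {H : LocalHamiltonian ℓ // H.terms.length ≤ q.eval H.n} × ℕ
  encode I := encUnary I.2 ++ (encUnary I.1.1.n ++ (encUnary I.1.1.terms.length ++
    I.1.1.terms.flatMap LocalTerm.encode))
  param I := I.2
  yes := {I | ∃ ψ : EuclideanSpace ℂ (Bits I.1.1.n),
    IsWeightState I.2 ψ ∧ I.1.1.energy ψ ≤ a I.1.1.n}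
  no := {I | ∀ ψ : EuclideanSpace ℂ (Bits I.1.1.n),
    IsWeightState I.2 ψ → b I.1.1.n ≤ I.1.1.energy ψ}

/-! ### Boolean circuits and weft -/

/-- A gate reading from `w` wires: an arbitrary gate with one or two inputs, or a large gate,
that is, a conjunction or a disjunction of arbitrarily many wires or a generalised Toffoli gate
(which adds the conjunction of the control wires to the target wire, modulo two). -/
inductive BoolGate (w : ℕ) : Type
  | unary (f : Bool → Bool) (i : Fin w)
  | binary (f : Bool → Bool → Bool) (i j : Fin w)
  | bigAnd (S : Finset (Fin w))
  | bigOr (S : Finset (Fin w))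
  | toffoli (S : Finset (Fin w)) (target : Fin w)

namespace BoolGate

def eval {w : ℕ} (v : Fin w → Bool) : BoolGate w → Bool
  | unary f i => f (v i)
  | binary f i j => f (v i) (v j)
  | bigAnd S => decide (∀ i ∈ S, v i = true)
  | bigOr S => decide (∃ i ∈ S, v i = true)
  | toffoli S t => xor (v t) (decide (∀ i ∈ S, v i = true))

/-- The wires that the gate reads. -/
def reads {w : ℕ} : BoolGate w → Finset (Fin w)
  | unary _ i => {i}
  | binary _ i j => {i, j}
  | bigAnd S => S
  | bigOr S => S
  | toffoli S t => insert t S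

/-- `1` for a large gate and `0` for a gate with one or two inputs. -/
def large {w : ℕ} : BoolGate w → ℕ
  | unary _ _ => 0
  | binary _ _ _ => 0
  | bigAnd _ => 1
  | bigOr _ => 1
  | toffoli _ _ => 1

/-- Code of a set of wires: its characteristic vector. -/
def encSet {w : ℕ} (S : Finset (Fin w)) : List Bool :=
  List.ofFn fun i : Fin w => decide (i ∈ S)

def encode {w : ℕ} : BoolGate w → List Bool
  | unary f i => [false, false, false, f false, f true] ++ encUnary i
  | binary f i j =>
      [false, false, true, f false false, f false true, f true false, f true true] ++
        (encUnary i ++ encUnary j)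
  | bigAnd S => [false, true, false] ++ encSet S
  | bigOr S => [false, true, true] ++ encSet S
  | toffoli S t => [true, false, false] ++ (encSet S ++ encUnary t)

end BoolGate

/-- A Boolean circuit with one output. The wires `0, …, inputs - 1` carry the inputs and the wire
`inputs + i` carries the value of gate `i`, which may read all the wires before it. -/
structure BoolCircuit where
  inputs : ℕ
  size : ℕ
  gate : (i : Fin size) → BoolGate (inputs + i)
  output : Fin (inputs + size)

namespace BoolCircuit

/-- The values of the inputs and of the first `i` gates on the input vector `x`. -/
def wires (C : BoolCircuit) (x : Fin C.inputs → Bool) :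
    (i : ℕ) → i ≤ C.size → (Fin (C.inputs + i) → Bool)
  | 0, _ => x
  | i + 1, h =>
      let v := C.wires x i (Nat.le_of_succ_le h)
      Fin.snoc (α := fun _ => Bool) v ((C.gate ⟨i, h⟩).eval v)

/-- The output `C(x)`. -/
def eval (C : BoolCircuit) (x : Fin C.inputs → Bool) : Bool :=
  C.wires x C.size le_rfl C.output

def Satisfiable (C : BoolCircuit) : Prop :=
  ∃ x : Fin C.inputs → Bool, C.eval x = true

/-- `C.Path w m`: some path from an input to the wire `w` goes through exactly `m` large gates. -/
inductive Path (C : BoolCircuit) : Fin (C.inputs + C.size) → ℕ → Prop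
  | input (i : Fin C.inputs) : Path C (Fin.castAdd C.size i) 0
  | gate (i : Fin C.size) (j : Fin (C.inputs + i)) (m : ℕ) (hj : j ∈ (C.gate i).reads)
      (hm : Path C (Fin.castLE (Nat.add_le_add_left i.isLt.le C.inputs) j) m) :
      Path C (Fin.natAdd C.inputs i) (m + (C.gate i).large)

/-- The circuit has weft at most `t`: every path from an input to the output goes through at most
`t` large gates. -/
def WeftLE (C : BoolCircuit) (t : ℕ) : Prop :=
  ∀ m, C.Path C.output m → m ≤ t

/-- The total description size: the least bound on the number of inputs and on the number of
gates. -/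
def descriptionSize (C : BoolCircuit) : ℕ :=
  max C.inputs C.size

def encode (C : BoolCircuit) : List Bool :=
  encUnary C.inputs ++ (encUnary C.size ++
    ((List.finRange C.size).flatMap (fun i => (C.gate i).encode) ++ encUnary C.output))

end BoolCircuit

/-! ### The quantum-classical exponential time hypothesis -/

/-- `T(n) ≤ 2^{o(n)}`. -/
def IsSubexponential (T : ℕ → ℕ) : Prop :=
  ∃ g : ℕ → ℝ, g =o[Filter.atTop] (fun n => (n : ℝ)) ∧ ∀ n, (T n : ℝ) ≤ (2 : ℝ) ^ g n

/-- The quantum-classical exponential time hypothesis: no quantum algorithm running in time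
`2^{o(n)}` decides, for a weft-`1` Boolean circuit of total description size `n`, whether it is
satisfiable. -/
def QCETH : Prop :=
  ¬ ∃ (A : QuantumAlgorithm) (T : ℕ → ℕ), IsSubexponential T ∧
    ∀ C : BoolCircuit, C.WeftLE 1 →
      (C.Satisfiable → A.AcceptsInTime C.encode (T C.descriptionSize)) ∧
      (¬ C.Satisfiable → A.RejectsInTime C.encode (T C.descriptionSize))

/-! ### A structured language over stacks, compiled to Turing machines -/

namespace StackProg

open Function (update)

/-- A finite control value together with the contents of all stacks. -/
@[ext] structure Store {K : Type} (Γ : K → Type) (σ : Type) where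
  var : σ
  stk : ∀ k, List (Γ k)

/-- Structured programs over stacks. `popCase` pops a symbol and branches on it, `loop` repeats its
body as long as a test of the control value and of the top of a stack succeeds. -/
inductive Cmd {K : Type} (Γ : K → Type) (σ Δ : Type) : Type
  | push (k : K) (f : σ → Γ k)
  | pop (k : K) (f : σ → Option (Γ k) → σ)
  | peek (k : K) (f : σ → Option (Γ k) → σ)
  | load (f : σ → σ)
  | seq (p q : Cmd Γ σ Δ)
  | choose (f : σ → Cmd Γ σ Δ)
  | popCase (k : K) (h : Option (Γ k) → Δ) (g : Δ → Cmd Γ σ Δ)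
  | loop (k : K) (c : σ → Option (Γ k) → Bool) (p : Cmd Γ σ Δ)

/-- `Iter c R n s s'`: iterating `R` exactly `n` times, as long as `c` holds, leads from `s` to
`s'`, where `c` fails. -/
inductive Iter {α : Type*} (c : α → Prop) (R : α → α → Prop) : ℕ → α → α → Prop
  | finish {s : α} (h : ¬ c s) : Iter c R 0 s s
  | step {s m s' : α} {n : ℕ} (h : c s) (h₁ : R s m) (h₂ : Iter c R n m s') :
      Iter c R (n + 1) s s'

namespace Cmd

variable {K : Type} [DecidableEq K] {Γ : K → Type} {σ Δ : Type}

/-- Big-step semantics of programs, where every loop makes at most `M` iterations. -/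
def Exec (M : ℕ) : Cmd Γ σ Δ → Store Γ σ → Store Γ σ → Prop
  | push k f, s, s' => s' = ⟨s.var, update s.stk k (f s.var :: s.stk k)⟩
  | pop k f, s, s' => s' = ⟨f s.var (s.stk k).head?, update s.stk k (s.stk k).tail⟩
  | peek k f, s, s' => s' = ⟨f s.var (s.stk k).head?, s.stk⟩
  | load f, s, s' => s' = ⟨f s.var, s.stk⟩
  | seq p q, s, s' => ∃ m, Exec M p s m ∧ Exec M q m s'
  | choose f, s, s' => Exec M (f s.var) s s'
  | popCase k h g, s, s' =>
      Exec M (g (h (s.stk k).head?)) ⟨s.var, update s.stk k (s.stk k).tail⟩ s'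
  | loop k c p, s, s' =>
      ∃ n ≤ M, Iter (fun s => c s.var (s.stk k).head? = true) (Exec M p) n s s'

/-- A bound on the number of steps of a program all of whose loops make at most `M` iterations. -/
def cost [Fintype σ] [Fintype Δ] (M : ℕ) : Cmd Γ σ Δ → ℕ
  | push _ _ => 1
  | pop _ _ => 1
  | peek _ _ => 1
  | load _ => 1
  | seq p q => 1 + (cost M p + cost M q)
  | choose f => 1 + ∑ v, cost M (f v)
  | popCase _ _ g => 1 + ∑ d, cost M (g d)
  | loop _ _ p => M * (1 + cost M p) + 1

-- Loops are nested to a depth fixed by the program, and each level multiplies the cost by about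
-- `M`. This reduces every later running-time estimate to a bound on iteration counts.
omit [DecidableEq K] in
theorem cost_le_pow [Fintype σ] [Fintype Δ] (c : Cmd Γ σ Δ) :
    ∃ e, ∀ M, c.cost M ≤ (M + 2) ^ e := by
  -- The base is `M + 2` rather than `M` so that it is at least two: one extra factor then absorbs a
  -- sum of two powers.
  have hadd : ∀ {M a b i j : ℕ}, a ≤ (M + 2) ^ i → b ≤ (M + 2) ^ j →
      a + b ≤ (M + 2) ^ (i + j + 1) := by
    intro M a b i j ha hb
    have h1 : (M + 2) ^ i ≤ (M + 2) ^ (i + j) := Nat.pow_le_pow_right (by omega) (by omega)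
    have h2 : (M + 2) ^ j ≤ (M + 2) ^ (i + j) := Nat.pow_le_pow_right (by omega) (by omega)
    rw [pow_succ]
    nlinarith [Nat.zero_le M, Nat.zero_le ((M + 2) ^ (i + j))]
  have hone : ∀ M : ℕ, 1 ≤ (M + 2) ^ 0 := by simp
  have hsum : ∀ {ι : Type} [Fintype ι] (f : ι → ℕ → ℕ), (∀ i, ∃ e, ∀ M, f i M ≤ (M + 2) ^ e) →
      ∃ e, ∀ M, 1 + ∑ i, f i M ≤ (M + 2) ^ e := by
    intro ι _ f hf
    classical
    suffices ∀ S : Finset ι, ∃ e, ∀ M, 1 + ∑ i ∈ S, f i M ≤ (M + 2) ^ e from this Finset.univ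
    intro S
    induction S using Finset.induction_on with
    | empty => exact ⟨0, by simp⟩
    | insert a S ha ih =>
      obtain ⟨e, he⟩ := ih
      obtain ⟨e', he'⟩ := hf a
      refine ⟨e' + e + 1, fun M => ?_⟩
      rw [Finset.sum_insert ha, add_left_comm]
      exact hadd (he' M) (he M)
  induction c with
  | push | pop | peek | load => exact ⟨0, by simp [cost]⟩
  | seq p q ihp ihq =>
    obtain ⟨i, hi⟩ := ihp
    obtain ⟨j, hj⟩ := ihq
    exact ⟨_, fun M => hadd (hone M) (hadd (hi M) (hj M))⟩
  | choose f ih => exact hsum (fun v M => (f v).cost M) ih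
  | popCase k h g ih => exact hsum (fun v M => (g v).cost M) ih
  | loop k c p ih =>
    obtain ⟨i, hi⟩ := ih
    refine ⟨(1 + (0 + i + 1)) + 0 + 1, fun M => hadd ?_ (hone M)⟩
    rw [pow_add, pow_one]
    exact Nat.mul_le_mul (by omega) (hadd (hone M) (hi M))

/-- The lists of pending commands that occur during the execution of a command with continuation
`l`. -/
def conts : Cmd Γ σ Δ → List (Cmd Γ σ Δ) → Set (List (Cmd Γ σ Δ))
  | push k f, l => {push k f :: l}
  | pop k f, l => {pop k f :: l}
  | peek k f, l => {peek k f :: l}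
  | load f, l => {load f :: l}
  | seq p q, l => insert (seq p q :: l) (conts p (q :: l) ∪ conts q l)
  | choose f, l => insert (choose f :: l) (⋃ v, conts (f v) l)
  | popCase k h g, l => insert (popCase k h g :: l) (⋃ d, conts (g d) l)
  | loop k c p, l => insert (loop k c p :: l) (conts p (loop k c p :: l))

omit [DecidableEq K] in
theorem mem_conts (c : Cmd Γ σ Δ) (l : List (Cmd Γ σ Δ)) : c :: l ∈ c.conts l := by
  cases c <;> simp [conts]

-- Lists of pending commands serve as labels of the compiled machine, so there must be finitely
-- many. The recursion is on the command: the body of a loop has the loop itself in its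
-- continuation, but the loop is not unfolded again.
omit [DecidableEq K] in
theorem finite_conts [Finite σ] [Finite Δ] (c : Cmd Γ σ Δ) (l : List (Cmd Γ σ Δ)) :
    (c.conts l).Finite := by
  induction c generalizing l with
  | push | pop | peek | load => simp [conts]
  | seq p q ihp ihq => exact ((ihp _).union (ihq _)).insert _
  | choose f ih => exact (Set.finite_iUnion fun v => ih v l).insert _
  | popCase k h g ih => exact (Set.finite_iUnion fun v => ih v l).insert _
  | loop k c p ih => exact (ih _).insert _

/-- The statement executed by the compiled machine when the given commands are pending. -/
def compile {Λ : Type} (lab : List (Cmd Γ σ Δ) → Λ) (v₀ : σ) :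
    List (Cmd Γ σ Δ) → Turing.TM2.Stmt Γ Λ (σ × Option Δ × Bool)
  -- A halting configuration is required to carry the initial control value, hence the reset.
  | [] => .load (fun _ => (v₀, none, false)) .halt
  | push k f :: l => .push k (fun v => f v.1) (.goto fun _ => lab l)
  | pop k f :: l => .pop k (fun v o => (f v.1 o, v.2)) (.goto fun _ => lab l)
  | peek k f :: l => .peek k (fun v o => (f v.1 o, v.2)) (.goto fun _ => lab l)
  | load f :: l => .load (fun v => (f v.1, v.2)) (.goto fun _ => lab l)
  | seq p q :: l => .goto fun _ => lab (p :: q :: l)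
  | choose f :: l => .goto fun v => lab (f v.1 :: l)
  -- A `goto` sees only the control value, so the branch selected by the popped symbol is stored
  -- there; the Boolean component does the same for loop tests.
  | popCase k h g :: l => .pop k (fun v o => (v.1, some (h o), v.2.2))
      (.goto fun v => lab (match v.2.1 with | some d => g d :: l | none => l))
  | loop k c p :: l => .peek k (fun v o => (v.1, v.2.1, c v.1 o))
      (.branch (fun v => v.2.2) (.goto fun _ => lab (p :: loop k c p :: l)) (.goto fun _ => lab l))

end Cmd

/-- Iterating the partial function `f` at most `n` times leads from `a` to `b`. -/
def StepsTo {α : Type*} (f : α → Option α) (n : ℕ) (a b : α) : Prop :=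
  ∃ m ≤ n, (flip bind f)^[m] (some a) = some b

theorem StepsTo.refl {α : Type*} (f : α → Option α) (a : α) : StepsTo f 0 a a := ⟨0, le_rfl, rfl⟩

theorem StepsTo.trans {α : Type*} {f : α → Option α} {n n' : ℕ} {a b c : α}
    (h : StepsTo f n a b) (h' : StepsTo f n' b c) : StepsTo f (n + n') a c := by
  obtain ⟨m, hm, e⟩ := h
  obtain ⟨m', hm', e'⟩ := h'
  exact ⟨m' + m, by omega, by rw [Function.iterate_add_apply, e, e']⟩

theorem StepsTo.single {α : Type*} {f : α → Option α} {a b : α} (h : f a = some b) :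
    StepsTo f 1 a b := ⟨1, le_rfl, h⟩

theorem StepsTo.mono {α : Type*} {f : α → Option α} {n n' : ℕ} {a b : α}
    (h : StepsTo f n a b) (hn : n ≤ n') : StepsTo f n' a b := by
  obtain ⟨m, hm, e⟩ := h
  exact ⟨m, by omega, e⟩

namespace Cmd

variable {K : Type} [DecidableEq K] {Γ : K → Type} {σ Δ : Type}

/-- Simulation of the big-step semantics by induction on the command. The set `S` of labels contains
all continuations of `c`, hence those of each subcommand with its own continuation. The auxiliary
part `d` of the control value carries no information between commands. -/
theorem Exec.stepsTo [Fintype σ] [Fintype Δ] {Λ : Type} {lab : List (Cmd Γ σ Δ) → Λ} {v₀ : σ}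
    {m : Λ → Turing.TM2.Stmt Γ Λ (σ × Option Δ × Bool)} {S : Set (List (Cmd Γ σ Δ))}
    (hm : ∀ l ∈ S, m (lab l) = compile lab v₀ l) {M : ℕ} (c : Cmd Γ σ Δ)
    {l : List (Cmd Γ σ Δ)} (hl : c.conts l ⊆ S) {s s' : Store Γ σ} (h : c.Exec M s s')
    (d : Option Δ × Bool) :
    ∃ d', StepsTo (Turing.TM2.step m) (c.cost M) ⟨some (lab (c :: l)), (s.var, d), s.stk⟩
      ⟨some (lab l), (s'.var, d'), s'.stk⟩ := by
  have hm0 := hm _ (hl (mem_conts c l))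
  induction c generalizing l s s' d with
  | push k f | pop k f | peek k f | load f =>
    subst h
    exact ⟨d, StepsTo.single (by simp [Turing.TM2.step, hm0, compile])⟩
  | seq p q ihp ihq =>
    obtain ⟨t, h1, h2⟩ := h
    have hp : p.conts (q :: l) ⊆ S := fun x hx => hl (Or.inr (Or.inl hx))
    have hq : q.conts l ⊆ S := fun x hx => hl (Or.inr (Or.inr hx))
    obtain ⟨d1, e1⟩ := ihp hp h1 d (hm _ (hp (mem_conts _ _)))
    obtain ⟨d2, e2⟩ := ihq hq h2 d1 (hm _ (hq (mem_conts _ _)))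
    exact ⟨d2, (StepsTo.single (by simp [Turing.TM2.step, hm0, compile])).trans (e1.trans e2)⟩
  | choose f ih =>
    have hf : (f s.var).conts l ⊆ S := fun x hx => hl (Or.inr (Set.mem_iUnion.2 ⟨_, hx⟩))
    obtain ⟨d1, e1⟩ := ih _ hf h d (hm _ (hf (mem_conts _ _)))
    refine ⟨d1, ((StepsTo.single (by simp [Turing.TM2.step, hm0, compile])).trans e1).mono ?_⟩
    exact Nat.add_le_add_left
      (Finset.single_le_sum (f := fun v => (f v).cost M) (fun _ _ => Nat.zero_le _)
        (Finset.mem_univ s.var)) 1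
  | popCase k g f ih =>
    have hf : (f (g (s.stk k).head?)).conts l ⊆ S :=
      fun x hx => hl (Or.inr (Set.mem_iUnion.2 ⟨_, hx⟩))
    obtain ⟨d1, e1⟩ := ih _ hf h (some (g (s.stk k).head?), d.2) (hm _ (hf (mem_conts _ _)))
    refine ⟨d1, ((StepsTo.single (by simp [Turing.TM2.step, hm0, compile])).trans e1).mono ?_⟩
    exact Nat.add_le_add_left
      (Finset.single_le_sum (f := fun v => (f v).cost M) (fun _ _ => Nat.zero_le _)
        (Finset.mem_univ (g (s.stk k).head?))) 1
  | loop k c p ih =>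
    obtain ⟨n, hn, h⟩ := h
    have hp : p.conts (loop k c p :: l) ⊆ S := fun x hx => hl (Or.inr hx)
    -- The bound is proved with the exact number `n` of iterations, which is what an induction on
    -- `Iter` can use.
    suffices H : ∃ d', StepsTo (Turing.TM2.step m) (n * (1 + p.cost M) + 1)
        ⟨some (lab (loop k c p :: l)), (s.var, d), s.stk⟩
        ⟨some (lab l), (s'.var, d'), s'.stk⟩ by
      obtain ⟨d', e⟩ := H
      exact ⟨d', e.mono (Nat.add_le_add_right (Nat.mul_le_mul_right _ hn) 1)⟩
    clear hn
    induction h generalizing d with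
    | @finish s h =>
      refine ⟨(d.1, c s.var (s.stk k).head?), (StepsTo.single ?_).mono (by omega)⟩
      have h : c s.var (s.stk k).head? = false := by simpa using h
      simp [Turing.TM2.step, hm0, compile, h]
    | @step s t s' n h h1 h2 ih2 =>
      obtain ⟨d1, e1⟩ := ih hp h1 (d.1, true) (hm _ (hp (mem_conts _ _)))
      obtain ⟨d2, e2⟩ := ih2 d1
      refine ⟨d2, ((StepsTo.single ?_).trans (e1.trans e2)).mono (Nat.le_of_eq (by ring))⟩
      have h : c s.var (s.stk k).head? = true := h
      simp [Turing.TM2.step, hm0, compile, h]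

/-- Stacks that are all empty except for one. -/
abbrev single (k : K) (x : List (Γ k)) : ∀ k, List (Γ k) := update (fun _ => []) k x

theorem initList_eq (tm : Turing.FinTM2) (x : List (tm.Γ tm.k₀)) :
    Turing.initList tm x = ⟨some tm.main, tm.initialState, single tm.k₀ x⟩ := by
  have : (Turing.initList tm x).stk = single tm.k₀ x := by
    funext k
    by_cases hk : k = tm.k₀
    · subst hk
      simp [Turing.initList]
    · simp [Turing.initList, hk]
  exact congrArg (Turing.TM2.Cfg.mk (some tm.main) tm.initialState) this

theorem haltList_eq (tm : Turing.FinTM2) (x : List (tm.Γ tm.k₁)) :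
    Turing.haltList tm x = ⟨none, tm.initialState, single tm.k₁ x⟩ := by
  have : (Turing.haltList tm x).stk = single tm.k₁ x := by
    funext k
    by_cases hk : k = tm.k₁
    · subst hk
      simp [Turing.haltList]
    · simp [Turing.haltList, hk]
  exact congrArg (Turing.TM2.Cfg.mk none tm.initialState) this

/-- The machine turns the input `x` into the output `y` in at most `n` steps. -/
def Outputs (tm : Turing.FinTM2) (x : List (tm.Γ tm.k₀)) (y : List (tm.Γ tm.k₁)) (n : ℕ) : Prop :=
  StepsTo (Turing.TM2.step tm.m) n ⟨some tm.main, tm.initialState, single tm.k₀ x⟩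
    ⟨none, tm.initialState, single tm.k₁ y⟩

theorem outputs_iff (tm : Turing.FinTM2) (x : List (tm.Γ tm.k₀)) (y : List (tm.Γ tm.k₁)) (n : ℕ) :
    Nonempty (Turing.TM2OutputsInTime tm x (some y) n) ↔ Outputs tm x y n := by
  have hh : Option.map (Turing.haltList tm) (some y) =
      some ⟨none, tm.initialState, single tm.k₁ y⟩ := congrArg some (haltList_eq tm y)
  constructor
  · rintro ⟨⟨⟨m, h⟩, hm⟩⟩
    refine ⟨m, hm, ?_⟩
    rw [hh, initList_eq] at h
    exact h
  · rintro ⟨m, hm, h⟩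
    refine ⟨⟨⟨m, ?_⟩, hm⟩⟩
    rw [hh, initList_eq]
    exact h

/-! ### The Turing machine of a program -/

section machine

variable [Fintype K] [Fintype σ] [Fintype Δ]

/-- The labels of the machine of a program. -/
abbrev Label (c : Cmd Γ σ Δ) : Type := {l : List (Cmd Γ σ Δ) // l ∈ insert [] (c.conts [])}

open Classical in
/-- The label for a list of pending commands. -/
noncomputable def lab (c : Cmd Γ σ Δ) (l : List (Cmd Γ σ Δ)) : c.Label :=
  if h : l ∈ insert [] (c.conts []) then ⟨l, h⟩ else ⟨[], Or.inl rfl⟩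

/-- The Turing machine of a program. -/
noncomputable def toFinTM2 (c : Cmd Γ σ Δ) (v₀ : σ) (k₀ k₁ : K) [Fintype (Γ k₀)] :
    Turing.FinTM2 where
  K := K
  k₀ := k₀
  k₁ := k₁
  Γ := Γ
  Λ := c.Label
  main := c.lab [c]
  ΛFin := ((c.finite_conts []).insert []).fintype
  σ := σ × Option Δ × Bool
  initialState := (v₀, none, false)
  m l := compile c.lab v₀ l.1

theorem Exec.outputs {c : Cmd Γ σ Δ} {v₀ v : σ} {k₀ k₁ : K} [Fintype (Γ k₀)] {M : ℕ}
    {x : List (Γ k₀)} {y : List (Γ k₁)}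
    (h : c.Exec M ⟨v₀, single k₀ x⟩ ⟨v, single k₁ y⟩) :
    Outputs (c.toFinTM2 v₀ k₀ k₁) x y (c.cost M + 1) := by
  have hm : ∀ l ∈ insert [] (c.conts []), (c.toFinTM2 v₀ k₀ k₁).m (c.lab l) =
      compile c.lab v₀ l := by
    intro l hl
    simp only [toFinTM2, lab, dif_pos hl]
  obtain ⟨d', e⟩ := Exec.stepsTo hm c (Set.subset_insert _ _) h (none, false)
  -- The additional step executes the empty list of commands, which resets the control value and
  -- halts.
  refine e.trans (StepsTo.single ?_)
  simp only [Turing.TM2.step]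
  rw [hm [] (Or.inl rfl)]
  simp only [compile, Turing.TM2.stepAux]
  rfl

end machine

end Cmd

end StackProg

/-! ### Basic routines -/

namespace StackProg

open Function (update)

namespace Cmd

variable {K : Type} [DecidableEq K] {Γ₀ σ : Type}

/-- Programs all of whose stacks have the same alphabet. -/
abbrev UCmd (K Γ₀ σ : Type) : Type := Cmd (fun _ : K => Γ₀) σ (Option Γ₀)

/-- Do nothing. -/
def skip {K : Type} {Γ : K → Type} {σ Δ : Type} : Cmd Γ σ Δ := load id

theorem exec_seq {Γ : K → Type} {Δ : Type} {M : ℕ} {p q : Cmd Γ σ Δ} {s t u : Store Γ σ}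
    (h₁ : p.Exec M s t) (h₂ : q.Exec M t u) : (seq p q).Exec M s u := ⟨t, h₁, h₂⟩

/-- Pop the symbols of a stack one after the other and run the program given by each of them. -/
def drain (a : K) (g : Γ₀ → UCmd K Γ₀ σ) : UCmd K Γ₀ σ :=
  loop a (fun _ o => o.isSome) (popCase a id fun o => o.elim skip g)

/-- Loop rule with an invariant: `st pre l` is the store when the prefix `pre` has been consumed and
`l` is left. It suffices to check one transition, in which the symbol has already been popped. -/
theorem exec_loop_popCase {Γ : K → Type} {Δ : Type} {M : ℕ} {a : K} {h : Option (Γ a) → Δ}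
    {g : Δ → Cmd Γ σ Δ} {l₀ : List (Γ a)} (st : List (Γ a) → List (Γ a) → Store Γ σ)
    (hst : ∀ pre l, pre ++ l = l₀ → (st pre l).stk a = l)
    (hstep : ∀ pre c l, pre ++ c :: l = l₀ → (g (h (some c))).Exec M
      ⟨(st pre (c :: l)).var, update (st pre (c :: l)).stk a l⟩ (st (pre ++ [c]) l))
    (hM : l₀.length ≤ M) :
    (loop a (fun _ o => o.isSome) (popCase a h g)).Exec M (st [] l₀) (st l₀ []) := by
  refine ⟨l₀.length, hM, ?_⟩
  suffices H : ∀ l pre, pre ++ l = l₀ →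
      Iter (fun s : Store Γ σ => (s.stk a).head?.isSome = true)
        (Exec M (popCase a h g)) l.length (st pre l) (st l₀ []) from
    H l₀ [] rfl
  intro l
  induction l with
  | nil =>
    intro pre h
    have := hst pre [] h
    rw [List.append_nil] at h
    subst h
    exact .finish (by simp [this])
  | cons c l ih =>
    intro pre h
    have h1 := hst pre (c :: l) h
    refine .step (m := st (pre ++ [c]) l) (by simp [h1]) ?_ (ih _ (by simpa using h))
    have h2 := hstep pre c l h
    simpa [Exec, h1] using h2

theorem exec_drain {M : ℕ} {a : K} {g : Γ₀ → UCmd K Γ₀ σ} {l₀ : List Γ₀}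
    (st : List Γ₀ → List Γ₀ → Store (fun _ : K => Γ₀) σ)
    (hst : ∀ pre l, pre ++ l = l₀ → (st pre l).stk a = l)
    (hstep : ∀ pre c l, pre ++ c :: l = l₀ →
      (g c).Exec M ⟨(st pre (c :: l)).var, update (st pre (c :: l)).stk a l⟩ (st (pre ++ [c]) l))
    (hM : l₀.length ≤ M) : (drain a g).Exec M (st [] l₀) (st l₀ []) :=
  exec_loop_popCase (g := fun o : Option Γ₀ => o.elim skip g) st hst hstep hM

/-- Loop over a stack in unary. -/
theorem exec_drain_replicate {M : ℕ} {a : K} {g : Γ₀ → UCmd K Γ₀ σ} {n : ℕ} {c : Γ₀}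
    (st : ℕ → Store (fun _ : K => Γ₀) σ)
    (hst : ∀ i ≤ n, (st i).stk a = List.replicate (n - i) c)
    (hstep : ∀ i < n,
      (g c).Exec M ⟨(st i).var, update (st i).stk a (List.replicate (n - (i + 1)) c)⟩ (st (i + 1)))
    (hM : n ≤ M) : (drain a g).Exec M (st 0) (st n) := by
  have := exec_drain (M := M) (a := a) (g := g) (l₀ := List.replicate n c)
    (fun pre _ => st pre.length) (fun pre l h => ?_) (fun pre d l h => ?_) (by simpa using hM)
  · simpa using this
  · have h3 := congrArg List.length h
    simp only [List.length_append, List.length_replicate] at h3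
    have : l = List.replicate (n - pre.length) c := by
      refine List.eq_replicate_iff.2 ⟨by omega, fun b hb => ?_⟩
      exact List.eq_of_mem_replicate (h ▸ List.mem_append_right _ hb)
    rw [this]
    exact hst _ (by omega)
  · have h3 := congrArg List.length h
    simp only [List.length_append, List.length_replicate, List.length_cons] at h3
    have hd : d = c := List.eq_of_mem_replicate (n := n) (h ▸ by simp)
    have : l = List.replicate (n - (pre.length + 1)) c := by
      refine List.eq_replicate_iff.2 ⟨by omega, fun b hb => ?_⟩
      exact List.eq_of_mem_replicate (n := n) (h ▸ by simp [hb])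
    subst hd
    rw [this]
    simpa using hstep pre.length (by omega)

/-- Move the contents of one stack to another one, in reversed order. -/
def move (a b : K) : UCmd K Γ₀ σ := drain a fun c => push b fun _ => c

theorem exec_move {M : ℕ} {a b : K} (hab : a ≠ b) (v : σ) (s : K → List Γ₀)
    (hM : (s a).length ≤ M) :
    (move a b).Exec M ⟨v, s⟩ ⟨v, update (update s a []) b ((s a).reverse ++ s b)⟩ := by
  have := exec_drain (M := M) (a := a) (g := fun c => push (σ := σ) (Δ := Option Γ₀) b fun _ => c)
    (l₀ := s a) (fun pre l => ⟨v, update (update s a l) b (pre.reverse ++ s b)⟩)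
    (fun pre l _ => by simp [hab]) (fun pre c l _ => ?_) hM
  · simpa [move] using this
  · simp only [Exec, Store.mk.injEq, true_and]
    funext k
    by_cases hk : k = a <;> by_cases hb : k = b <;> simp_all [Function.update_apply]

/-- Push a copy of the contents of the stack `a` on the stack `b`. -/
def copy (a b t : K) : UCmd K Γ₀ σ :=
  seq (move a t) (drain t fun c => seq (push a fun _ => c) (push b fun _ => c))

/-- The detour through `t` reverses the word twice, so both the original and the copy end up in the
right order. -/
theorem exec_copy {M : ℕ} {a b t : K} (hab : a ≠ b) (hat : a ≠ t) (hbt : b ≠ t) (v : σ)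
    (s : K → List Γ₀) (ht : s t = []) (hM : (s a).length ≤ M) :
    (copy a b t).Exec M ⟨v, s⟩ ⟨v, update s b (s a ++ s b)⟩ := by
  refine exec_seq (exec_move hat v s hM) ?_
  have := exec_drain (M := M) (a := t)
    (g := fun c => seq (push (σ := σ) (Δ := Option Γ₀) a fun _ => c) (push b fun _ => c))
    (l₀ := (s a).reverse) (fun pre l => ⟨v, update (update (update s t l) a pre.reverse) b
      (pre.reverse ++ s b)⟩)
    (fun pre l _ => by simp [hat.symm, hbt.symm]) (fun pre c l _ => ?_) (by simpa using hM)
  · convert this using 2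
    · funext k
      by_cases hk : k = a <;> by_cases hb : k = b <;> by_cases h : k = t <;>
        simp_all [Function.update_apply]
    · funext k
      by_cases hk : k = a <;> by_cases hb : k = b <;> by_cases h : k = t <;>
        simp_all [Function.update_apply]
  · refine exec_seq rfl ?_
    simp only [Exec, Store.mk.injEq, true_and]
    funext k
    by_cases hk : k = a <;> by_cases hb : k = b <;> by_cases h : k = t <;>
      simp_all

/-- Empty a stack. -/
def clear (a : K) : UCmd K Γ₀ σ := drain a fun _ => skip

theorem exec_clear {M : ℕ} {a : K} (v : σ) (s : K → List Γ₀) (hM : (s a).length ≤ M) :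
    (clear a).Exec M ⟨v, s⟩ ⟨v, update s a []⟩ := by
  have := exec_drain (M := M) (a := a) (g := fun c => skip (σ := σ) (Δ := Option Γ₀))
    (l₀ := s a) (fun pre l => ⟨v, update s a l⟩)
    (fun pre l _ => by simp) (fun pre c l _ => ?_) hM
  · simpa [clear] using this
  · simp [skip, Exec]

/-- Push a fixed word. -/
def pushList (a : K) : List Γ₀ → UCmd K Γ₀ σ
  | [] => skip
  | c :: l => seq (pushList a l) (push a fun _ => c)

theorem exec_pushList {M : ℕ} {a : K} (l : List Γ₀) (v : σ) (s : K → List Γ₀) :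
    (pushList a l).Exec M ⟨v, s⟩ ⟨v, update s a (l ++ s a)⟩ := by
  induction l with
  | nil => simp [pushList, skip, Exec]
  | cons c l ih => exact exec_seq ih (by simp [Exec])

end Cmd

end StackProg

/-! ### Combining programs and machines -/

namespace StackProg

open Function (update)

section join

variable {K₁ K₂ : Type} [DecidableEq K₁] [DecidableEq K₂]

/-- The alphabets of two families of stacks side by side. -/
abbrev SumΓ (Γ₁ : K₁ → Type) (Γ₂ : K₂ → Type) : K₁ ⊕ K₂ → Type
  | .inl k => Γ₁ k
  | .inr k => Γ₂ k

variable {Γ₁ : K₁ → Type} {Γ₂ : K₂ → Type}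

/-- Two families of stacks side by side. -/
def join (S : ∀ k, List (Γ₁ k)) (T : ∀ k, List (Γ₂ k)) : ∀ k, List (SumΓ Γ₁ Γ₂ k)
  | .inl k => S k
  | .inr k => T k

omit [DecidableEq K₁] [DecidableEq K₂] in
@[simp] theorem join_inl (S : ∀ k, List (Γ₁ k)) (T : ∀ k, List (Γ₂ k)) (k : K₁) :
    join S T (.inl k) = S k := rfl

omit [DecidableEq K₁] [DecidableEq K₂] in
@[simp] theorem join_inr (S : ∀ k, List (Γ₁ k)) (T : ∀ k, List (Γ₂ k)) (k : K₂) :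
    join S T (.inr k) = T k := rfl

@[simp] theorem update_join_inl (S : ∀ k, List (Γ₁ k)) (T : ∀ k, List (Γ₂ k)) (k : K₁)
    (x : List (Γ₁ k)) :
    update (join S T) (.inl k) x = join (update S k x) T := by
  funext j
  rcases j with j | j
  · by_cases h : j = k
    · subst h; simp
    · simp [h]
  · simp

@[simp] theorem update_join_inr (S : ∀ k, List (Γ₁ k)) (T : ∀ k, List (Γ₂ k)) (k : K₂)
    (x : List (Γ₂ k)) :
    update (join S T) (.inr k) x = join S (update T k x) := by
  funext j
  rcases j with j | j
  · simp
  · by_cases h : j = k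
    · subst h; simp
    · simp [h]

end join

namespace Cmd

/-! ### A frame rule for programs -/

section lift

variable {K₁ K₂ : Type} [DecidableEq K₁] [DecidableEq K₂]
variable {Γ₁ : K₁ → Type} {Γ₂ : K₂ → Type} {σ τ Δ : Type}

/-- A program acting on the first of two families of stacks. -/
def lift : Cmd Γ₁ σ Δ → Cmd (SumΓ Γ₁ Γ₂) (σ × τ) Δ
  | push k f => push (.inl k) fun v => f v.1
  | pop k f => pop (.inl k) fun v o => (f v.1 o, v.2)
  | peek k f => peek (.inl k) fun v o => (f v.1 o, v.2)
  | load f => load fun v => (f v.1, v.2)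
  | seq p q => seq (lift p) (lift q)
  | choose f => choose fun v => lift (f v.1)
  | popCase k h g => popCase (.inl k) h fun d => lift (g d)
  | loop k c p => loop (.inl k) (fun v o => c v.1 o) (lift p)

/-- Frame rule: a lifted program never touches the second family of stacks nor the second control
component. It allows routines to be verified on their own stacks and used next to a machine. -/
theorem Exec.lift {M : ℕ} {c : Cmd Γ₁ σ Δ} {s s' : Store Γ₁ σ} (h : c.Exec M s s') (t : τ)
    (T : ∀ k, List (Γ₂ k)) :
    (Cmd.lift c).Exec M ⟨(s.var, t), join s.stk T⟩ ⟨(s'.var, t), join s'.stk T⟩ := by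
  induction c generalizing s s' with
  | push | pop | peek | load => subst h; simp [Cmd.lift, Exec]
  | seq p q ihp ihq =>
    obtain ⟨m, h1, h2⟩ := h
    exact ⟨_, ihp h1, ihq h2⟩
  | choose f ih => exact ih _ h
  | popCase k g f ih =>
    have := ih _ h
    simpa [Cmd.lift, Exec] using this
  | loop k c p ih =>
    obtain ⟨n, hn, h⟩ := h
    refine ⟨n, hn, ?_⟩
    clear hn
    induction h with
    | finish h => exact .finish h
    | step h h1 h2 ih2 => exact .step h (ih h1) ih2

end lift

/-! ### Machine steps as programs -/

section embed

variable {K₁ K₂ : Type} [DecidableEq K₁] [DecidableEq K₂]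
variable {Γ₁ : K₁ → Type} {Γ₂ : K₂ → Type} {σ τ Λ Δ : Type}

/-- A statement of a Turing machine as a program, which records the next label. -/
def ofStmt : Turing.TM2.Stmt Γ₂ Λ τ → Cmd (SumΓ Γ₁ Γ₂) (σ × τ × Option Λ) Δ
  | .push k f q => seq (push (.inr k) fun v => f v.2.1) (ofStmt q)
  | .peek k f q => seq (peek (.inr k) fun v o => (v.1, f v.2.1 o, v.2.2)) (ofStmt q)
  | .pop k f q => seq (pop (.inr k) fun v o => (v.1, f v.2.1 o, v.2.2)) (ofStmt q)
  | .load f q => seq (load fun v => (v.1, f v.2.1, v.2.2)) (ofStmt q)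
  | .branch f p q => choose fun v => cond (f v.2.1) (ofStmt p) (ofStmt q)
  | .goto f => load fun v => (v.1, v.2.1, some (f v.2.1))
  | .halt => load fun v => (v.1, v.2.1, none)

/-- The store holding a configuration of a machine in its second component. -/
def ofCfg (v : σ) (S : ∀ k, List (Γ₁ k)) (c : Turing.TM2.Cfg Γ₂ Λ τ) :
    Store (SumΓ Γ₁ Γ₂) (σ × τ × Option Λ) :=
  ⟨(v, c.var, c.l), join S c.stk⟩

theorem exec_ofStmt (M : ℕ) (q : Turing.TM2.Stmt Γ₂ Λ τ) (v : σ) (t : τ) (l : Option Λ)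
    (S : ∀ k, List (Γ₁ k)) (T : ∀ k, List (Γ₂ k)) :
    (ofStmt q : Cmd (SumΓ Γ₁ Γ₂) (σ × τ × Option Λ) Δ).Exec M ⟨(v, t, l), join S T⟩
      (ofCfg v S (Turing.TM2.stepAux q t T)) := by
  induction q generalizing t T with
  | push k f q ih => exact exec_seq (by simp [Exec]) (ih _ _)
  | peek k f q ih => exact exec_seq (by simp [Exec]) (ih _ _)
  | pop k f q ih => exact exec_seq (by simp [Exec]) (ih _ _)
  | load f q ih => exact exec_seq (by simp [Exec]) (ih _ _)
  | branch f p q ihp ihq =>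
    simp only [ofStmt, Exec, Turing.TM2.stepAux]
    cases f t
    · exact ihq _ _
    · exact ihp _ _
  | goto f => simp [ofStmt, Exec, ofCfg]
  | halt => simp [ofStmt, Exec, ofCfg]

/-- One step of a machine. -/
def machineStep (m : Λ → Turing.TM2.Stmt Γ₂ Λ τ) : Cmd (SumΓ Γ₁ Γ₂) (σ × τ × Option Λ) Δ :=
  choose fun v => v.2.2.elim skip fun l => ofStmt (m l)

theorem exec_machineStep (M : ℕ) (m : Λ → Turing.TM2.Stmt Γ₂ Λ τ) (v : σ)
    (S : ∀ k, List (Γ₁ k)) {c c' : Turing.TM2.Cfg Γ₂ Λ τ} (h : Turing.TM2.step m c = some c') :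
    (machineStep m : Cmd (SumΓ Γ₁ Γ₂) (σ × τ × Option Λ) Δ).Exec M (ofCfg v S c)
      (ofCfg v S c') := by
  obtain ⟨l, t, T⟩ := c
  cases l with
  | none => simp at h
  | some l =>
    simp only [Turing.TM2.step, Option.some.injEq] at h
    subst h
    exact exec_ofStmt M _ _ _ _ _ _

end embed

end Cmd

theorem iterate_bind_none {α : Type*} (f : α → Option α) (n : ℕ) :
    (flip bind f)^[n] none = none := by
  induction n with
  | zero => rfl
  | succ n ih => rw [Function.iterate_succ_apply]; exact ih

theorem iterate_bind_succ {α : Type*} (f : α → Option α) (n : ℕ) (a : α) :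
    (flip bind f)^[n + 1] (some a) = (flip bind f)^[n] (f a) := rfl

namespace Cmd

section run

variable {K₁ K₂ : Type} [DecidableEq K₁] [DecidableEq K₂]
variable {Γ₁ : K₁ → Type} {Γ₂ : K₂ → Type} {σ τ Λ Δ : Type}

/-- Run a machine until it halts (the stack `k` is irrelevant). -/
def run (k : K₂) (m : Λ → Turing.TM2.Stmt Γ₂ Λ τ) : Cmd (SumΓ Γ₁ Γ₂) (σ × τ × Option Λ) Δ :=
  loop (.inr k) (fun v _ => v.2.2.isSome) (machineStep m)

/-- The loop test only looks at the stored label, so iterations correspond one to one to steps of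
the machine. -/
theorem exec_run {M n : ℕ} (hn : n ≤ M) (k : K₂) (m : Λ → Turing.TM2.Stmt Γ₂ Λ τ) (v : σ)
    (S : ∀ k, List (Γ₁ k)) {c c' : Turing.TM2.Cfg Γ₂ Λ τ} (h : StepsTo (Turing.TM2.step m) n c c')
    (hc : c'.l = none) :
    (run k m : Cmd (SumΓ Γ₁ Γ₂) (σ × τ × Option Λ) Δ).Exec M (ofCfg v S c) (ofCfg v S c') := by
  obtain ⟨i, hi, h⟩ := h
  refine ⟨i, hi.trans hn, ?_⟩
  clear hi
  induction i generalizing c with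
  | zero =>
    have : c = c' := by simpa using h
    subst this
    exact .finish (by simp [ofCfg, hc])
  | succ i ih =>
    rw [iterate_bind_succ] at h
    cases hs : Turing.TM2.step m c with
    | none => rw [hs, iterate_bind_none] at h; simp at h
    | some c₁ =>
      rw [hs] at h
      refine .step ?_ (exec_machineStep M m v S hs) (ih h)
      obtain ⟨l, t, T⟩ := c
      cases l with
      | none => simp at hs
      | some l => simp [ofCfg]

end run

end Cmd

end StackProg

/-! ### Dovetailing -/

namespace StackProg

open Function (update)

namespace Cmd

/-! ### Runs with a time limit -/

section clocked

variable {K₁ K₂ : Type} [DecidableEq K₁] [DecidableEq K₂] {Γ₂ : K₂ → Type} {σ τ Λ : Type}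

/-- The number of symbols pushed by a statement. -/
def pushes : Turing.TM2.Stmt Γ₂ Λ τ → ℕ
  | .push _ _ q => 1 + pushes q
  | .peek _ _ q => pushes q
  | .pop _ _ q => pushes q
  | .load _ q => pushes q
  | .branch _ p q => pushes p + pushes q
  | .goto _ => 0
  | .halt => 0

theorem length_stepAux_le (q : Turing.TM2.Stmt Γ₂ Λ τ) (t : τ) (T : ∀ k, List (Γ₂ k)) (k : K₂) :
    ((Turing.TM2.stepAux q t T).stk k).length ≤ (T k).length + pushes q := by
  induction q generalizing t T with
  | push j f q ih =>
    refine (ih _ _).trans ?_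
    by_cases h : k = j
    · subst h; simp [pushes]; omega
    · simp [pushes, h]
  | pop j f q ih =>
    refine (ih _ _).trans ?_
    by_cases h : k = j
    · subst h; simp [pushes]
    · simp [pushes, h]
  | peek j f q ih => exact ih _ _
  | load f q ih => exact ih _ _
  | branch f p q ihp ihq =>
    simp only [Turing.TM2.stepAux, pushes]
    cases f t
    · exact (ihq _ _).trans (by omega)
    · exact (ihp _ _).trans (by omega)
  | goto f => simp [pushes]
  | halt => simp [pushes]

/-- Stacks grow by a bounded amount per step. After an interrupted run this bounds the work of
emptying the stacks of the machine. -/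
theorem length_step_le [Fintype Λ] {m : Λ → Turing.TM2.Stmt Γ₂ Λ τ} {c c' : Turing.TM2.Cfg Γ₂ Λ τ}
    (h : Turing.TM2.step m c = some c') (k : K₂) :
    (c'.stk k).length ≤ (c.stk k).length + ∑ l, pushes (m l) := by
  obtain ⟨l, t, T⟩ := c
  cases l with
  | none => simp at h
  | some l =>
    simp only [Turing.TM2.step, Option.some.injEq] at h
    subst h
    refine (length_stepAux_le _ _ _ _).trans (Nat.add_le_add_left ?_ _)
    exact Finset.single_le_sum (f := fun l => pushes (m l)) (fun _ _ => Nat.zero_le _)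
      (Finset.mem_univ l)

/-- Run a machine until it halts or the clock `k` is used up. -/
def clocked (k : K₁) (m : Λ → Turing.TM2.Stmt Γ₂ Λ τ) :
    Cmd (SumΓ (fun _ : K₁ => Bool) Γ₂) (σ × τ × Option Λ) (Option Bool) :=
  loop (.inl k) (fun v o => v.2.2.isSome && o.isSome)
    (seq (popCase (.inl k) id fun _ => skip) (machineStep m))

/-- Either the run completes, or the clock stops it, which happens only if `t < n`. In the second
case the growth of the stacks is recorded for the clean-up; `r` is the number of unused ticks. -/
theorem exec_clocked [Fintype Λ] {M n : ℕ} (k : K₁) (m : Λ → Turing.TM2.Stmt Γ₂ Λ τ) (v : σ)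
    (S : K₁ → List Bool) {c c' : Turing.TM2.Cfg Γ₂ Λ τ} (h : StepsTo (Turing.TM2.step m) n c c')
    (hc : c'.l = none) (t : ℕ) (ht : t ≤ M) :
    ∃ d r, (clocked k m).Exec M (ofCfg v (update S k (List.replicate t true)) c)
        (ofCfg v (update S k (List.replicate r true)) d) ∧ r ≤ t ∧
      (d = c' ∨ (d.l.isSome ∧ t < n ∧
        ∀ j, (d.stk j).length ≤ (c.stk j).length + t * ∑ l, pushes (m l))) := by
  suffices H : ∃ i ≤ t, ∃ d r, Iter (fun s : Store (SumΓ (fun _ : K₁ => Bool) Γ₂)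
      (σ × τ × Option Λ) => (s.var.2.2.isSome && (s.stk (.inl k)).head?.isSome) = true)
      (Exec M (seq (popCase (.inl k) id fun _ => skip) (machineStep m))) i
      (ofCfg v (update S k (List.replicate t true)) c)
      (ofCfg v (update S k (List.replicate r true)) d) ∧ r ≤ t ∧
      (d = c' ∨ (d.l.isSome ∧ t < n ∧
        ∀ j, (d.stk j).length ≤ (c.stk j).length + t * ∑ l, pushes (m l))) by
    obtain ⟨i, hi, d, r, h1, h2⟩ := H
    exact ⟨d, r, ⟨i, hi.trans ht, h1⟩, h2⟩
  clear ht
  obtain ⟨i, hi, h⟩ := h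
  induction t generalizing c i n with
  | zero =>
    refine ⟨0, le_rfl, c, 0, .finish (by simp [ofCfg]), le_rfl, ?_⟩
    cases i with
    | zero => left; simpa using h
    | succ i =>
      right
      refine ⟨?_, by omega, by simp⟩
      obtain ⟨l, t, T⟩ := c
      cases l with
      | none => rw [iterate_bind_succ, Turing.TM2.step, iterate_bind_none] at h; simp at h
      | some l => rfl
  | succ t ih =>
    cases i with
    | zero =>
      have : c = c' := by simpa using h
      subst this
      exact ⟨0, by omega, c, t + 1, .finish (by simp [ofCfg, hc]), le_rfl, .inl rfl⟩
    | succ i =>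
      rw [iterate_bind_succ] at h
      cases hs : Turing.TM2.step m c with
      | none => rw [hs, iterate_bind_none] at h; simp at h
      | some c₁ =>
        rw [hs] at h
        obtain ⟨j, hj, d, r, h1, h2, h3⟩ := ih (n := n - 1) i (by omega) h
        refine ⟨j + 1, by omega, d, r, .step ?_ (exec_seq (t := ofCfg v
          (update S k (List.replicate t true)) c) ?_ (exec_machineStep M m v _ hs)) h1,
          by omega, ?_⟩
        · obtain ⟨l, t, T⟩ := c
          cases l with
          | none => simp at hs
          | some l => simp [ofCfg, List.replicate_succ]
        · simp [Exec, skip, ofCfg, List.replicate_succ]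
        · refine h3.imp id fun ⟨h4, h5, h6⟩ => ⟨h4, by omega, fun j => (h6 j).trans ?_⟩
          have := length_step_le hs j
          rw [Nat.add_mul]
          omega

end clocked

end Cmd

/-- The stacks of the dovetailing program. -/
inductive DoveStack
  | inp | rev | par | tim | clk | aux | go
  deriving DecidableEq

instance : Fintype DoveStack :=
  ⟨{.inp, .rev, .par, .tim, .clk, .aux, .go}, fun k => by cases k <;> decide⟩

namespace Dove

open Cmd DoveStack

variable (tm : Turing.FinTM2) (e : Bool → tm.Γ tm.k₀)

/-- Programs controlling the machine `tm`. -/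
abbrev DCmd : Type :=
  Cmd (SumΓ (fun _ : DoveStack => Bool) tm.Γ) (Unit × tm.σ × Option tm.Λ) (Option Bool)

/-- Move a word from the stack `a` to the stack `b` and to the input stack of `tm`. -/
def feed (a b : DoveStack) : DCmd tm :=
  loop (.inl a) (fun _ o => o.isSome) (popCase (.inl a) id fun o =>
    o.elim skip fun c => seq (push (.inl b) fun _ => c) (push (.inr tm.k₀) fun _ => e c))

theorem exec_feed {M : ℕ} {a b : DoveStack} (hab : a ≠ b) (v : Unit × tm.σ × Option tm.Λ)
    (S : DoveStack → List Bool) (T : ∀ k, List (tm.Γ k)) (hM : (S a).length ≤ M) :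
    (feed tm e a b).Exec M ⟨v, join S T⟩
      ⟨v, join (update (update S a []) b ((S a).reverse ++ S b))
        (update T tm.k₀ (((S a).map e).reverse ++ T tm.k₀))⟩ := by
  have := exec_loop_popCase (M := M) (Γ := SumΓ (fun _ : DoveStack => Bool) tm.Γ)
    (σ := Unit × tm.σ × Option tm.Λ) (a := .inl a) (h := id)
    (g := fun o : Option Bool => o.elim skip fun c =>
      seq (push (.inl b) fun _ => c) (push (.inr tm.k₀) fun _ => e c))
    (l₀ := S a) (fun pre l => ⟨v, join (update (update S a l) b (pre.reverse ++ S b))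
      (update T tm.k₀ ((pre.map e).reverse ++ T tm.k₀))⟩)
    (fun pre l _ => by simp [hab]) (fun pre c l _ => ?_) hM
  · simpa [feed] using this
  · refine exec_seq rfl ?_
    simp only [Exec, Store.mk.injEq, true_and, update_join_inl, update_join_inr, join_inl, join_inr]
    congr 1
    · funext k
      by_cases hk : k = a <;> by_cases hb : k = b <;> simp_all [Function.update_apply]
    · simp

/-- Empty all stacks of `tm`. -/
def clearAll : List tm.K → DCmd tm
  | [] => skip
  | k :: l => seq (loop (.inr k) (fun _ o => o.isSome) (popCase (.inr k) (fun _ => none)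
      fun _ => skip)) (clearAll l)

theorem exec_clearAll {M : ℕ} (l : List tm.K) (v : Unit × tm.σ × Option tm.Λ)
    (S : DoveStack → List Bool) (T : ∀ k, List (tm.Γ k)) (hM : ∀ k, (T k).length ≤ M) :
    (clearAll tm l).Exec M ⟨v, join S T⟩ ⟨v, join S fun k => if k ∈ l then [] else T k⟩ := by
  induction l generalizing T with
  | nil => simp [clearAll, skip, Exec]
  | cons k l ih =>
    have h1 := exec_loop_popCase (M := M) (Γ := SumΓ (fun _ : DoveStack => Bool) tm.Γ)
      (σ := Unit × tm.σ × Option tm.Λ) (Δ := Option Bool) (a := .inr k) (h := fun _ => none)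
      (g := fun o => skip) (l₀ := T k) (fun pre l => ⟨v, join S (update T k l)⟩)
      (fun pre l _ => by simp) (fun pre c l _ => by simp [skip, Exec]) (hM k)
    simp only [Function.update_eq_self] at h1
    refine exec_seq h1 ?_
    convert ih (update T k []) (fun j => ?_) using 3
    · funext j
      by_cases hj : j = k
      · subst hj; simp
      · simp [hj]
    · by_cases hj : j = k
      · subst hj; simp
      · simpa [hj] using hM j

/-- The stacks of the controlling program between two attempts. -/
def ctrl (x : List Bool) (n m : ℕ) (g : List Bool) : DoveStack → List Bool
  | inp => x
  | par => List.replicate m true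
  | tim => List.replicate n true
  | go => g
  | _ => []

/-- Go on to the next pair of a parameter and a time bound. -/
def next : UCmd DoveStack Bool Unit :=
  -- The pairs (time limit, parameter) are visited in the order `(n, n), …, (n, 0), (n + 1, n + 1),
  -- …`, so each limit `n` is combined with all parameters up to `n`.
  popCase par id fun o => o.elim (seq (push tim fun _ => true) (copy tim par aux)) fun _ => skip

theorem exec_next {M : ℕ} (x : List Bool) (n m : ℕ) (g : List Bool) (hM : n + 1 ≤ M) :
    next.Exec M ⟨(), ctrl x n m g⟩
      ⟨(), if m = 0 then ctrl x (n + 1) (n + 1) g else ctrl x n (m - 1) g⟩ := by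
  cases m with
  | zero =>
    simp only [next, Exec, ctrl, List.replicate_zero, List.head?_nil, id, Option.elim_none]
    refine ⟨_, rfl, ?_⟩
    convert exec_copy (M := M) (σ := Unit) (a := tim) (b := par) (t := aux) (by decide) (by decide)
      (by decide) () _ ?_ ?_ using 2
    · simp only [if_true]
      funext k
      cases k <;> simp [ctrl, List.replicate_succ]
    · simp [ctrl]
    · simpa [ctrl] using hM
  | succ m =>
    simp only [next, Exec, ctrl, List.replicate_succ, List.head?_cons, id, Option.elim_some, skip,
      Store.mk.injEq, true_and]
    funext k
    cases k <;> simp [ctrl]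

/-- Run `tm` with the current parameter and time bound. -/
noncomputable def attempt : DCmd tm :=
  -- The input `encUnary m ++ x` of the machine is assembled from its end: first `x`, then the
  -- terminating zero, then `m` ones. Each word passes through an auxiliary stack, which reverses it
  -- once more and restores it for the next attempt.
  seq (lift next) (seq (lift (move inp rev)) (seq (feed tm e rev inp)
    (seq (push (.inr tm.k₀) fun _ => e false) (seq (lift (move par aux)) (seq (feed tm e aux par)
      (seq (lift (copy tim clk aux)) (seq (load fun v => (v.1, tm.initialState, some tm.main))
        (seq (clocked clk tm.m) (seq (lift (clear clk)) (choose fun v => v.2.2.elim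
          (lift (clear go))
          fun _ => letI := tm.kFin; clearAll tm Finset.univ.toList))))))))))

/-- The outcome of an attempt. -/
theorem exec_attempt {M : ℕ} (x : List Bool) (n m n' m' : ℕ)
    (hnm : (n', m') = if m = 0 then (n + 1, n + 1) else (n, m - 1))
    (out : List (tm.Γ tm.k₁)) (h : ℕ)
    (hout : Outputs tm ((encUnary m' ++ x).map e) out h)
    (hM : letI := tm.ΛFin
      n' + m' + 1 + x.length + n' * ∑ l, pushes (tm.m l) ≤ M) (t : tm.σ × Option tm.Λ) :
    ∃ t', (attempt tm e).Exec M ⟨((), t), join (ctrl x n m [true]) fun _ => []⟩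
        ⟨((), t'), join (ctrl x n' m' []) (single tm.k₁ out)⟩ ∨
      (n' < h ∧ (attempt tm e).Exec M ⟨((), t), join (ctrl x n m [true]) fun _ => []⟩
        ⟨((), t'), join (ctrl x n' m' [true]) fun _ => []⟩) := by
  let := tm.ΛFin
  let := tm.kFin
  have hnM : n + 1 ≤ M ∨ m ≠ 0 := by
    by_cases hm : m = 0
    · left; simp only [hm, if_true, Prod.mk.injEq] at hnm; omega
    · exact .inr hm
  have e1 : (lift next : DCmd tm).Exec M ⟨((), t), join (ctrl x n m [true]) fun _ => []⟩
      ⟨((), t), join (ctrl x n' m' [true]) fun _ => []⟩ := by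
    have h1 : next.Exec M ⟨(), ctrl x n m [true]⟩ ⟨(), ctrl x n' m' [true]⟩ := by
      by_cases hm : m = 0
      · simp only [hm, if_true, Prod.mk.injEq] at hnm
        have := exec_next (M := M) x n 0 [true] (by omega)
        simpa [hm, hnm.1, hnm.2] using this
      · simp only [hm, if_false, Prod.mk.injEq] at hnm
        obtain ⟨m, rfl⟩ := Nat.exists_eq_succ_of_ne_zero hm
        simp only [next, Exec, ctrl, List.replicate_succ, List.head?_cons, id, Option.elim_some,
          skip, Store.mk.injEq, true_and]
        funext k
        cases k <;> simp [ctrl, hnm.1, hnm.2]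
    exact h1.lift t _
  have e2 := (exec_move (M := M) (σ := Unit) (a := inp) (b := rev) (by decide) ()
    (ctrl x n' m' [true]) (by simp only [ctrl]; omega)).lift (Γ₂ := tm.Γ) t fun _ => []
  have e3 := exec_feed tm e (M := M) (a := rev) (b := inp) (by decide) ((), t)
    (update (update (ctrl x n' m' [true]) inp []) rev
      ((ctrl x n' m' [true] inp).reverse ++ ctrl x n' m' [true] rev)) (fun _ => [])
    (by simp [ctrl]; omega)
  have e4 := (exec_move (M := M) (σ := Unit) (a := par) (b := aux) (by decide) ()
    (ctrl x n' m' [true]) (by simp only [ctrl, List.length_replicate]; omega)).lift (Γ₂ := tm.Γ) t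
    (single tm.k₀ ((false :: x).map e))
  have e5 := exec_feed tm e (M := M) (a := aux) (b := par) (by decide) ((), t)
    (update (update (ctrl x n' m' [true]) par []) aux
      ((ctrl x n' m' [true] par).reverse ++ ctrl x n' m' [true] aux))
    (single tm.k₀ ((false :: x).map e))
    (by simp [ctrl]; omega)
  have e6 := (exec_copy (M := M) (σ := Unit) (a := tim) (b := clk) (t := aux) (by decide)
    (by decide) (by decide) () (ctrl x n' m' [true]) rfl
    (by simp only [ctrl, List.length_replicate]; omega)).lift (Γ₂ := tm.Γ) t
    (single tm.k₀ ((encUnary m' ++ x).map e))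
  obtain ⟨d, r, e7, hr, hd⟩ := exec_clocked (M := M) clk tm.m () (ctrl x n' m' [true]) hout rfl n'
    (by omega)
  have e8 := (exec_clear (M := M) (σ := Unit) (a := clk) ()
    (update (ctrl x n' m' [true]) clk (List.replicate r true))
    (by simp; omega)).lift (Γ₂ := tm.Γ) (d.var, d.l) d.stk
  have hpre : ∀ u, (choose fun v => v.2.2.elim (lift (clear go))
      fun _ => clearAll tm Finset.univ.toList : DCmd tm).Exec M
      ⟨((), d.var, d.l), join (ctrl x n' m' [true]) d.stk⟩ u →
      (attempt tm e).Exec M ⟨((), t), join (ctrl x n m [true]) fun _ => []⟩ u := by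
    intro u hu
    refine exec_seq e1 (exec_seq e2 (exec_seq e3 (exec_seq rfl (exec_seq
      (t := ⟨((), t), join (update (update (ctrl x n' m' [true]) par []) aux
        ((ctrl x n' m' [true] par).reverse ++ ctrl x n' m' [true] aux))
          (single tm.k₀ ((false :: x).map e))⟩) ?_
      (exec_seq e5 (exec_seq
      (t := ⟨((), t), join (update (ctrl x n' m' [true]) clk (List.replicate n' true))
          (single tm.k₀ ((encUnary m' ++ x).map e))⟩) ?_
      (exec_seq rfl (exec_seq e7 (exec_seq e8 ?_)))))))))
    · convert e4 using 2
      simp only [update_join_inl, update_join_inr]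
      congr 1
      · funext k
        cases k <;> simp [ctrl]
      · simp [ctrl]
    · convert e6 using 2
      · congr 1
        · funext k
          cases k <;> simp [ctrl]
        · simp [encUnary, ctrl]
      · congr 1
        funext k
        cases k <;> simp [ctrl]
    · convert hu using 3
      funext k
      cases k <;> simp [ctrl]
  rcases hd with rfl | ⟨hd1, hd2, hd3⟩
  · refine ⟨(tm.initialState, none), Or.inl (hpre _ ?_)⟩
    have := (exec_clear (M := M) (σ := Unit) (a := go) () (ctrl x n' m' [true])
      (by simp [ctrl]; omega)).lift (Γ₂ := tm.Γ)
      ((tm.initialState, none) : tm.σ × Option tm.Λ) (single tm.k₁ out)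
    have h2 : update (ctrl x n' m' [true]) go [] = ctrl x n' m' [] := by
      funext k
      cases k <;> simp [ctrl]
    rw [h2] at this
    exact this
  · obtain ⟨l, hl⟩ := Option.isSome_iff_exists.1 hd1
    refine ⟨(d.var, d.l), Or.inr ⟨hd2, hpre _ ?_⟩⟩
    have := exec_clearAll tm (M := M) Finset.univ.toList ((), d.var, d.l) (ctrl x n' m' [true])
      d.stk fun k => (hd3 k).trans ?_
    · simpa [Exec, hl] using this
    · refine le_trans (Nat.add_le_add_right ?_ _) hM
      by_cases hk : k = tm.k₀
      · subst hk; simp [encUnary]; omega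
      · simp [hk]

/-- The dovetailing program. -/
noncomputable def prog : DCmd tm :=
  seq (lift (push go fun _ => true)) (seq (loop (.inl go) (fun _ o => o.isSome) (attempt tm e))
    (lift (seq (clear inp) (seq (clear par) (clear tim)))))

/-- The hypothesis `hnm` says that the pair `(τ, s₀)` has not been tried yet. Its attempt cannot
time out because `h s₀ ≤ τ`, so the search ends there at the latest, possibly earlier with another
parameter `m'`. -/
theorem exec_loop {M : ℕ} (x : List Bool) (out : ℕ → List (tm.Γ tm.k₁)) (h : ℕ → ℕ)
    (hout : ∀ s, Outputs tm ((encUnary s ++ x).map e) (out s) (h s)) {s₀ τ : ℕ} (hτ : h s₀ ≤ τ)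
    (hM : letI := tm.ΛFin
      2 * τ + 1 + x.length + τ * ∑ l, pushes (tm.m l) ≤ M) (n m : ℕ)
    (hnm : n < τ ∨ (n = τ ∧ s₀ < m)) (hmn : m ≤ n) (hs : s₀ ≤ τ) (t : tm.σ × Option tm.Λ) :
    ∃ i ≤ (τ - n) * (τ + 2) + m, ∃ n' m' t', n' ≤ τ ∧ m' ≤ n' ∧
      Iter (fun s : Store (SumΓ (fun _ : DoveStack => Bool) tm.Γ) (Unit × tm.σ × Option tm.Λ) =>
        (s.stk (.inl go)).head?.isSome = true) (Exec M (attempt tm e)) i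
        ⟨((), t), join (ctrl x n m [true]) fun _ => []⟩
        ⟨((), t'), join (ctrl x n' m' []) (single tm.k₁ (out m'))⟩ := by
  -- Potential counting the remaining attempts: passing from `(n, 0)` to `(n + 1, n + 1)` lowers the
  -- first summand by `τ + 2` and raises the second by at most `τ`.
  generalize hμ : (τ - n) * (τ + 2) + m = μ
  induction μ using Nat.strong_induction_on generalizing n m t with
  | _ μ ih =>
  obtain ⟨n', m', hnm', hn', hmn', hs', hlt⟩ : ∃ n' m',
      ((n', m') = if m = 0 then (n + 1, n + 1) else (n, m - 1)) ∧ n' ≤ τ ∧ m' ≤ n' ∧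
      (n' = τ → s₀ ≤ m') ∧ (τ - n') * (τ + 2) + m' < μ := by
    by_cases hm : m = 0
    · refine ⟨n + 1, n + 1, by simp [hm], by omega, le_rfl, by omega, ?_⟩
      obtain ⟨d, rfl⟩ : ∃ d, τ = n + 1 + d := ⟨τ - (n + 1), by omega⟩
      rw [← hμ, show n + 1 + d - (n + 1) = d by omega, show n + 1 + d - n = d + 1 by omega,
        Nat.add_mul]
      omega
    · exact ⟨n, m - 1, by simp [hm], by omega, by omega, by omega, by omega⟩
  have hM' : letI := tm.ΛFin
      n' + m' + 1 + x.length + n' * ∑ l, pushes (tm.m l) ≤ M := by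
    refine le_trans ?_ hM
    have := Nat.mul_le_mul_right (letI := tm.ΛFin; ∑ l, pushes (tm.m l)) hn'
    omega
  obtain ⟨t', h1 | ⟨h1, h2⟩⟩ := exec_attempt tm e (M := M) x n m n' m' hnm' (out m') (h m') (hout m')
    hM' t
  · exact ⟨1, by omega, n', m', t', hn', hmn', .step (by simp [ctrl]) h1 (.finish (by simp [ctrl]))⟩
  -- Otherwise the failed attempt was the one at `(τ, s₀)`, and a timeout would mean `τ < h s₀`.
  · have hpre : n' < τ ∨ (n' = τ ∧ s₀ < m') := by
      by_contra hcon
      have h3 : n' = τ := by omega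
      have h4 : m' = s₀ := by have := hs' h3; omega
      rw [h4] at h1
      omega
    obtain ⟨i, hi, n₁, m₁, t₁, hn₁, hm₁, h3⟩ := ih _ hlt n' m' hpre hmn' t' rfl
    exact ⟨i + 1, by omega, n₁, m₁, t₁, hn₁, hm₁, .step (by simp [ctrl]) h2 h3⟩

/-- Since `τ` exceeds both `s₀` and `h s₀`, the pair `(τ, s₀)` lies in the enumerated range `m ≤ n`
and grants enough time. The search starts from `(0, 0)`, which itself is never tried. -/
theorem exec_prog {M : ℕ} (x : List Bool) (out : ℕ → List (tm.Γ tm.k₁)) (h : ℕ → ℕ)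
    (hout : ∀ s, Outputs tm ((encUnary s ++ x).map e) (out s) (h s)) (s₀ : ℕ) {τ : ℕ}
    (hτ : s₀ + h s₀ + 1 ≤ τ)
    (hM : letI := tm.ΛFin
      2 * τ + 1 + x.length + τ * ∑ l, pushes (tm.m l) ≤ M) (hM' : τ * (τ + 2) ≤ M)
    (t : tm.σ × Option tm.Λ) :
    ∃ s t', (prog tm e).Exec M ⟨((), t), single (.inl inp) x⟩
      ⟨((), t'), single (.inr tm.k₁) (out s)⟩ := by
  obtain ⟨i, hi, n, m, t', hn, hm, h1⟩ := exec_loop tm e x out h hout (s₀ := s₀) (τ := τ) (by omega)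
    hM 0 0 (by omega) le_rfl (by omega) t
  refine ⟨m, t', exec_seq (t := ⟨((), t), join (ctrl x 0 0 [true]) fun _ => []⟩) ?_
    (exec_seq ⟨i, ?_, h1⟩ ?_)⟩
  · have : (single (.inl inp) x : ∀ k, List (SumΓ (fun _ : DoveStack => Bool) tm.Γ k)) =
        join (update (fun _ => []) inp x) fun _ => [] := by
      rw [← update_join_inl]
      congr 1
      funext k
      rcases k with k | k <;> rfl
    rw [this]
    have h2 : (push go fun _ => true : UCmd DoveStack Bool Unit).Exec M
      ⟨(), update (fun _ => []) inp x⟩ ⟨(), ctrl x 0 0 [true]⟩ := by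
      simp only [Exec, Store.mk.injEq, true_and]
      funext k
      cases k <;> simp [ctrl]
    exact h2.lift t _
  · exact hi.trans (by simpa using hM')
  · have : (single (.inr tm.k₁) (out m) : ∀ k, List (SumΓ (fun _ : DoveStack => Bool) tm.Γ k)) =
        join (fun _ => []) (single tm.k₁ (out m)) := by
      rw [← update_join_inr]
      congr 1
      funext k
      rcases k with k | k <;> rfl
    rw [this]
    have hb : x.length ≤ M ∧ m ≤ M ∧ n ≤ M := by
      refine ⟨by omega, by omega, by omega⟩
    have h2 : (seq (clear inp) (seq (clear par) (clear tim)) : UCmd DoveStack Bool Unit).Exec M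
        ⟨(), ctrl x n m []⟩ ⟨(), fun _ => []⟩ := by
      refine exec_seq (exec_clear _ _ (by simpa [ctrl] using hb.1)) (exec_seq (exec_clear _ _
        (by simpa [ctrl] using hb.2.1)) ?_)
      convert exec_clear (M := M) (a := tim) () (update (update (ctrl x n m []) inp []) par [])
        (by simpa [ctrl] using hb.2.2) using 2
      funext k
      cases k <;> simp [ctrl]
    exact h2.lift t' _

/-- A machine computing outputs from a parameter and a word can be turned into a machine which
outputs one of them, in a time that is polynomially bounded for the best value of the parameter. -/
theorem exists_dovetail (o : tm.Γ tm.k₁ ≃ Bool) :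
    ∃ (D : Turing.TM2ComputableAux Bool Bool) (c : ℕ), ∀ (x : List Bool) (out : ℕ → List Bool)
      (h : ℕ → ℕ), (∀ s, Outputs tm ((encUnary s ++ x).map e) ((out s).map o.symm) (h s)) →
      ∀ s₀, ∃ s, Nonempty (Turing.TM2OutputsInTime D.tm (x.map D.inputAlphabet.invFun)
        (some ((out s).map D.outputAlphabet.invFun)) ((s₀ + h s₀ + x.length + 2) ^ c)) := by
  let := tm.kFin
  let := tm.σFin
  let := tm.ΛFin
  obtain ⟨c, hc⟩ := (prog tm e).cost_le_pow
  set p := ∑ l, pushes (tm.m l) with hp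
  let : Fintype (SumΓ (fun _ : DoveStack => Bool) tm.Γ (.inl inp)) := inferInstanceAs (Fintype Bool)
  -- With iteration bound `M = Z ^ (p + 8) - 2` the base `M + 2` of the cost is a power of `Z`; the
  -- final `+ 1` in the exponent pays for the halting step.
  refine ⟨⟨(prog tm e).toFinTM2 ((), tm.initialState, none) (.inl inp) (.inr tm.k₁),
    Equiv.refl Bool, o⟩, (p + 8) * c + 1, fun x out h hout s₀ => ?_⟩
  set Z := s₀ + h s₀ + x.length + 2 with hZ
  -- As `Z` is at least two, the constant `p` of the machine can be traded for a power of `Z`.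
  have hpZ : p ≤ Z ^ p := (Nat.lt_pow_self (by omega)).le
  have hZ3 : 3 ≤ Z ^ 2 := by nlinarith
  have hM1 : 2 * Z + 1 + x.length + Z * p ≤ Z ^ (p + 8) - 2 := by
    refine Nat.le_sub_of_add_le ?_
    have h1 : Z ^ (p + 8) = Z ^ p * Z ^ 2 * Z * Z ^ 5 := by ring
    have h2 : 2 ^ 5 ≤ Z ^ 5 := Nat.pow_le_pow_left (by omega) 5
    have h3 : 1 ≤ Z ^ p := Nat.one_le_pow _ _ (by omega)
    have h4 : p * Z ≤ Z ^ p * Z ^ 2 * Z := by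
      refine Nat.mul_le_mul_right _ ?_
      nlinarith
    have h5 : Z ≤ Z ^ p * Z ^ 2 * Z := by
      refine Nat.le_mul_of_pos_left _ ?_
      positivity
    have h6 : Z ^ p * Z ^ 2 * Z * 2 ^ 5 ≤ Z ^ (p + 8) := by
      rw [h1]
      exact Nat.mul_le_mul_left _ h2
    have : x.length ≤ Z := by omega
    nlinarith
  have hM2 : Z * (Z + 2) ≤ Z ^ (p + 8) - 2 := by
    refine Nat.le_sub_of_add_le ?_
    have h1 : Z ^ 8 ≤ Z ^ (p + 8) := Nat.pow_le_pow_right (by omega) (by omega)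
    have h2 : Z ^ 8 = Z ^ 2 * Z ^ 6 := by ring
    have h3 : 2 ^ 6 ≤ Z ^ 6 := Nat.pow_le_pow_left (by omega) 6
    have h4 : Z ^ 2 * 2 ^ 6 ≤ Z ^ 8 := by rw [h2]; exact Nat.mul_le_mul_left _ h3
    have : 2 ≤ Z := by omega
    nlinarith
  obtain ⟨s, t', hs⟩ := exec_prog tm e (M := Z ^ (p + 8) - 2) x _ h hout s₀ (τ := Z)
    (by omega) hM1 hM2 (tm.initialState, none)
  have h7 : x.map (Equiv.refl Bool).invFun = x := List.map_id x
  have h2 : Outputs ((prog tm e).toFinTM2 ((), tm.initialState, none) (.inl inp) (.inr tm.k₁))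
      (x.map (Equiv.refl Bool).invFun) ((out s).map o.symm)
      ((prog tm e).cost (Z ^ (p + 8) - 2) + 1) := by
    refine Exec.outputs (v := ((), t')) ?_
    rw [← h7] at hs
    exact hs
  refine ⟨s, (outputs_iff _ _ _ _).2 (h2.mono ?_)⟩
  have h5 := hc (Z ^ (p + 8) - 2)
  have h6 : 2 ≤ Z ^ (p + 8) := le_trans (by omega : 2 ≤ Z) (Nat.le_self_pow (by omega) _)
  rw [Nat.sub_add_cancel h6, ← pow_mul] at h5
  rw [show Z ^ ((p + 8) * c + 1) = Z ^ ((p + 8) * c) * Z from pow_succ _ _]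
  have h8 : 1 ≤ Z ^ ((p + 8) * c) := Nat.one_le_pow _ _ (by omega)
  have h9 := Nat.mul_le_mul_left (Z ^ ((p + 8) * c)) (show 2 ≤ Z by omega)
  refine (Nat.add_le_add_right h5 1).trans ?_
  omega

end Dove

end StackProg

/-! ### Running a machine on the output of a program -/

namespace StackProg

open Function (update)

namespace Cmd

variable {K Γ₀ σ : Type} [DecidableEq K]

/-- Run the machine `tm` on the output of the program `R`. -/
def pipe (R : UCmd K Γ₀ σ) (out tmp : K) (dec : Γ₀ → Bool) (tm : Turing.FinTM2)
    (i : Bool → tm.Γ tm.k₀) :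
    Cmd (SumΓ (fun _ : K => Γ₀) tm.Γ) (σ × tm.σ × Option tm.Λ) (Option Γ₀) :=
  seq (lift R) (seq (lift (move out tmp))
    (seq (loop (.inl tmp) (fun _ o => o.isSome) (popCase (.inl tmp) id fun o =>
      o.elim skip fun c => push (.inr tm.k₀) fun _ => i (dec c)))
    (seq (load fun v => (v.1, tm.initialState, some tm.main)) (run tm.k₀ tm.m))))

/-- The output of `R` is reversed on `tmp` first, because pushing it symbol by symbol on the input
stack of the machine reverses it again. -/
theorem exec_pipe {R : UCmd K Γ₀ σ} {inp out tmp : K} (hot : out ≠ tmp) {bit : Bool → Γ₀}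
    {dec : Γ₀ → Bool} (hdec : ∀ b, dec (bit b) = b) {tm : Turing.FinTM2} {i : Bool → tm.Γ tm.k₀}
    {M n : ℕ} {v₀ v : σ} {x y : List Bool} {z : List (tm.Γ tm.k₁)}
    (hR : R.Exec M ⟨v₀, single inp (x.map bit)⟩ ⟨v, single out (y.map bit)⟩)
    (hA : Outputs tm (y.map i) z n) (hy : y.length ≤ M) (hn : n ≤ M) (t : tm.σ × Option tm.Λ) :
    (pipe R out tmp dec tm i).Exec M ⟨(v₀, t), single (.inl inp) (x.map bit)⟩
      ⟨(v, tm.initialState, none), single (.inr tm.k₁) z⟩ := by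
  have h0 : ∀ k l, (single (.inl k) l : ∀ k, List (SumΓ (fun _ : K => Γ₀) tm.Γ k)) =
      join (single k l) fun _ => [] := by
    intro k l
    rw [← update_join_inl]
    congr 1
    funext k
    rcases k with k | k <;> rfl
  have h1 : ∀ k l, (single (.inr k) l : ∀ k, List (SumΓ (fun _ : K => Γ₀) tm.Γ k)) =
      join (fun _ => []) (single k l) := by
    intro k l
    rw [← update_join_inr]
    congr 1
    funext k
    rcases k with k | k <;> rfl
  rw [h0, h1]
  have e1 := hR.lift (Γ₂ := tm.Γ) t fun _ => []
  have e2 : (move out tmp : UCmd K Γ₀ σ).Exec M ⟨v, single out (y.map bit)⟩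
      ⟨v, single tmp (y.map bit).reverse⟩ := by
    convert exec_move hot v (single out (y.map bit)) (M := M) (by simpa using hy) using 2
    funext k
    by_cases hk : k = out <;> by_cases hb : k = tmp <;>
      simp_all [Function.update_apply, Ne.symm]
  refine exec_seq e1 (exec_seq (e2.lift t _) (exec_seq (t := ⟨(v, t), join (fun _ => [])
    (single tm.k₀ (y.map i))⟩) ?_ (exec_seq rfl (exec_run hn _ _ _ _ hA rfl))))
  have := exec_loop_popCase (M := M) (Γ := SumΓ (fun _ : K => Γ₀) tm.Γ)
    (σ := σ × tm.σ × Option tm.Λ) (a := .inl tmp) (h := id)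
    (g := fun o : Option Γ₀ => o.elim skip fun c => push (.inr tm.k₀) fun _ => i (dec c))
    (l₀ := (y.map bit).reverse) (fun pre l => ⟨(v, t), join (single tmp l)
      (single tm.k₀ (pre.map fun c => i (dec c)).reverse)⟩)
    (fun pre l _ => by simp) (fun pre c l _ => by simp [Exec]) (by simpa using hy)
  simp only [List.map_nil, List.reverse_nil, Function.update_eq_self, List.map_reverse,
    List.reverse_reverse, List.map_map, Function.comp_def, hdec] at this
  simpa [single] using this

/-- A single bound `M` covers the loops of `R`, the transfer of `y` and the run of `A`; the exponent
depends on the programs alone. -/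
theorem exists_pipe [Fintype K] [Fintype Γ₀] [Fintype σ] (R : UCmd K Γ₀ σ) {inp out tmp : K}
    (hot : out ≠ tmp) {bit : Bool → Γ₀} {dec : Γ₀ → Bool} (hdec : ∀ b, dec (bit b) = b) (v₀ : σ)
    (A : QuantumAlgorithm) :
    ∃ (tm : Turing.FinTM2) (e : Bool → tm.Γ tm.k₀) (o : tm.Γ tm.k₁ ≃ Bool) (c : ℕ),
      ∀ (M n : ℕ) (v : σ) (x y z : List Bool),
        R.Exec M ⟨v₀, single inp (x.map bit)⟩ ⟨v, single out (y.map bit)⟩ →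
        Nonempty (Turing.TM2OutputsInTime A.tm (y.map A.inputAlphabet.invFun)
          (some (z.map A.outputAlphabet.invFun)) n) → y.length ≤ M → n ≤ M →
        Outputs tm (x.map e) (z.map o.symm) ((M + 2) ^ c) := by
  let := A.tm.kFin
  let := A.tm.σFin
  let := A.tm.ΛFin
  obtain ⟨c, hc⟩ := (pipe R out tmp dec A.tm A.inputAlphabet.invFun).cost_le_pow
  let : Fintype (SumΓ (fun _ : K => Γ₀) A.tm.Γ (.inl inp)) := inferInstanceAs (Fintype Γ₀)
  refine ⟨(pipe R out tmp dec A.tm A.inputAlphabet.invFun).toFinTM2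
    (v₀, A.tm.initialState, none) (.inl inp) (.inr A.tm.k₁), bit, A.outputAlphabet, c + 1,
    fun M n v x y z hR hA hy hn => ?_⟩
  have h1 := exec_pipe hot hdec hR ((outputs_iff _ _ _ _).1 hA) hy hn (A.tm.initialState, none)
  refine StepsTo.mono (Exec.outputs h1) ((Nat.add_le_add_right (hc M) 1).trans ?_)
  rw [show (M + 2) ^ (c + 1) = (M + 2) ^ c * (M + 2) from pow_succ _ _]
  have h8 : 1 ≤ (M + 2) ^ c := Nat.one_le_pow _ _ (by omega)
  have h9 := Nat.mul_le_mul_left ((M + 2) ^ c) (show 2 ≤ M + 2 by omega)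
  omega

end Cmd

end StackProg

/-! ### Generalised gates and partial assignments -/

namespace StackProg

/-- A constraint on the value `y` of a wire: there are `A` and `α` with `rel y A α` such that `A` tells
whether all wires marked in `fst` (complemented if `pol`) are true, and `α` is the value of each of the wires
marked in `snd`. -/
structure GenGate where
  pol : Bool
  rel : Bool → Bool → Bool → Bool
  fst : List Bool
  snd : List Bool

/-- What is known about a wire: its value `y`, the claimed values of `A` and `α`, and whether the
current block is claimed to contain a witness for `A = false`. -/
abbrev Cell : Type := Option (Bool × Bool × Bool × Bool)

/-- The alphabet of the reduction. -/
inductive Sym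
  | bit (b : Bool)
  | hdr (pol : Bool) (rel : Bool → Bool → Bool → Bool)
  | sep
  | fin
  | cell (c : Cell)

noncomputable instance : Fintype Sym :=
  Fintype.ofInjective
    (β := Bool ⊕ (Bool × (Bool → Bool → Bool → Bool)) ⊕ Unit ⊕ Unit ⊕ Cell)
    (fun
      | .bit b => .inl b
      | .hdr p r => .inr (.inl (p, r))
      | .sep => .inr (.inr (.inl ()))
      | .fin => .inr (.inr (.inr (.inl ())))
      | .cell c => .inr (.inr (.inr (.inr c))))
    (by intro a b h; cases a <;> cases b <;> simp_all)

/-- The bit stored in a symbol. -/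
def Sym.toBit : Sym → Bool
  | .bit b => b
  | _ => false

def Sym.isBit : Sym → Bool
  | .bit _ => true
  | _ => false

/-- There are finitely many relations on three bits, so a whole relation fits into one symbol of a
finite alphabet. -/
def GenGate.encode (g : GenGate) : List Sym :=
  .hdr g.pol g.rel :: (g.fst.map .bit ++ .sep :: (g.snd.map .bit ++ [.fin]))

/-- Some marked wire is known to be false (after complementing if `pol`). -/
def seenFalse (pol : Bool) (S : List Bool) (Y : List Cell) : Bool :=
  (S.zip Y).any fun p => p.1 && p.2.elim false fun c => c.1 == pol

/-- Some marked wire is known to have a value other than `α`. -/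
def seenOther (α : Bool) (S : List Bool) (Y : List Cell) : Bool :=
  (S.zip Y).any fun p => p.1 && p.2.elim false fun c => c.1 != α

/-- The claims about a wire are consistent with what is known about the wires of a block. -/
def GenGate.ok (g : GenGate) (c : Cell) (Y : List Cell) : Bool :=
  c.elim true fun c => g.rel c.1 c.2.1 c.2.2.1 && !seenOther c.2.2.1 g.snd Y &&
    cond c.2.1 (!seenFalse g.pol g.fst Y) (!c.2.2.2 || seenFalse g.pol g.fst Y)

/-- The claims made for one wire: its value, the values of `A` and `α`, and the block which
contains a witness if `A` is false. -/
structure Claim where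
  y : Bool
  A : Bool
  α : Bool
  wit : List Bool

def Claim.bits (r : Claim) : List Bool := r.y :: r.A :: r.α :: r.wit

/-- The witness index is compressed to the one bit that matters when testing against block `j`; this
keeps the set of cells finite, independently of `S`. -/
def Claim.cell (j : List Bool) (r : Claim) : Cell := some (r.y, r.A, r.α, r.wit == j)

/-- A partial assignment: the index of a block of wires and the claims for its wires. -/
structure Block where
  idx : List Bool
  claims : List Claim

def Block.bits (w : Block) : List Bool := w.idx ++ w.claims.flatMap Claim.bits

/-- Place a list in an otherwise empty list, at the block with the given index (in binary). -/
def place {α : Type*} : List Bool → List (Option α) → List (Option α)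
  | [], l => l
  | b :: i, l => place i (cond b (List.replicate l.length none ++ l)
      (l ++ List.replicate l.length none))

/-- What the partial assignment tells about the wires, witnesses being compared with block `j`. -/
def Block.cells (w : Block) (j : List Bool) : List Cell :=
  -- The order is reversed because the program pushes a cell for each claim it reads: the first
  -- claim concerns the last wire of the block.
  place w.idx (w.claims.map (Claim.cell j)).reverse

/-- The claims of `w` are refuted by what `w'` tells about the wires. -/
def refutes (G : List GenGate) (w w' : Block) : Bool :=
  (G.zip (w.cells w'.idx)).any fun p => !p.1.ok p.2 (w'.cells w'.idx)

/-- The claims of `w` and `w'` (which are different) cannot be made at the same time. -/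
def conflict (G : List GenGate) (w w' : Block) : Bool :=
  -- Only claims of `w` are tested; those of `w'` are tested in the pair with the roles exchanged.
  -- The graph has no loops, so a block refuting itself is instead made to conflict with every other
  -- block.
  w.idx == w'.idx || (refutes G w w || refutes G w w')

/-- Block `w` has an index of length `s` and makes claims for `B` wires. -/
structure Block.WF (s B : ℕ) (w : Block) : Prop where
  idx : w.idx.length = s
  claims : w.claims.length = B
  wit : ∀ r ∈ w.claims, r.wit.length = s

/-- Read `B` claims from a list of bits. -/
def readClaims (s : ℕ) : ℕ → List Bool → List Claim
  | 0, _ => []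
  | B + 1, l => ⟨l.getD 0 false, l.getD 1 false, l.getD 2 false, (l.drop 3).take s⟩ ::
      readClaims s B (l.drop (s + 3))

def Block.ofBits (s B : ℕ) (l : List Bool) : Block := ⟨l.take s, readClaims s B (l.drop s)⟩

theorem readClaims_spec (s : ℕ) : ∀ (B : ℕ) (l : List Bool), l.length = B * (s + 3) →
    (readClaims s B l).length = B ∧ (∀ r ∈ readClaims s B l, r.wit.length = s) ∧
      (readClaims s B l).flatMap Claim.bits = l
  | 0, l, h => by
    have : l = [] := List.eq_nil_of_length_eq_zero (by simpa using h)
    simp [readClaims, this]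
  | B + 1, l, h => by
    rw [Nat.add_mul] at h
    obtain ⟨a, b, c, l, rfl⟩ : ∃ a b c l', l = a :: b :: c :: l' := by
      rcases l with _ | ⟨a, _ | ⟨b, _ | ⟨c, l⟩⟩⟩
      · simp at h
      · simp at h; omega
      · simp at h; omega
      · exact ⟨a, b, c, l, rfl⟩
    simp only [List.length_cons] at h
    obtain ⟨h1, h2, h3⟩ := readClaims_spec s B (l.drop s) (by simp; omega)
    have hd : (a :: b :: c :: l).drop (s + 3) = l.drop s := by simp
    refine ⟨?_, ?_, ?_⟩
    · simp [readClaims, h1]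
    · intro r hr
      rw [readClaims, hd, List.mem_cons] at hr
      rcases hr with rfl | hr
      · simp; omega
      · exact h2 r hr
    · simp [readClaims, h3, Claim.bits]

/-- With `Block.ofBits_bits`, this identifies well-formed blocks with all bit strings of one fixed
length. The vertices can therefore be enumerated by a binary counter. -/
theorem Block.ofBits_spec {s B : ℕ} {l : List Bool} (h : l.length = s + B * (s + 3)) :
    (Block.ofBits s B l).WF s B ∧ (Block.ofBits s B l).bits = l := by
  obtain ⟨h1, h2, h3⟩ := readClaims_spec s B (l.drop s) (by simp; omega)
  exact ⟨⟨by simp [ofBits]; omega, h1, h2⟩, by simp [ofBits, bits, h3]⟩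

theorem readClaims_bits {s : ℕ} : ∀ {c : List Claim}, (∀ r ∈ c, r.wit.length = s) →
    readClaims s c.length (c.flatMap Claim.bits) = c
  | [], _ => rfl
  | r :: c, h => by
    have hr := h r (by simp)
    have ih := readClaims_bits (s := s) (c := c) fun r hr => h r (by simp [hr])
    simp only [List.length_cons, readClaims, List.flatMap_cons, Claim.bits]
    congr 1
    · simp [← hr]
    · conv_rhs => rw [← ih]
      simp [← hr]

theorem Block.ofBits_bits {s B : ℕ} {w : Block} (h : w.WF s B) : Block.ofBits s B w.bits = w := by
  have := readClaims_bits h.wit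
  rw [h.claims] at this
  have h1 : w.bits.take s = w.idx := by simp [bits, ← h.idx]
  have h2 : w.bits.drop s = w.claims.flatMap Claim.bits := by simp [bits, ← h.idx]
  rw [ofBits, h1, h2, this]

/-- The `L` lowest binary digits of `n`, starting with the lowest one. -/
def natBits : ℕ → ℕ → List Bool
  | 0, _ => []
  | L + 1, n => (n % 2 == 1) :: natBits L (n / 2)

@[simp] theorem length_natBits (L n : ℕ) : (natBits L n).length = L := by
  induction L generalizing n with
  | zero => rfl
  | succ L ih => simp [natBits, ih]

theorem natBits_injOn (L : ℕ) {m n : ℕ} (hm : m < 2 ^ L) (hn : n < 2 ^ L)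
    (h : natBits L m = natBits L n) : m = n := by
  induction L generalizing m n with
  | zero => simp at hm hn; omega
  | succ L ih =>
    simp only [natBits, List.cons.injEq] at h
    have := ih (by omega) (by omega) h.2
    have h1 : (m % 2 = 1) ↔ (n % 2 = 1) := by simpa using congrArg (· = true) h.1
    omega

theorem exists_natBits (l : List Bool) : ∃ n < 2 ^ l.length, natBits l.length n = l := by
  induction l with
  | nil => exact ⟨0, by simp, rfl⟩
  | cons b l ih =>
    obtain ⟨n, hn, h⟩ := ih
    refine ⟨2 * n + b.toNat, ?_, ?_⟩
    · cases b <;> simp [pow_succ] <;> omega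
    · simp only [List.length_cons, natBits]
      congr 1
      · cases b <;> simp [Nat.add_mod]
      · rw [← h]
        congr 1
        · simp
        · cases b <;> simp <;> omega

theorem natBits_zero (L : ℕ) : natBits L 0 = List.replicate L false := by
  induction L with
  | zero => rfl
  | succ L ih => simp [natBits, ih, List.replicate_succ]

end StackProg

/-! ### Routines of the reduction -/

namespace StackProg

open Function (update)

open Cmd

/-- The stacks of the reduction. -/
inductive RedStack
  | inp | out | g | g2 | sS | w | bB | u | v | nu | nur | nv | nvr | e | y | y2 | j | j2
  | t1 | t2 | t3 | t4 | t5 | t6 | rc | cnt | wt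
  deriving DecidableEq

instance : Fintype RedStack :=
  ⟨{.inp, .out, .g, .g2, .sS, .w, .bB, .u, .v, .nu, .nur, .nv, .nvr, .e, .y, .y2, .j, .j2,
    .t1, .t2, .t3, .t4, .t5, .t6, .rc, .cnt, .wt}, fun k => by cases k <;> decide⟩

/-- The control values of the reduction. -/
@[ext] structure Flags where
  bad : Bool := false
  same : Bool := false
  ne : Bool := false
  m : Bool := false
  pol : Bool := false
  seen : Bool := false
  cl : Cell := none

noncomputable instance : Fintype Flags :=
  Fintype.ofInjective (β := Bool × Bool × Bool × Bool × Bool × Bool × Cell)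
    (fun f => (f.bad, f.same, f.ne, f.m, f.pol, f.seen, f.cl))
    (by intro a b h; cases a; cases b; simp_all)

/-- Programs of the reduction. -/
abbrev RCmd : Type := UCmd RedStack Sym Flags

namespace Red

open RedStack

abbrev tt : Sym := .bit true

abbrev ff : Sym := .bit false

theorem Exec.of_eq {M : ℕ} {c : RCmd} {s t t' : Store (fun _ : RedStack => Sym) Flags}
    (h : c.Exec M s t) (h' : t = t') : c.Exec M s t' := h' ▸ h

theorem Store.congr {v : Flags} {s t : RedStack → List Sym} (h : s = t) :
    (⟨v, s⟩ : Store (fun _ : RedStack => Sym) Flags) = ⟨v, t⟩ := h ▸ rfl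

theorem funext₂ {s t : RedStack → List Sym} (a b : RedStack) (ha : s a = t a) (hb : s b = t b)
    (h : ∀ k, k ≠ a → k ≠ b → s k = t k) : s = t := by
  funext k
  by_cases hk : k = a
  · rw [hk, ha]
  · by_cases hk' : k = b
    · rw [hk', hb]
    · exact h k hk hk'

/-- A loop over the symbols of a prefix of a stack. -/
theorem exec_loop_prefix {M : ℕ} {a : RedStack} {test : Option Sym → Bool} {g : Sym → RCmd}
    {l₀ rest : List Sym} (htest : ∀ c ∈ l₀, test (some c) = true) (hrest : test rest.head? = false)
    (st : List Sym → List Sym → Store (fun _ : RedStack => Sym) Flags)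
    (hst : ∀ pre l, pre ++ l = l₀ → (st pre l).stk a = l ++ rest)
    (hstep : ∀ pre c l, pre ++ c :: l = l₀ → (g c).Exec M
      ⟨(st pre (c :: l)).var, update (st pre (c :: l)).stk a (l ++ rest)⟩ (st (pre ++ [c]) l))
    (hM : l₀.length ≤ M) :
    (loop a (fun _ o => test o) (popCase a id fun o => o.elim skip g) : RCmd).Exec M
      (st [] l₀) (st l₀ []) := by
  refine ⟨l₀.length, hM, ?_⟩
  suffices H : ∀ l pre, pre ++ l = l₀ →
      Iter (fun s : Store (fun _ : RedStack => Sym) Flags => test (s.stk a).head? = true)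
        (Cmd.Exec M (popCase a id fun o => o.elim skip g)) l.length (st pre l) (st l₀ []) from
    H l₀ [] rfl
  intro l
  induction l with
  | nil =>
    intro pre h
    have := hst pre [] h
    rw [List.append_nil] at h
    subst h
    exact .finish (by simp [this, hrest])
  | cons c l ih =>
    intro pre h
    have h1 := hst pre (c :: l) h
    refine .step (m := st (pre ++ [c]) l) ?_ ?_ (ih _ (by simpa using h))
    · simpa [h1] using htest c (h ▸ by simp)
    · have h2 := hstep pre c l h
      simpa [Cmd.Exec, h1] using h2

/-- Repeat a program for each symbol of a copy of the stack `a`. -/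
def times (a c t : RedStack) (p : RCmd) : RCmd := seq (copy a c t) (drain c fun _ => p)

/-- Decode a number in unary on the input, pushing as many symbols `c` on the stack `a`, and then
push the word `l`. -/
def readUnary (a : RedStack) (c : Sym) (l : List Sym) : RCmd :=
  seq (loop inp (fun _ o => o.elim false Sym.toBit)
    (popCase inp id fun o => o.elim skip fun _ => push a fun _ => c))
    (seq (popCase inp id fun _ => skip) (pushList a l))

theorem exec_readUnary {M : ℕ} {a : RedStack} (ha : a ≠ inp) (c : Sym) (l : List Sym) (f : Flags)
    (s : RedStack → List Sym) {n : ℕ} {rest : List Bool}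
    (hs : s inp = (encUnary n ++ rest).map .bit) (hn : n ≤ M) :
    (readUnary a c l).Exec M ⟨f, s⟩
      ⟨f, update (update s inp (rest.map .bit)) a (l ++ (List.replicate n c ++ s a))⟩ := by
  have h1 := exec_loop_prefix (M := M) (a := inp) (test := fun o => o.elim false Sym.toBit)
    (g := fun _ => push a fun _ => c) (l₀ := List.replicate n tt) (rest := ff :: rest.map .bit)
    (fun d hd => by rw [List.eq_of_mem_replicate hd]; rfl) rfl
    (fun pre l => ⟨f, update (update s inp (l ++ ff :: rest.map .bit)) a
      (List.replicate pre.length c ++ s a)⟩)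
    (fun pre l _ => by simp [ha.symm]) (fun pre d l _ => ?_) (by simpa using hn)
  · have h0 : (⟨f, s⟩ : Store (fun _ : RedStack => Sym) Flags) = ⟨f, update (update s inp
        (List.replicate n tt ++ ff :: rest.map .bit)) a
        (List.replicate (List.length ([] : List Sym)) c ++ s a)⟩ := by
      refine Store.congr ?_
      refine funext₂ inp a ?_ ?_ fun k h₁ h₂ => ?_ <;> simp [*, Ne.symm ha, encUnary]
    rw [h0]
    refine exec_seq h1 (exec_seq (t := ⟨f, update (update s inp (rest.map .bit)) a
      (List.replicate n c ++ s a)⟩) ?_ (Exec.of_eq (exec_pushList _ _ _) (Store.congr ?_)))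
    · simp only [Cmd.Exec, skip, Store.mk.injEq, id, true_and]
      refine funext₂ inp a ?_ ?_ fun k h₁ h₂ => ?_ <;> simp [*, Ne.symm ha]
    · simp
  · simp only [Cmd.Exec, Store.mk.injEq, true_and]
    refine funext₂ inp a ?_ ?_ fun k h₁ h₂ => ?_ <;> simp [*, Ne.symm ha, List.replicate_succ]

/-- Double a number in unary. -/
def double (a : RedStack) : RCmd :=
  seq (drain a fun c => pushList t1 [c, c]) (move t1 a)

theorem exec_double {M : ℕ} {a : RedStack} (ha : a ≠ t1) (f : Flags) (s : RedStack → List Sym)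
    {n : ℕ} (hs : s a = List.replicate n tt) (ht : s t1 = []) (hn : 2 * n ≤ M) :
    (double a).Exec M ⟨f, s⟩ ⟨f, update s a (List.replicate (2 * n) tt)⟩ := by
  have h1 := exec_drain_replicate (M := M) (a := a) (g := fun c => pushList (σ := Flags) t1 [c, c])
    (n := n) (c := tt) (fun i => ⟨f, update (update s a (List.replicate (n - i) tt)) t1
      (List.replicate (2 * i) tt)⟩) (fun i _ => by simp [ha])
    (fun i hi => Exec.of_eq (exec_pushList _ _ _) (Store.congr ?_)) (by omega)
  · have h0 : (⟨f, s⟩ : Store (fun _ : RedStack => Sym) Flags) = ⟨f, update (update s a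
        (List.replicate (n - 0) tt)) t1 (List.replicate (2 * 0) tt)⟩ := by
      refine Store.congr ?_
      refine funext₂ a t1 ?_ ?_ fun k h₁ h₂ => ?_ <;> simp [*, Ne.symm ha]
    rw [h0]
    refine exec_seq h1 (Exec.of_eq (exec_move (Ne.symm ha) _ _ (by simpa using hn))
      (Store.congr ?_))
    refine funext₂ a t1 ?_ ?_ fun k h₁ h₂ => ?_ <;> simp [*, Ne.symm ha]
  · refine funext₂ a t1 ?_ ?_ fun k h₁ h₂ => ?_ <;> simp [*, Ne.symm ha, Nat.mul_add, List.replicate_succ]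

/-- Halve a number in unary, rounding up. -/
def halve (a : RedStack) : RCmd :=
  seq (loop a (fun _ o => o.isSome)
    (popCase a id fun _ => popCase a id fun _ => push t1 fun _ => tt)) (move t1 a)

theorem exec_halve {M : ℕ} {a : RedStack} (ha : a ≠ t1) (f : Flags) (s : RedStack → List Sym)
    {n : ℕ} (hs : s a = List.replicate n tt) (ht : s t1 = []) (hn : n ≤ M) :
    (halve a).Exec M ⟨f, s⟩ ⟨f, update s a (List.replicate ((n + 1) / 2) tt)⟩ := by
  have h1 : ∀ i, (loop a (fun _ o => o.isSome)
      (popCase a id fun _ => popCase a id fun _ => push t1 fun _ => tt) : RCmd).Exec M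
      ⟨f, update (update s a (List.replicate n tt)) t1 (List.replicate i tt)⟩
      ⟨f, update (update s a []) t1 (List.replicate (i + (n + 1) / 2) tt)⟩ := by
    intro i
    refine ⟨(n + 1) / 2, by omega, ?_⟩
    clear hs hn
    induction n using Nat.strong_induction_on generalizing i with
    | _ n ih =>
    rcases n with _ | n
    · exact .finish (by simp [ha])
    -- Popping two of `n + 1` symbols leaves `n - 1` in truncated subtraction: when a single symbol
    -- is left, the second pop meets an empty stack and changes nothing.
    · rw [show (n + 1 + 1) / 2 = (n - 1 + 1) / 2 + 1 by omega]
      refine .step (m := ⟨f, update (update s a (List.replicate (n - 1) tt)) t1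
        (List.replicate (i + 1) tt)⟩) (by simp [ha, List.replicate_succ]) ?_ ?_
      · simp only [Cmd.Exec, Store.mk.injEq, true_and]
        refine funext₂ a t1 ?_ ?_ fun k h₁ h₂ => ?_ <;> simp [*, Ne.symm ha, List.replicate_succ]
      · have := ih (n - 1) (by omega) (i + 1)
        rwa [show i + 1 + (n - 1 + 1) / 2 = i + ((n - 1 + 1) / 2 + 1) by omega] at this
  have h0 : (⟨f, s⟩ : Store (fun _ : RedStack => Sym) Flags) = ⟨f, update (update s a
      (List.replicate n tt)) t1 (List.replicate 0 tt)⟩ := by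
    refine Store.congr ?_
    refine funext₂ a t1 ?_ ?_ fun k h₁ h₂ => ?_ <;> simp [*, Ne.symm ha]
  rw [h0]
  refine exec_seq (h1 0) (Exec.of_eq (exec_move (Ne.symm ha) _ _ (by simp; omega))
    (Store.congr ?_))
  refine funext₂ a t1 ?_ ?_ fun k h₁ h₂ => ?_ <;> simp [*, Ne.symm ha]

/-- Increase a number in binary, modulo a power of two. -/
def incr (a : RedStack) : RCmd :=
  seq (loop a (fun _ o => o.elim false Sym.toBit)
    (popCase a id fun o => o.elim skip fun _ => push t1 fun _ => ff))
    (seq (popCase a id fun o => o.elim skip fun _ => push a fun _ => tt) (move t1 a))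

/-- The carry runs through the initial ones (lowest digits come first) and stops at the first zero;
if there is none, the counter overflows to zero. -/
theorem natBits_succ (L n : ℕ) : ∃ i, (∃ l, natBits L n = List.replicate i true ++ false :: l ∧
      natBits L (n + 1) = List.replicate i false ++ true :: l ∧ i + 1 + l.length = L) ∨
    i = L ∧ natBits L n = List.replicate L true ∧ natBits L (n + 1) = List.replicate L false := by
  induction L generalizing n with
  | zero => exact ⟨0, .inr ⟨rfl, rfl, rfl⟩⟩
  | succ L ih =>
    rcases Nat.mod_two_eq_zero_or_one n with h | h
    · refine ⟨0, .inl ⟨natBits L (n / 2), ?_, ?_, by simp; omega⟩⟩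
      · simp [natBits, h]
      · have h1 : (n + 1) % 2 = 1 := by omega
        have h2 : (n + 1) / 2 = n / 2 := by omega
        simp [natBits, h1, h2]
    · have h1 : (n + 1) % 2 = 0 := by omega
      have h2 : (n + 1) / 2 = n / 2 + 1 := by omega
      obtain ⟨i, ⟨l, h3, h4, h5⟩ | ⟨h3, h4, h5⟩⟩ := ih (n / 2)
      · exact ⟨i + 1, .inl ⟨l, by simp [natBits, h, h3, List.replicate_succ],
          by simp [natBits, h1, h2, h4, List.replicate_succ], by omega⟩⟩
      · exact ⟨i + 1, .inr ⟨by omega, by simp [natBits, h, h4, List.replicate_succ],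
          by simp [natBits, h1, h2, h5, List.replicate_succ]⟩⟩

theorem exec_incr {M : ℕ} {a : RedStack} (ha : a ≠ t1) (f : Flags) (s : RedStack → List Sym)
    {L n : ℕ} (hs : s a = (natBits L n).map .bit) (ht : s t1 = []) (hn : L ≤ M) :
    (incr a).Exec M ⟨f, s⟩ ⟨f, update s a ((natBits L (n + 1)).map .bit)⟩ := by
  -- Both outcomes of the carry are treated at once: `rest` starts with the zero that is flipped, or
  -- is empty in case of overflow.
  have key : ∀ (i : ℕ) (rest : List Sym), i ≤ M → rest.head?.elim false Sym.toBit = false →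
      s a = List.replicate i tt ++ rest → (incr a).Exec M ⟨f, s⟩ ⟨f, update s a
        (List.replicate i ff ++ (rest.head?.elim [] fun _ => [tt]) ++ rest.tail)⟩ := by
    intro i rest hi hr hs'
    clear hs
    have h1 := exec_loop_prefix (M := M) (a := a) (test := fun o => o.elim false Sym.toBit)
      (g := fun _ => push t1 fun _ => ff) (l₀ := List.replicate i tt) (rest := rest)
      (fun d hd => by rw [List.eq_of_mem_replicate hd]; rfl) hr
      (fun pre l => ⟨f, update (update s a (l ++ rest)) t1 (List.replicate pre.length ff)⟩)
      (fun pre l _ => by simp [ha]) (fun pre d l _ => ?_) (by simpa using hi)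
    · have h0 : (⟨f, s⟩ : Store (fun _ : RedStack => Sym) Flags) = ⟨f, update (update s a
          (List.replicate i tt ++ rest)) t1 (List.replicate (List.length ([] : List Sym)) ff)⟩ := by
        refine Store.congr ?_
        refine funext₂ a t1 ?_ ?_ fun k h₁ h₂ => ?_ <;> simp [*, Ne.symm ha]
      rw [h0]
      refine exec_seq h1 (exec_seq (t := ⟨f, update (update s a
        ((rest.head?.elim [] fun _ => [tt]) ++ rest.tail)) t1 (List.replicate i ff)⟩) ?_
        (Exec.of_eq (exec_move (Ne.symm ha) _ _ (by simpa using hi)) (Store.congr ?_)))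
      · rcases rest with _ | ⟨c, rest⟩
        · simp only [Cmd.Exec, Store.mk.injEq, id, Option.elim, skip, ha, ne_eq, not_false_eq_true,
            Function.update_of_ne, Function.update_self, List.nil_append, List.head?_nil, true_and,
            List.tail_nil]
          refine funext₂ a t1 ?_ ?_ fun k h₁ h₂ => ?_ <;> simp [*, Ne.symm ha]
        · simp only [Cmd.Exec, Store.mk.injEq, id, Option.elim, skip, ha, ne_eq, not_false_eq_true,
            Function.update_of_ne, Function.update_self, List.nil_append, List.head?_cons, true_and,
            List.tail_cons]
          refine funext₂ a t1 ?_ ?_ fun k h₁ h₂ => ?_ <;> simp [*, Ne.symm ha]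
      · refine funext₂ a t1 ?_ ?_ fun k h₁ h₂ => ?_ <;> simp [*, Ne.symm ha]
    · simp only [Cmd.Exec, Store.mk.injEq, true_and]
      refine funext₂ a t1 ?_ ?_ fun k h₁ h₂ => ?_ <;> simp [*, Ne.symm ha, List.replicate_succ]
  obtain ⟨i, ⟨l, h3, h4, h5⟩ | ⟨h3, h4, h5⟩⟩ := natBits_succ L n
  · refine Exec.of_eq (key i (ff :: l.map .bit) (by omega) rfl (by simp [hs, h3]))
      (Store.congr ?_)
    simp [h4]
  · refine Exec.of_eq (key i [] (by omega) rfl (by simp [hs, h3, h4])) (Store.congr ?_)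
    simp [h5, h3]

end Red

end StackProg

/-! ### Reading a circuit -/

namespace StackProg

open Function (update)

open Cmd

/-- The word marking position `i`. -/
def mark (i : ℕ) : List Bool := List.replicate i false ++ [true]

/-- The generalised gate of a gate of a Boolean circuit. -/
def GenGate.ofGate {w : ℕ} : BoolGate w → GenGate
  | .unary f i => ⟨false, fun y A _ => y == f A, mark i, []⟩
  | .binary f i j => ⟨false, fun y A α => y == f A α, mark i, mark j⟩
  | .bigAnd S => ⟨false, fun y A _ => y == A, BoolGate.encSet S, []⟩
  -- De Morgan: with `pol = true` the value `A` says that all marked wires are false, and the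
  -- disjunction is its negation.
  | .bigOr S => ⟨true, fun y A _ => y == !A, BoolGate.encSet S, []⟩
  | .toffoli S t => ⟨false, fun y A α => y == xor α A, BoolGate.encSet S, mark t⟩

/-- An unconstrained wire. -/
def GenGate.free : GenGate := ⟨false, fun _ _ _ => true, [], []⟩

/-- The requirement that wire `i` is true. -/
def GenGate.accept (i : ℕ) : GenGate := ⟨false, fun _ _ α => α, [], mark i⟩

/-- The constraints on the wires of a circuit, followed by the requirement that it accepts. -/
def genGates (C : BoolCircuit) : List GenGate :=
  List.replicate C.inputs .free ++ ((List.finRange C.size).map (fun i => .ofGate (C.gate i)) ++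
    [.accept C.output])

namespace Red

open RedStack

/-- Read a bit and go on accordingly. -/
def readBit (a : RedStack) (p : Bool → RCmd) : RCmd :=
  popCase a id fun o => p (o.elim false Sym.toBit)

theorem exec_readBit {M : ℕ} {a : RedStack} {p : Bool → RCmd} {f : Flags} {s : RedStack → List Sym}
    {t : Store (fun _ : RedStack => Sym) Flags} {b : Bool} {l : List Bool}
    (hs : s a = (b :: l).map .bit) (h : (p b).Exec M ⟨f, update s a (l.map .bit)⟩ t) :
    (readBit a p).Exec M ⟨f, s⟩ t := by
  simpa [readBit, Cmd.Exec, hs, Sym.toBit] using h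

/-- Copy as many symbols of the input as there are wires. -/
def readSet : RCmd :=
  seq (copy w t2 t3) (drain t2 fun _ => popCase inp id fun o => o.elim skip fun c =>
    push g2 fun _ => c)

theorem exec_readSet {M : ℕ} (f : Flags) (s : RedStack → List Sym) {n : ℕ} {l rest : List Bool}
    (hi : s inp = (l ++ rest).map .bit) (hw : s w = List.replicate n tt) (hl : l.length = n)
    (h2 : s t2 = []) (h3 : s t3 = []) (hM : n ≤ M) :
    readSet.Exec M ⟨f, s⟩
      ⟨f, update (update s inp (rest.map .bit)) g2 ((l.map .bit).reverse ++ s g2)⟩ := by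
  refine exec_seq (exec_copy (by decide) (by decide) (by decide) f s h3 (by simpa [hw])) ?_
  have := exec_drain_replicate (M := M) (a := t2) (g := fun _ => popCase inp id fun o =>
      o.elim skip fun c => push (σ := Flags) g2 fun _ => c) (n := n) (c := tt)
    (fun i => ⟨f, update (update (update s t2 (List.replicate (n - i) tt)) inp
      ((l.drop i ++ rest).map .bit)) g2 (((l.take i).map .bit).reverse ++ s g2)⟩)
    (fun i _ => by simp) (fun i hi => ?_) hM
  · convert this using 2
    · funext k
      cases k <;> simp [hi, hw, h2]
    · funext k
      cases k <;> simp [← hl, h2]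
  · have hd : l.drop i = l[i] :: l.drop (i + 1) := List.drop_eq_getElem_cons (by omega)
    have ht : l.take (i + 1) = l.take i ++ [l[i]] := List.take_succ_eq_append_getElem (by omega)
    simp only [hd, ht, Cmd.Exec, Store.mk.injEq]
    simp only [ne_eq, reduceCtorEq, not_false_eq_true, Function.update_of_ne, Function.update_self,
      List.cons_append, List.map_cons, List.head?_cons, id, Option.elim, Cmd.Exec, List.tail_cons,
      Store.mk.injEq, true_and]
    funext k
    cases k <;> simp [-List.map_take, -List.map_drop, -List.take_append_getElem]

/-- Read a gate of a circuit. -/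
def readGate : RCmd :=
  seq (readBit inp fun b₁ => readBit inp fun b₂ => readBit inp fun b₃ =>
    cond b₁
      (seq (push g2 fun _ => .hdr false fun y A α => y == xor α A) (seq readSet
        (seq (push g2 fun _ => .sep) (readUnary g2 ff [.fin, tt]))))
    -- Conjunctions and disjunctions share this branch: their codes differ only in `b₃`, which
    -- serves as the polarity and negates `A`.
    (cond b₂
      (seq (push g2 fun _ => .hdr b₃ fun y A _ => y == xor b₃ A) (seq readSet
        (pushList g2 [.fin, .sep])))
    (cond b₃
      (readBit inp fun c₀ => readBit inp fun c₁ => readBit inp fun c₂ => readBit inp fun c₃ =>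
        seq (push g2 fun _ => .hdr false fun y A α => y == cond A (cond α c₃ c₂) (cond α c₁ c₀))
          (seq (readUnary g2 ff [.sep, tt]) (readUnary g2 ff [.fin, tt])))
      (readBit inp fun c₀ => readBit inp fun c₁ =>
        seq (push g2 fun _ => .hdr false fun y A _ => y == cond A c₁ c₀)
          (readUnary g2 ff [.fin, .sep, tt])))))
    (push w fun _ => tt)

theorem exec_push {M : ℕ} (a : RedStack) (c : Sym) (f : Flags) (s : RedStack → List Sym) :
    (push a fun _ => c : RCmd).Exec M ⟨f, s⟩ ⟨f, update s a (c :: s a)⟩ := rfl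

theorem exec_readGate {M : ℕ} (f : Flags) (s : RedStack → List Sym) {n : ℕ} (b : BoolGate n)
    {rest : List Bool} (hi : s inp = (b.encode ++ rest).map .bit) (hw : s w = List.replicate n tt)
    (h2 : s t2 = []) (h3 : s t3 = []) (hM : n ≤ M) :
    readGate.Exec M ⟨f, s⟩ ⟨f, update (update (update s inp (rest.map .bit)) g2
      ((GenGate.ofGate b).encode.reverse ++ s g2)) w (List.replicate (n + 1) tt)⟩ := by
  refine exec_seq (t := ⟨f, update (update s inp (rest.map .bit)) g2
      ((GenGate.ofGate b).encode.reverse ++ s g2)⟩) ?_ (Exec.of_eq (exec_push _ _ _ _)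
      (Store.congr ?_))
  · cases b with
    | unary F i =>
      have hF : (fun (y A _ : Bool) => y == cond A (F true) (F false)) =
          fun y A _ => y == F A := by
        funext y A _
        cases A <;> rfl
      refine exec_readBit (b := false) (l := [false, false, F false, F true] ++ encUnary i ++ rest)
        (by simp [hi, BoolGate.encode]) ?_
      refine exec_readBit (b := false) (l := [false, F false, F true] ++ encUnary i ++ rest)
        (by simp) ?_
      refine exec_readBit (b := false) (l := [F false, F true] ++ encUnary i ++ rest) (by simp) ?_
      simp only [cond_false]
      refine exec_readBit (b := F false) (l := [F true] ++ encUnary i ++ rest) (by simp) ?_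
      refine exec_readBit (b := F true) (l := encUnary i ++ rest) (by simp) ?_
      refine exec_seq (exec_push _ _ _ _) (Exec.of_eq (exec_readUnary (by decide) _ _ _ _ (n := i)
        (rest := rest) (by simp) (by have := i.2; omega)) (Store.congr ?_))
      funext k
      cases k <;> simp [GenGate.ofGate, GenGate.encode, mark, hF]
    | binary F i j =>
      have hF : (fun (y A α : Bool) => y == cond A (cond α (F true true) (F true false))
          (cond α (F false true) (F false false))) = fun y A α => y == F A α := by
        funext y A α
        cases A <;> cases α <;> rfl
      refine exec_readBit (b := false) (l := [false, true, F false false, F false true,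
        F true false, F true true] ++ (encUnary i ++ encUnary j) ++ rest)
        (by simp [hi, BoolGate.encode]) ?_
      refine exec_readBit (b := false) (l := [true, F false false, F false true, F true false,
        F true true] ++ (encUnary i ++ encUnary j) ++ rest) (by simp) ?_
      refine exec_readBit (b := true) (l := [F false false, F false true, F true false,
        F true true] ++ (encUnary i ++ encUnary j) ++ rest) (by simp) ?_
      simp only [cond_false, cond_true]
      refine exec_readBit (b := F false false) (l := [F false true, F true false,
        F true true] ++ (encUnary i ++ encUnary j) ++ rest) (by simp) ?_
      refine exec_readBit (b := F false true) (l := [F true false,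
        F true true] ++ (encUnary i ++ encUnary j) ++ rest) (by simp) ?_
      refine exec_readBit (b := F true false) (l := [F true true] ++ (encUnary i ++ encUnary j) ++
        rest) (by simp) ?_
      refine exec_readBit (b := F true true) (l := encUnary i ++ (encUnary j ++ rest))
        (by simp) ?_
      refine exec_seq (exec_push _ _ _ _) (exec_seq (exec_readUnary (by decide) _ _ _ _ (n := i)
        (rest := encUnary j ++ rest) (by simp) (by have := i.2; omega)) (Exec.of_eq
        (exec_readUnary (by decide) _ _ _ _ (n := j) (rest := rest) (by simp)
          (by have := j.2; omega)) (Store.congr ?_)))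
      funext k
      cases k <;> simp [GenGate.ofGate, GenGate.encode, mark, hF]
    | bigAnd S =>
      refine exec_readBit (b := false) (l := [true, false] ++ BoolGate.encSet S ++ rest)
        (by simp [hi, BoolGate.encode]) ?_
      refine exec_readBit (b := true) (l := [false] ++ BoolGate.encSet S ++ rest) (by simp) ?_
      refine exec_readBit (b := false) (l := BoolGate.encSet S ++ rest) (by simp) ?_
      refine exec_seq (exec_push _ _ _ _) (exec_seq (exec_readSet _ _ (l := BoolGate.encSet S)
        (rest := rest) (n := n) (by simp) (by simpa using hw) (by simp [BoolGate.encSet])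
        (by simpa using h2) (by simpa using h3) hM) (Exec.of_eq (exec_pushList _ _ _)
        (Store.congr ?_)))
      funext k
      cases k <;> simp [GenGate.ofGate, GenGate.encode]
    | bigOr S =>
      refine exec_readBit (b := false) (l := [true, true] ++ BoolGate.encSet S ++ rest)
        (by simp [hi, BoolGate.encode]) ?_
      refine exec_readBit (b := true) (l := [true] ++ BoolGate.encSet S ++ rest) (by simp) ?_
      refine exec_readBit (b := true) (l := BoolGate.encSet S ++ rest) (by simp) ?_
      refine exec_seq (exec_push _ _ _ _) (exec_seq (exec_readSet _ _ (l := BoolGate.encSet S)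
        (rest := rest) (n := n) (by simp) (by simpa using hw) (by simp [BoolGate.encSet])
        (by simpa using h2) (by simpa using h3) hM) (Exec.of_eq (exec_pushList _ _ _)
        (Store.congr ?_)))
      funext k
      cases k <;> simp [GenGate.ofGate, GenGate.encode]
    | toffoli S t =>
      refine exec_readBit (b := true) (l := [false, false] ++ (BoolGate.encSet S ++ encUnary t) ++
        rest) (by simp [hi, BoolGate.encode]) ?_
      refine exec_readBit (b := false) (l := [false] ++ (BoolGate.encSet S ++ encUnary t) ++ rest)
        (by simp) ?_
      refine exec_readBit (b := false) (l := BoolGate.encSet S ++ (encUnary t ++ rest))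
        (by simp) ?_
      refine exec_seq (exec_push _ _ _ _) (exec_seq (exec_readSet _ _ (l := BoolGate.encSet S)
        (rest := encUnary t ++ rest) (n := n) (by simp) (by simpa using hw)
        (by simp [BoolGate.encSet]) (by simpa using h2) (by simpa using h3) hM)
        (exec_seq (exec_push _ _ _ _) (Exec.of_eq (exec_readUnary (by decide) _ _ _ _ (n := t)
        (rest := rest) (by simp) (by have := t.2; omega)) (Store.congr ?_))))
      funext k
      cases k <;> simp [GenGate.ofGate, GenGate.encode, mark]
  · funext k
    cases k <;> simp [hw, List.replicate_succ]

/-- Read a circuit. -/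
def readCircuit : RCmd :=
  seq (readUnary t4 tt []) (seq (drain t4 fun _ =>
      seq (pushList g2 GenGate.free.encode.reverse) (push w fun _ => tt))
    (seq (readUnary t4 tt []) (seq (drain t4 fun _ => readGate)
      (seq (pushList g2 [.sep, .hdr false fun _ _ α => α]) (seq (readUnary g2 ff [.fin, tt])
        (seq (push w fun _ => tt) (move g2 g)))))))

/-- The stack `w` counts the wires read so far. This count is needed while reading, since the code
of a set in gate `i` has length `C.inputs + i`. Constraints pile up in reverse on `g2` and are
turned around at the end. -/
theorem exec_readCircuit {M : ℕ} (f : Flags) (s : RedStack → List Sym) (C : BoolCircuit)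
    (hi : s inp = C.encode.map .bit) (hw : s w = []) (h2 : s t2 = []) (h3 : s t3 = [])
    (h4 : s t4 = []) (hg : s g = []) (hg2 : s g2 = []) (hM : C.inputs + C.size ≤ M)
    (hM' : ((genGates C).flatMap GenGate.encode).length ≤ M) :
    readCircuit.Exec M ⟨f, s⟩ ⟨f, update (update (update s inp []) w
      (List.replicate (C.inputs + C.size + 1) tt)) g ((genGates C).flatMap GenGate.encode)⟩ := by
  set G := (List.finRange C.size).flatMap fun i => (C.gate i).encode with hG
  set s1 := update (update s inp ((encUnary C.size ++ (G ++ encUnary C.output)).map .bit)) t4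
    (List.replicate C.inputs tt) with hs1
  -- `F₁ i` and, below, `F₂ i` are the contents of `g2` after `i` inputs and after `i` gates; they
  -- are the invariants of the two loops.
  set F₁ : ℕ → List Sym := fun i => ((List.replicate i GenGate.free).flatMap GenGate.encode).reverse
    with hF₁
  set s2 := update (update (update s inp ((encUnary C.size ++ (G ++ encUnary C.output)).map .bit))
    w (List.replicate C.inputs tt)) g2 (F₁ C.inputs) with hs2
  set F₂ : ℕ → List Sym := fun i => (((List.finRange C.size).take i).flatMap fun i =>
    (GenGate.ofGate (C.gate i)).encode).reverse ++ F₁ C.inputs with hF₂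
  have e1 : (readUnary t4 tt []).Exec M ⟨f, s⟩ ⟨f, s1⟩ := by
    refine Exec.of_eq (exec_readUnary (by decide) _ _ _ _ (n := C.inputs)
      (rest := encUnary C.size ++ (G ++ encUnary C.output)) (by rw [hi]; rfl) (by omega))
      (Store.congr ?_)
    simp [hs1, h4]
  have e2 := exec_drain_replicate (M := M) (a := t4) (g := fun _ : Sym =>
      seq (pushList (σ := Flags) g2 GenGate.free.encode.reverse) (push w fun _ => tt))
    (n := C.inputs) (c := tt) (fun i => ⟨f, update (update (update s1 t4
      (List.replicate (C.inputs - i) tt)) w (List.replicate i tt)) g2 (F₁ i)⟩)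
    (fun i _ => by simp) (fun i hi => exec_seq (exec_pushList _ _ _) (by
      simp only [Cmd.Exec, Store.mk.injEq, true_and]
      funext k
      cases k <;> simp [hF₁, List.replicate_succ']
      exact List.replicate_succ'.symm.trans List.replicate_succ)) (by omega)
  have e3 : (readUnary t4 tt []).Exec M ⟨f, s2⟩ ⟨f, update (update s2 inp
      ((G ++ encUnary C.output).map .bit)) t4 (List.replicate C.size tt)⟩ := by
    refine Exec.of_eq (exec_readUnary (by decide) _ _ _ _ (n := C.size)
      (rest := G ++ encUnary C.output) (by simp [hs2]) (by omega)) (Store.congr ?_)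
    simp [hs2, h4]
  have e4 := exec_drain_replicate (M := M) (a := t4) (g := fun _ : Sym => readGate)
    (n := C.size) (c := tt) (fun i => ⟨f, update (update (update (update s2 inp
      (((((List.finRange C.size).drop i).flatMap fun i => (C.gate i).encode) ++
        encUnary C.output).map .bit)) t4
      (List.replicate (C.size - i) tt)) w (List.replicate (C.inputs + i) tt)) g2 (F₂ i)⟩)
    (fun i _ => by simp) (fun i hi => by
      have hd : (List.finRange C.size).drop i = ⟨i, hi⟩ :: (List.finRange C.size).drop (i + 1) := by
        rw [List.drop_eq_getElem_cons (by simpa using hi)]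
        simp
      have ht : (List.finRange C.size).take (i + 1) = (List.finRange C.size).take i ++ [⟨i, hi⟩] := by
        rw [List.take_succ_eq_append_getElem (by simpa using hi)]
        simp
      refine Exec.of_eq (exec_readGate _ _ (n := C.inputs + i) (C.gate ⟨i, hi⟩)
        (rest := (((List.finRange C.size).drop (i + 1)).flatMap fun i => (C.gate i).encode) ++
          encUnary C.output) (by simp [hd]) (by simp) (by simp [hs2, h2]) (by simp [hs2, h3])
        (by omega)) (Store.congr ?_)
      funext k
      cases k <;> simp [hF₂, ht, Nat.add_assoc]) (by omega)
  have hfin : F₂ C.size = (((List.replicate C.inputs GenGate.free ++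
      (List.finRange C.size).map fun i => GenGate.ofGate (C.gate i))).flatMap
        GenGate.encode).reverse := by
    simp only [hF₂, hF₁, List.flatMap_append, List.reverse_append, List.flatMap_map]
    rw [List.take_of_length_le (by simp)]
  have hall : (genGates C).flatMap GenGate.encode = (F₂ C.size).reverse ++
      (GenGate.accept C.output).encode := by
    simp [hfin, genGates]
  have hdn : (List.finRange C.size).drop C.size = [] := List.drop_eq_nil_of_le (by simp)
  refine exec_seq e1 (exec_seq (t := ⟨f, s2⟩) ?_ (exec_seq e3 (exec_seq
    (t := ⟨f, update (update (update s2 inp ((encUnary C.output).map .bit)) w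
      (List.replicate (C.inputs + C.size) tt)) g2 (F₂ C.size)⟩) ?_ (exec_seq (exec_pushList _ _ _)
      (exec_seq (exec_readUnary (by decide) _ _ _ _ (n := C.output) (rest := []) (by simp)
        (by have := C.output.2; omega)) (exec_seq (exec_push _ _ _ _)
        (Exec.of_eq (exec_move (by decide) _ _ ?_) (Store.congr ?_))))))))
  · convert e2 using 2
    · funext k
      cases k <;> simp [hs1, hw, hg2, hF₁]
    · funext k
      cases k <;> simp [hs1, hs2, h4]
  · convert e4 using 2
    · funext k
      cases k <;> simp [hs2, hF₂, hG]
    · funext k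
      cases k <;> simp [hs2, h4, hdn]
  · rw [hall] at hM'
    simp only [GenGate.encode, GenGate.accept, mark, List.length_append, List.length_reverse,
      List.length_cons, List.map_nil, List.nil_append, List.length_map, List.length_replicate,
      List.length_nil] at hM'
    simp
    omega
  · rw [hall]
    funext k
    cases k <;> simp [hs2, hg, hg2, GenGate.encode, GenGate.accept, mark, List.replicate_succ]

end Red

end StackProg

/-! ### Comparing claims with what is known about the wires -/

namespace StackProg

open Function (update)

open Cmd

/-- The cell stored in a symbol. -/
def Sym.toCell : Sym → Cell
  | .cell c => c
  | _ => none

namespace Red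

open RedStack

/-- Move a symbol. -/
def shift (a b : RedStack) : RCmd := popCase a id fun o => o.elim skip fun c => push b fun _ => c

theorem exec_shift {M : ℕ} {a b : RedStack} {f : Flags} {s : RedStack → List Sym} {c : Sym}
    {l : List Sym} (hs : s a = c :: l) (hab : b ≠ a) :
    (shift a b).Exec M ⟨f, s⟩ ⟨f, update (update s a l) b (c :: s b)⟩ := by
  simp [shift, Cmd.Exec, hs, hab]

/-- Read a word of the gate list together with the list of cells, and find out whether some bit
and the cell at the same position have a property. -/
def scan (p : Bool → Cell → Bool → Cell → Bool) : RCmd :=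
  seq (loop g (fun _ o => o.elim false Sym.isBit) (popCase g id fun o => o.elim skip fun c =>
    seq (push g2 fun _ => c) (popCase y id fun o => o.elim skip fun d => seq (push y2 fun _ => d)
      (load fun f => { f with seen := f.seen || p f.pol f.cl c.toBit d.toCell })))) (move y2 y)

/-- A word of marks and the list of cells are walked through in parallel. If the cells run out
first, further pops leave the flag unchanged, in accordance with the truncation in `List.zip`.
Moving `y2` back to `y` restores the cells. -/
theorem exec_scan {M : ℕ} (p : Bool → Cell → Bool → Cell → Bool) (f : Flags)
    (s : RedStack → List Sym) {S : List Bool} {rest : List Sym} {Y : List Cell}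
    (hg : s g = S.map .bit ++ rest) (hrest : rest.head?.elim false Sym.isBit = false)
    (hy : s y = Y.map .cell) (hy2 : s y2 = []) (hS : S.length ≤ M) (hf : f.seen = false) :
    (scan p).Exec M ⟨f, s⟩ ⟨{ f with seen := (S.zip Y).any fun q => p f.pol f.cl q.1 q.2 },
      update (update s g rest) g2 ((S.map .bit).reverse ++ s g2)⟩ := by
  have key : ∀ (S : List Bool) (b : Bool) (Y : List Cell) (Y2 G2 : List Sym),
      Iter (fun s : Store (fun _ : RedStack => Sym) Flags =>
        (s.stk g).head?.elim false Sym.isBit = true) (Cmd.Exec M (popCase g id fun o =>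
          o.elim skip fun c => seq (push g2 fun _ => c) (popCase y id fun o => o.elim skip fun d =>
            seq (push y2 fun _ => d) (load fun f =>
              { f with seen := f.seen || p f.pol f.cl c.toBit d.toCell })))) S.length
        ⟨{ f with seen := b }, update (update (update (update s g (S.map .bit ++ rest)) g2 G2) y
          (Y.map .cell)) y2 Y2⟩
        ⟨{ f with seen := b || (S.zip Y).any fun q => p f.pol f.cl q.1 q.2 },
          update (update (update (update s g rest) g2 ((S.map .bit).reverse ++ G2)) y
          ((Y.drop S.length).map .cell)) y2 (((Y.take S.length).map .cell).reverse ++ Y2)⟩ := by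
    intro S
    induction S with
    | nil => exact fun b Y Y2 G2 => by simpa using .finish (by simp [hrest])
    | cons c S ih =>
      intro b Y Y2 G2
      rcases Y with _ | ⟨d, Y⟩
      · refine .step (m := ⟨{ f with seen := b }, update (update (update (update s g
          (S.map .bit ++ rest)) g2 (.bit c :: G2)) y []) y2 Y2⟩) (by simp [Sym.isBit]) ?_ ?_
        · simp only [Cmd.Exec]
          refine ⟨_, rfl, ?_⟩
          simp only [Cmd.Exec, skip]
          simp only [List.map_nil, ne_eq, reduceCtorEq, not_false_eq_true, Function.update_of_ne,
            Function.update_self, List.head?_nil, id, Option.elim, Cmd.Exec, List.tail_nil,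
            Store.mk.injEq, true_and]
          funext k
          cases k <;> simp
        · simpa using ih b [] Y2 (.bit c :: G2)
      · refine .step (m := ⟨{ f with seen := b || p f.pol f.cl c d }, update (update (update
          (update s g (S.map .bit ++ rest)) g2 (.bit c :: G2)) y (Y.map .cell)) y2
          (.cell d :: Y2)⟩) (by simp [Sym.isBit]) ?_ ?_
        · simp only [Cmd.Exec]
          refine ⟨_, rfl, ?_⟩
          simp only [Cmd.Exec]
          simp only [List.map_cons, ne_eq, reduceCtorEq, not_false_eq_true, Function.update_of_ne,
            Function.update_self, List.head?_cons, id, Option.elim, Cmd.Exec, List.tail_cons]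
          refine ⟨_, rfl, ?_⟩
          simp only [Sym.toBit, Sym.toCell, Store.mk.injEq, true_and]
          funext k
          cases k <;> simp
        · simpa [Bool.or_assoc] using ih (b || p f.pol f.cl c d) Y (.cell d :: Y2) (.bit c :: G2)
  have h0 : (⟨f, s⟩ : Store (fun _ : RedStack => Sym) Flags) = ⟨{ f with seen := false },
      update (update (update (update s g (S.map .bit ++ rest)) g2 (s g2)) y (Y.map .cell)) y2 []⟩ := by
    congr 1
    · rw [← hf]
    · funext k
      cases k <;> simp [hg, hy, hy2]
  rw [h0]
  refine exec_seq ⟨_, hS, key S false Y [] (s g2)⟩ (Exec.of_eq (exec_move (by decide) _ _ ?_) ?_)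
  · simp
    omega
  · simp only [Bool.false_or, Store.mk.injEq, true_and]
    funext k
    cases k <;> simp [hy2, hy, ← List.map_drop, ← List.map_take, ← List.map_append]

/-- Compare the claims for a wire with what is known about all wires. -/
def checkGate : RCmd :=
  seq (pop e fun f o => { f with cl := o.elim none Sym.toCell })
  (seq (popCase g id fun o => o.elim skip fun c => seq (push g2 fun _ => c) (load fun f =>
    match c with
    | .hdr p r => { f with
        pol := p
        m := f.cl.elim true fun c => r c.1 c.2.1 c.2.2.1
        seen := false }
    | _ => f))
  (seq (scan fun p _ b d => b && d.elim false fun x => x.1 == p)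
  (seq (shift g g2)
  (seq (load fun f => { f with
    m := f.m && f.cl.elim true fun c => cond c.2.1 (!f.seen) (!c.2.2.2 || f.seen)
    seen := false })
  (seq (scan fun _ c b d => b && d.elim false fun x => x.1 != c.elim false fun c => c.2.2.1)
  (seq (shift g g2)
  (load fun f =>
    { bad := f.bad || !(f.m && f.cl.elim true fun _ => !f.seen), same := f.same, ne := f.ne })))))))

/-- The flag `m` collects the conjuncts of `GenGate.ok`: the relation, then the test of `A` by a
scan of `fst`; the test of `α` by a scan of `snd` comes last. A missing or empty cell makes no claim
and never sets `bad`. -/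
theorem exec_checkGate {M : ℕ} (b₁ b₂ b₃ : Bool) (s : RedStack → List Sym) {G : GenGate}
    {rest : List Sym} {E Y : List Cell} (hg : s g = G.encode ++ rest) (he : s e = E.map .cell)
    (hy : s y = Y.map .cell) (hy2 : s y2 = []) (hG : G.encode.length ≤ M) :
    checkGate.Exec M ⟨{ bad := b₁, same := b₂, ne := b₃ }, s⟩
      ⟨{ bad := b₁ || E.head?.elim false (fun c => !G.ok c Y), same := b₂, ne := b₃ },
        update (update (update s g rest) g2 (G.encode.reverse ++ s g2)) e (E.tail.map .cell)⟩ := by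
  obtain ⟨p, r, S, T⟩ := G
  simp only [GenGate.encode, List.length_cons, List.length_append, List.length_map] at hG
  set c : Cell := E.head?.elim none id with hc
  set s1 := update (update (update s g (S.map .bit ++ .sep :: (T.map .bit ++ .fin :: rest)))
    g2 (.hdr p r :: s g2)) e (E.tail.map .cell) with hs1
  refine exec_seq (t := ⟨{ bad := b₁, same := b₂, ne := b₃, cl := c }, update s e
    (E.tail.map .cell)⟩) ?_ (exec_seq (t := ⟨⟨b₁, b₂, b₃,
      c.elim true fun c => r c.1 c.2.1 c.2.2.1, p, false, c⟩, s1⟩) ?_ (exec_seq (exec_scan _ _ _ (S := S)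
      (rest := .sep :: (T.map .bit ++ .fin :: rest)) (Y := Y) (by simp [hs1]) rfl
      (by simp [hs1, hy]) (by simp [hs1, hy2]) (by omega) rfl) (exec_seq (exec_shift
      (c := .sep) (l := T.map .bit ++ .fin :: rest) (by simp) (by decide)) (exec_seq rfl
      (exec_seq (exec_scan _ _ _ (S := T) (rest := .fin :: rest) (Y := Y) (by simp) rfl
      (by simp [hs1, hy]) (by simp [hs1, hy2]) (by omega) rfl) (exec_seq (exec_shift
      (c := .fin) (l := rest) (by simp) (by decide)) ?_))))))
  · simp only [Cmd.Exec, he]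
    rcases E with _ | ⟨d, E⟩ <;> simp [hc, Sym.toCell]
  · simp only [Cmd.Exec, ne_eq, reduceCtorEq, not_false_eq_true, Function.update_of_ne, hg,
      GenGate.encode, List.cons_append, List.head?_cons, id, Option.elim, List.tail_cons]
    refine ⟨_, rfl, ?_⟩
    simp only [Cmd.Exec, Store.mk.injEq]
    refine ⟨trivial, ?_⟩
    funext k
    cases k <;> simp [hs1]
  · simp only [Cmd.Exec, Store.mk.injEq]
    constructor
    · rcases E with _ | ⟨_ | ⟨y, A, α, m⟩, E⟩
      · simp [hc]
      · simp [hc, GenGate.ok]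
      · simp only [hc, List.head?_cons, Option.elim, GenGate.ok, seenOther, seenFalse, id,
          Flags.mk.injEq, and_true]
        congr 2
        -- The program tests `A` before `α`, whereas `GenGate.ok` lists them in the opposite order.
        rw [Bool.and_right_comm]
    · funext k
      cases k <;> simp [hs1, GenGate.encode]

/-- Compare all claims of a block with what is known about the wires. -/
def checkAll : RCmd := seq (loop g (fun _ o => o.isSome) checkGate) (move g2 g)

theorem exec_checkAll {M : ℕ} (b₁ b₂ b₃ : Bool) (s : RedStack → List Sym) {G : List GenGate}
    {E Y : List Cell} (hg : s g = G.flatMap GenGate.encode) (he : s e = E.map .cell)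
    (hy : s y = Y.map .cell) (hy2 : s y2 = []) (hg2 : s g2 = [])
    (hG : (G.flatMap GenGate.encode).length ≤ M) :
    checkAll.Exec M ⟨{ bad := b₁, same := b₂, ne := b₃ }, s⟩
      ⟨{ bad := b₁ || (G.zip E).any fun p => !p.1.ok p.2 Y, same := b₂, ne := b₃ },
        update s e ((E.drop G.length).map .cell)⟩ := by
  have key : ∀ (G : List GenGate) (b : Bool) (E : List Cell) (G2 : List Sym),
      (G.flatMap GenGate.encode).length ≤ M →
      Iter (fun s : Store (fun _ : RedStack => Sym) Flags => (s.stk g).head?.isSome = true)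
        (Cmd.Exec M checkGate) G.length
        ⟨{ bad := b, same := b₂, ne := b₃ }, update (update (update s g
          (G.flatMap GenGate.encode)) g2 G2) e (E.map .cell)⟩
        ⟨{ bad := b || (G.zip E).any fun p => !p.1.ok p.2 Y, same := b₂, ne := b₃ },
          update (update (update s g []) g2 ((G.flatMap GenGate.encode).reverse ++ G2)) e
          ((E.drop G.length).map .cell)⟩ := by
    intro G
    induction G with
    | nil => exact fun b E G2 _ => by simpa using .finish (by simp)
    | cons a G ih =>
      intro b E G2 hM
      simp only [List.flatMap_cons, List.length_append] at hM
      refine .step (m := ⟨⟨b || E.head?.elim false (fun c => !a.ok c Y), b₂, b₃,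
        false, false, false, none⟩, update (update (update s g (G.flatMap GenGate.encode)) g2
          (a.encode.reverse ++ G2)) e (E.tail.map .cell)⟩) (by simp [GenGate.encode]) ?_ ?_
      · refine Exec.of_eq (exec_checkGate b b₂ b₃ _ (G := a) (rest := G.flatMap GenGate.encode)
          (E := E) (Y := Y) (by simp) (by simp) (by simp [hy]) (by simp [hy2]) (by omega))
          (Store.congr ?_)
        funext k
        cases k <;> simp
      · have := ih (b || E.head?.elim false (fun c => !a.ok c Y)) E.tail (a.encode.reverse ++ G2)
          (by omega)
        rcases E with _ | ⟨d, E⟩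
        · simpa using this
        · simpa [Bool.or_assoc] using this
  have hlen : ∀ G : List GenGate, G.length ≤ (G.flatMap GenGate.encode).length := by
    intro G
    induction G with
    | nil => simp
    | cons a G ih => simp [GenGate.encode] at ih ⊢; omega
  have h0 : s = update (update (update s g (G.flatMap GenGate.encode)) g2 []) e (E.map .cell) := by
    funext k
    cases k <;> simp [hg, hg2, he]
  have h1 := key G b₁ E [] hG
  rw [← h0] at h1
  refine exec_seq ⟨_, (hlen G).trans hG, h1⟩ (Exec.of_eq (exec_move (by decide) _ _ (by simpa using hG))
    (Store.congr ?_))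
  funext k
  cases k <;> simp [hg, hg2]

end Red

end StackProg

/-! ### Expanding a block -/

namespace StackProg

open Function (update)

open Cmd

namespace Red

open RedStack

/-- Compare a word with the reference index, removing it. -/
def cmp : RCmd :=
  seq (drain j fun c => seq (push j2 fun _ => c) (popCase t1 id fun o => o.elim skip fun d =>
    seq (push t4 fun _ => d) (load fun f => { f with m := f.m && d.toBit == c.toBit }))) (move j2 j)

theorem exec_cmp {M : ℕ} (f : Flags) (s : RedStack → List Sym) {l J rest : List Bool}
    (h1 : s t1 = (l ++ rest).map .bit) (hj : s j = J.map .bit) (hl : l.length = J.length)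
    (hj2 : s j2 = []) (hM : J.length ≤ M) :
    cmp.Exec M ⟨f, s⟩ ⟨{ f with m := f.m && l == J },
      update (update s t1 (rest.map .bit)) t4 ((l.map .bit).reverse ++ s t4)⟩ := by
  have key : ∀ (J l : List Bool) (b : Bool) (J2 T4 : List Sym), l.length = J.length →
      Iter (fun s : Store (fun _ : RedStack => Sym) Flags => (s.stk j).head?.isSome = true)
        (Cmd.Exec M (popCase j id fun o => o.elim skip fun c => seq (push j2 fun _ => c)
          (popCase t1 id fun o => o.elim skip fun d => seq (push t4 fun _ => d)
            (load fun f => { f with m := f.m && d.toBit == c.toBit })))) J.length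
        ⟨{ f with m := b }, update (update (update (update s j (J.map .bit)) j2 J2) t1
          ((l ++ rest).map .bit)) t4 T4⟩
        ⟨{ f with m := b && l == J }, update (update (update (update s j []) j2
          ((J.map .bit).reverse ++ J2)) t1 (rest.map .bit)) t4 ((l.map .bit).reverse ++ T4)⟩ := by
    intro J
    induction J with
    | nil =>
      intro l b J2 T4 hl
      obtain rfl : l = [] := List.eq_nil_of_length_eq_zero hl
      simpa using .finish (by simp)
    | cons c J ih =>
      intro l b J2 T4 hl
      obtain ⟨d, l, rfl⟩ : ∃ d l', l = d :: l' := List.exists_cons_of_length_eq_add_one hl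
      refine .step (m := ⟨{ f with m := b && d == c }, update (update (update (update s j
        (J.map .bit)) j2 (.bit c :: J2)) t1 ((l ++ rest).map .bit)) t4 (.bit d :: T4)⟩)
        (by simp) ?_ ?_
      · simp only [Cmd.Exec, List.map_cons, ne_eq, reduceCtorEq, not_false_eq_true,
          Function.update_of_ne, Function.update_self, List.head?_cons, id, Option.elim,
          List.tail_cons]
        refine ⟨_, rfl, ?_⟩
        simp only [List.cons_append, List.map_cons, Cmd.Exec, ne_eq, reduceCtorEq,
          not_false_eq_true, Function.update_of_ne, Function.update_self, List.head?_cons, id,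
          Option.elim, List.tail_cons]
        refine ⟨_, rfl, ?_⟩
        simp only [Sym.toBit, Store.mk.injEq, true_and]
        funext k
        cases k <;> simp
      · simpa [Bool.and_assoc] using ih l (b && d == c) (.bit c :: J2) (.bit d :: T4)
          (by simpa using hl)
  have h0 : s = update (update (update (update s j (J.map .bit)) j2 []) t1
      ((l ++ rest).map .bit)) t4 (s t4) := by
    funext k
    cases k <;> simp [h1, hj, hj2]
  have h2 := key J l f.m [] (s t4) hl
  rw [← h0] at h2
  refine exec_seq ⟨_, by simpa [hj] using hM, h2⟩ (Exec.of_eq (exec_move (by decide) _ _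
    (by simpa using hM)) (Store.congr ?_))
  funext k
  cases k <;> simp [hj, hj2]

/-- Read the claims for a wire. -/
def readClaim : RCmd :=
  readBit t1 fun a => readBit t1 fun b => readBit t1 fun c => seq (load fun f => { f with m := true })
    (seq cmp (seq (clear t4) (seq (push y fun f => .cell (some (a, b, c, f.m)))
      (load fun f => { f with m := false }))))

theorem exec_readClaim {M : ℕ} (b₁ b₂ b₃ : Bool) (s : RedStack → List Sym) {r : Claim}
    {J rest : List Bool} (h1 : s t1 = (r.bits ++ rest).map .bit) (hj : s j = J.map .bit)
    (hl : r.wit.length = J.length) (hj2 : s j2 = []) (h4 : s t4 = []) (hM : J.length ≤ M) :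
    readClaim.Exec M ⟨{ bad := b₁, same := b₂, ne := b₃ }, s⟩
      ⟨{ bad := b₁, same := b₂, ne := b₃ },
        update (update s t1 (rest.map .bit)) y (.cell (r.cell J) :: s y)⟩ := by
  refine exec_readBit (b := r.y) (l := r.A :: r.α :: r.wit ++ rest) (by simp [h1, Claim.bits]) ?_
  refine exec_readBit (b := r.A) (l := r.α :: r.wit ++ rest) (by simp) ?_
  refine exec_readBit (b := r.α) (l := r.wit ++ rest) (by simp) ?_
  refine exec_seq rfl (exec_seq (exec_cmp _ _ (l := r.wit) (J := J) (rest := rest) (by simp)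
    (by simp [hj]) hl (by simp [hj2]) hM) (exec_seq (exec_clear _ _ (by simp [h4]; omega))
    (exec_seq rfl ?_)))
  simp only [Cmd.Exec, Store.mk.injEq, Bool.true_and, true_and]
  funext k
  cases k <;> simp [Claim.cell, h4]

/-- Double the length of the list of cells, the new cells coming first if `b`. -/
def placeBit (b : Bool) : RCmd :=
  seq (drain y fun c => seq (push t3 fun _ => c) (push t4 fun _ => .cell none))
    (cond b (seq (move t3 y) (move t4 y)) (seq (move t4 y) (move t3 y)))

theorem exec_placeBit {M : ℕ} (b : Bool) (f : Flags) (s : RedStack → List Sym) {Y : List Cell}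
    (hy : s y = Y.map .cell) (h3 : s t3 = []) (h4 : s t4 = []) (hM : Y.length ≤ M) :
    (placeBit b).Exec M ⟨f, s⟩ ⟨f, update s y ((cond b (List.replicate Y.length none ++ Y)
      (Y ++ List.replicate Y.length none)).map .cell)⟩ := by
  have h1 := exec_drain (M := M) (a := y)
    (g := fun c => seq (push (σ := Flags) t3 fun _ => c) (push t4 fun _ => .cell none))
    (l₀ := s y) (fun pre l => ⟨f, update (update (update s y l) t3 pre.reverse) t4
      (List.replicate pre.length (.cell none))⟩)
    (fun pre l _ => by simp) (fun pre c l _ => exec_seq rfl (by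
      simp only [Cmd.Exec, Store.mk.injEq, true_and]
      funext k
      cases k <;> simp [List.replicate_succ])) (by simpa [hy] using hM)
  have h0 : s = update (update (update s y (s y)) t3 ([] : List Sym).reverse) t4
      (List.replicate ([] : List Sym).length (.cell none)) := by
    funext k
    cases k <;> simp [h3, h4]
  rw [← h0] at h1
  refine exec_seq h1 ?_
  cases b
  · refine exec_seq (exec_move (by decide) _ _ (by simpa [hy] using hM)) (Exec.of_eq
      (exec_move (by decide) _ _ (by simpa [hy] using hM)) (Store.congr ?_))
    funext k
    cases k <;> simp [hy, h3, h4]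
  · refine exec_seq (exec_move (by decide) _ _ (by simpa [hy] using hM)) (Exec.of_eq
      (exec_move (by decide) _ _ (by simpa [hy] using hM)) (Store.congr ?_))
    funext k
    cases k <;> simp [hy, h3, h4]

theorem exec_times {M : ℕ} {a c t : RedStack} {p : RCmd} (hac : a ≠ c) (hat : a ≠ t) (hct : c ≠ t)
    {f : Flags} {s : RedStack → List Sym} {s' : Store (fun _ : RedStack => Sym) Flags}
    (ht : s t = []) (hM : (s a).length ≤ M)
    (h : (drain c fun _ => p).Exec M ⟨f, update s c (s a ++ s c)⟩ s') :
    (times a c t p).Exec M ⟨f, s⟩ s' :=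
  exec_seq (exec_copy hac hat hct f s ht hM) h

/-- Compute the cells of a block. -/
def expand : RCmd :=
  seq (load fun f => { f with m := true }) (seq cmp
    (seq (load fun f => { f with m := false, same := f.m })
    (seq (move t4 t2) (seq (times bB t6 t3 readClaim) (drain t2 fun c => placeBit c.toBit)))))

theorem length_place {α : Type*} (i : List Bool) (l : List (Option α)) :
    (place i l).length = 2 ^ i.length * l.length := by
  induction i generalizing l with
  | nil => simp [place]
  | cons b i ih =>
    rw [place, ih]
    cases b <;> simp [pow_succ] <;> ring

/-- The index bits are split off while they are compared with `J`. The claims become a list of `B`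
cells, and each index bit then doubles the length of that list, lowest bit first, as in `place`. -/
theorem exec_expand {M : ℕ} (b₁ b₂ b₃ : Bool) (s : RedStack → List Sym) {S B : ℕ} {b : Block}
    (hb : b.WF S B) {J : List Bool} (hJ : J.length = S) (h1 : s t1 = b.bits.map .bit)
    (hj : s j = J.map .bit) (hB : s bB = List.replicate B tt) (hj2 : s j2 = []) (h2 : s t2 = [])
    (h3 : s t3 = []) (h4 : s t4 = []) (h6 : s t6 = []) (hy : s y = []) (hS : S ≤ M)
    (hM : 2 ^ S * B ≤ M) :
    expand.Exec M ⟨{ bad := b₁, same := b₂, ne := b₃ }, s⟩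
      ⟨{ bad := b₁, same := b.idx == J, ne := b₃ },
        update (update s t1 []) y ((b.cells J).map .cell)⟩ := by
  have hBM : B ≤ M := (Nat.le_mul_of_pos_left B (by positivity)).trans hM
  have hlen := hb.claims
  set s1 := update (update (update (update s t1 ((b.claims.flatMap Claim.bits).map .bit)) t2
    (b.idx.map .bit)) t4 []) t6 (List.replicate B tt) with hs1
  have e1 := exec_drain_replicate (M := M) (a := t6) (g := fun _ : Sym => readClaim)
    (n := B) (c := tt) (fun i => ⟨{ bad := b₁, same := b.idx == J, ne := b₃ },
      update (update (update s1 t1 (((b.claims.drop i).flatMap Claim.bits).map .bit)) t6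
      (List.replicate (B - i) tt)) y (((b.claims.take i).map (Claim.cell J)).reverse.map .cell)⟩)
    (fun i _ => by simp) (fun i hi => by
      have hd : b.claims.drop i = b.claims[i] :: b.claims.drop (i + 1) :=
        List.drop_eq_getElem_cons (by omega)
      have ht : b.claims.take (i + 1) = b.claims.take i ++ [b.claims[i]] :=
        List.take_succ_eq_append_getElem (by omega)
      refine Exec.of_eq (exec_readClaim _ _ _ _ (r := b.claims[i]) (J := J)
        (rest := (b.claims.drop (i + 1)).flatMap Claim.bits) (by simp [hd, -List.getElem_cons_drop]) (by simp [hs1, hj])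
        (by rw [hb.wit _ (List.getElem_mem _), hJ]) (by simp [hs1, hj2]) (by simp [hs1])
        (by omega)) (Store.congr ?_)
      rw [ht]
      funext k
      cases k <;> simp [-List.map_take, -List.take_append_getElem]) hBM
  set Y := (b.claims.map (Claim.cell J)).reverse with hY
  -- The product of `2 ^ i.length` and the length of the list is invariant, so all intermediate
  -- lists stay below the final length.
  have e2 : ∀ (i : List Bool) (Y : List Cell), 2 ^ i.length * Y.length ≤ M → i.length ≤ M →
      (drain t2 fun c => placeBit c.toBit).Exec M
        ⟨{ bad := b₁, same := b.idx == J, ne := b₃ }, update (update (update s t1 []) t2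
          (i.map .bit)) y (Y.map .cell)⟩
        ⟨{ bad := b₁, same := b.idx == J, ne := b₃ },
          update (update s t1 []) y ((place i Y).map .cell)⟩ := by
    intro i Y h hi
    refine ⟨i.length, hi, ?_⟩
    clear hi
    induction i generalizing Y with
    | nil =>
      have : update (update (update s t1 []) t2 (List.map Sym.bit [])) y (Y.map .cell) =
          update (update s t1 []) y ((place [] Y).map .cell) := by
        funext k
        cases k <;> simp [h2, place]
      rw [this]
      exact .finish (by simp [h2])
    | cons c i ih =>
      have hc : (cond c (List.replicate Y.length none ++ Y)
          (Y ++ List.replicate Y.length none)).length = 2 * Y.length := by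
        cases c <;> simp <;> omega
      simp only [List.length_cons, pow_succ] at h
      refine .step (m := ⟨{ bad := b₁, same := b.idx == J, ne := b₃ }, update (update (update s t1
        []) t2 (i.map .bit)) y ((cond c (List.replicate Y.length none ++ Y)
          (Y ++ List.replicate Y.length none)).map .cell)⟩) (by simp) ?_ ?_
      · have hY : Y.length ≤ M := le_trans (by
          have : 0 < 2 ^ i.length := by positivity
          nlinarith) h
        have := exec_placeBit (M := M) c { bad := b₁, same := b.idx == J, ne := b₃ }
          (update (update (update s t1 []) t2 (i.map .bit)) y (Y.map .cell)) (Y := Y) (by simp)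
          (by simp [h3]) (by simp [h4]) hY
        have h5 : update (update (update s t1 []) t2 (i.map .bit)) y (Y.map .cell) =
            update (update (update (update s t1 []) t2 ((c :: i).map .bit)) y (Y.map .cell)) t2
              (i.map .bit) := by
          funext k
          cases k <;> simp
        rw [Function.update_idem, h5] at this
        simpa [Cmd.Exec, Sym.toBit] using this
      · exact ih _ (by rw [hc]; linarith)
  refine exec_seq rfl (exec_seq (exec_cmp _ _ (l := b.idx) (J := J)
    (rest := b.claims.flatMap Claim.bits) (by simp [h1, Block.bits]) (by simp [hj])
    (by rw [hb.idx, hJ]) (by simp [hj2]) (by omega)) (exec_seq rfl (exec_seq (exec_move (by decide)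
    _ _ (by simp [h4, hb.idx, hS])) (exec_seq (t := ⟨⟨b₁, b.idx == J, b₃, false, false,
      false, none⟩, update (update (update s t1 []) t2 (b.idx.map .bit)) y (Y.map .cell)⟩)
      (exec_times (by decide) (by decide) (by decide) (by simp [h3]) (by simp [hB, hBM]) ?_)
    (e2 _ _ (by simp [hY, hb.idx, hlen, hM]) (by rw [hb.idx]; exact hS))))))
  convert e1 using 2
  · simp
  · funext k
    cases k <;> simp [hs1, h4, h2, hB, h6, hy]
  · funext k
    cases k <;> simp [hs1, h4, h2, hB, h6, ← hlen, hY]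

/-- Compare the claims of the block `a` with those of the block `b`. -/
def check (a b : RedStack) : RCmd :=
  seq (copy b t1 t2) (seq (times sS t6 t2 (shift t1 t3)) (seq (clear t1) (seq (move t3 j)
  (seq (copy b t1 t2) (seq expand (seq (move y t5) (seq (copy a t1 t2) (seq expand
  (seq (move y y2) (seq (move y2 e) (seq (move t5 y)
  (seq checkAll (seq (clear e) (seq (clear y) (clear j)))))))))))))))

theorem length_cells {S B : ℕ} {b : Block} (hb : b.WF S B) (J : List Bool) :
    (b.cells J).length = 2 ^ S * B := by
  simp [Block.cells, length_place, hb.idx, hb.claims]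

theorem length_bits {S B : ℕ} {b : Block} (hb : b.WF S B) :
    b.bits.length = S + B * (S + 3) := by
  have : ∀ c : List Claim, (∀ r ∈ c, r.wit.length = S) →
      (c.flatMap Claim.bits).length = c.length * (S + 3) := by
    intro c hc
    induction c with
    | nil => simp
    | cons r c ih =>
      simp [Claim.bits, hc r (by simp)] at ih ⊢
      rw [ih fun r hr => hc r (by simp [hr])]
      ring
  simp [Block.bits, hb.idx, this _ hb.wit, hb.claims]

/-- The cells of both blocks are taken relative to the index `J` of `b`. The expansion of `a` comes
last, so `same` ends as the comparison of `wa.idx` with `J`, while `bad` accumulates over several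
calls. -/
theorem exec_check {M : ℕ} {a b : RedStack} (ha : a = u ∨ a = v) (hb : b = u ∨ b = v)
    (b₁ b₂ b₃ : Bool) (s : RedStack → List Sym) {S B : ℕ} {wa wb : Block} {G : List GenGate}
    (hwa : wa.WF S B) (hwb : wb.WF S B) (hsa : s a = wa.bits.map .bit)
    (hsb : s b = wb.bits.map .bit) (hS : s sS = List.replicate S tt)
    (hB : s bB = List.replicate B tt) (hg : s g = G.flatMap GenGate.encode) (hg2 : s g2 = [])
    (he : s e = []) (hy : s y = []) (hy2 : s y2 = []) (hj : s j = []) (hj2 : s j2 = [])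
    (h1 : s t1 = []) (h2 : s t2 = []) (h3 : s t3 = []) (h4 : s t4 = []) (h5 : s t5 = [])
    (h6 : s t6 = []) (hM : S + B * (S + 3) ≤ M) (hM' : 2 ^ S * B ≤ M)
    (hG : (G.flatMap GenGate.encode).length ≤ M) :
    (check a b).Exec M ⟨{ bad := b₁, same := b₂, ne := b₃ }, s⟩
      ⟨{ bad := b₁ || refutes G wa wb, same := wa.idx == wb.idx, ne := b₃ }, s⟩ := by
  have hl := length_bits hwb
  have hla := length_bits hwa
  have hlc := length_cells hwb wb.idx
  have hlca := length_cells hwa wb.idx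
  set J := wb.idx with hJ
  have hJl : J.length = S := hwb.idx
  have hbits : wb.bits = J ++ wb.claims.flatMap Claim.bits := rfl
  have e1 := exec_drain_replicate (M := M) (a := t6) (g := fun _ : Sym => shift t1 t3)
    (n := S) (c := tt) (fun i => ⟨{ bad := b₁, same := b₂, ne := b₃ },
      update (update (update s t1 ((wb.bits.drop i).map .bit)) t6
      (List.replicate (S - i) tt)) t3 ((J.take i).map .bit).reverse⟩)
    (fun i _ => by simp) (fun i hi => by
      have hd : wb.bits.drop i = J[i] :: wb.bits.drop (i + 1) := by
        rw [List.drop_eq_getElem_cons (by omega)]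
        congr 1
        simp [hbits, List.getElem_append_left, hJl, hi]
      have ht : J.take (i + 1) = J.take i ++ [J[i]] := List.take_succ_eq_append_getElem (by omega)
      refine Exec.of_eq (exec_shift (c := .bit J[i]) (l := (wb.bits.drop (i + 1)).map .bit)
        (by rw [hd]; simp) (by decide)) (Store.congr ?_)
      rw [ht]
      funext k
      cases k <;> simp [-List.map_take, -List.take_append_getElem]) (by omega)
  have hM0 : S ≤ M := by omega
  have hcl : (J ++ []).length ≤ M := by simp [hJl, hM0]
  refine exec_seq (t := ⟨{ bad := b₁, same := b₂, ne := b₃ }, update s t1 (wb.bits.map .bit)⟩) ?_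
    (exec_seq (t := ⟨{ bad := b₁, same := b₂, ne := b₃ }, update (update s t1
      ((wb.bits.drop S).map .bit)) t3 (J.map .bit).reverse⟩) ?_
    (exec_seq (exec_clear _ _ (by simp; omega)) (exec_seq (t := ⟨⟨b₁, b₂, b₃, false,
      false, false, none⟩, update s j (J.map .bit)⟩) ?_
    (exec_seq (t := ⟨{ bad := b₁, same := b₂, ne := b₃ }, update (update s j (J.map .bit)) t1
      (wb.bits.map .bit)⟩) ?_ (exec_seq (exec_expand _ _ _ _ hwb hJl (by simp) (by simp)
      (by simp [hB]) (by simp [hj2]) (by simp [h2]) (by simp [h3]) (by simp [h4]) (by simp [h6])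
      (by simp [hy]) hM0 hM') (exec_seq (exec_move (by decide) _ _ (by simp [hlc, hM']))
    (exec_seq (t := ⟨⟨b₁, wb.idx == J, b₃, false, false, false, none⟩, update (update (update s j
      (J.map .bit)) t1 (wa.bits.map .bit)) t5 ((wb.cells J).map .cell).reverse⟩) ?_
    (exec_seq (exec_expand _ _ _ _ hwa hJl (by simp) (by simp)
      (by simp [hB]) (by simp [hj2]) (by simp [h2]) (by simp [h3]) (by simp [h4]) (by simp [h6])
      (by simp [hy]) hM0 hM') (exec_seq (exec_move (by decide) _ _ (by simp [hlca, hM']))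
    (exec_seq (exec_move (by decide) _ _ (by simp [hlca, hM', hy2]))
    (exec_seq (exec_move (by decide) _ _ (by simp [hlc, hM']))
    (exec_seq (exec_checkAll _ _ _ _ (G := G) (E := wa.cells J) (Y := wb.cells J) (by simp [hg])
      (by simp [hy2, he]) (by simp) (by simp) (by simp [hg2]) hG)
    (exec_seq (exec_clear _ _ (by simp [hlca]; omega)) (exec_seq (exec_clear _ _ (by simp [hlc, hM']))
    (Exec.of_eq (exec_clear _ _ (by simp; omega)) ?_)))))))))))))))
  · refine Exec.of_eq (exec_copy ?_ ?_ (by decide) _ _ h2 (by simp [hsb]; omega))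
      (Store.congr (by simp [hsb, h1]))
    all_goals rcases hb with rfl | rfl <;> decide
  · refine exec_times (by decide) (by decide) (by decide) (by simp [h2]) (by simp [hS]; omega) ?_
    convert e1 using 2
    · funext k
      cases k <;> simp [hS, h6, h3]
    · funext k
      cases k <;> simp [h6, ← hJl]
  · refine Exec.of_eq (exec_move (by decide) _ _ (by simp; omega)) (Store.congr ?_)
    funext k
    cases k <;> simp [h1, h3, hj]
  · refine Exec.of_eq (exec_copy ?_ ?_ (by decide) _ _ (by simp [h2]) ?_) (Store.congr ?_)
    iterate 2 rcases hb with rfl | rfl <;> decide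
    · rcases hb with rfl | rfl <;> simp [hsb] <;> omega
    · rcases hb with rfl | rfl <;> simp [hsb, h1]
  · refine Exec.of_eq (exec_copy ?_ ?_ (by decide) _ _ (by simp [h2]) ?_) (Store.congr ?_)
    iterate 2 rcases ha with rfl | rfl <;> decide
    · rcases ha with rfl | rfl <;> simp [hsa] <;> omega
    · funext k
      rcases ha with rfl | rfl <;> cases k <;> simp [hsa, h1, h5, hy]
  · simp only [Store.mk.injEq]
    refine ⟨rfl, ?_⟩
    funext k
    cases k <;> simp [h1, h5, hy, hy2, he, hj]

end Red

end StackProg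

/-! ### Writing the Hamiltonian -/

namespace StackProg

open Function (update)

open Cmd

/-- The partial assignment numbered `i`. -/
def vertex (S B i : ℕ) : Block := Block.ofBits S B (natBits (S + B * (S + 3)) i)

/-- The partial assignments numbered `i` and `j` are different and incompatible. -/
def clash (G : List GenGate) (S B i j : ℕ) : Bool :=
  natBits (S + B * (S + 3)) i != natBits (S + B * (S + 3)) j &&
    conflict G (vertex S B i) (vertex S B j)

/-- Code of a term on two qubits, whose matrix has the code `c`. -/
def pairCode (c : List Bool) (i j : ℕ) : List Bool :=
  encUnary 2 ++ (encUnary i ++ (encUnary j ++ c))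

/-- Codes of the terms for the conflicts between `i` and the numbers below `m`. -/
def rowCodes (c : List Bool) (N : ℕ) (r : ℕ → ℕ → Bool) (i m : ℕ) : List (List Bool) :=
  -- The order is decreasing because the output stack is filled from the end of the word.
  (List.range m).reverse.flatMap fun j => cond (r i j) (List.replicate N (pairCode c i j)) []

/-- Codes of the terms for the conflicts in the first `m` rows. -/
def allCodes (c : List Bool) (N : ℕ) (r : ℕ → ℕ → Bool) (n m : ℕ) : List (List Bool) :=
  (List.range m).reverse.flatMap fun i => rowCodes c N r i n

theorem rowCodes_succ (c : List Bool) (N : ℕ) (r : ℕ → ℕ → Bool) (i m : ℕ) :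
    rowCodes c N r i (m + 1) =
      cond (r i m) (List.replicate N (pairCode c i m)) [] ++ rowCodes c N r i m := by
  simp [rowCodes, List.range_succ]

theorem allCodes_succ (c : List Bool) (N : ℕ) (r : ℕ → ℕ → Bool) (n m : ℕ) :
    allCodes c N r n (m + 1) = rowCodes c N r m n ++ allCodes c N r n m := by
  simp [allCodes, List.range_succ]

theorem length_rowCodes_le (c : List Bool) (N : ℕ) (r : ℕ → ℕ → Bool) (i m : ℕ) :
    (rowCodes c N r i m).length ≤ m * N := by
  induction m with
  | zero => simp [rowCodes]
  | succ m ih =>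
    rw [rowCodes_succ, List.length_append, Nat.succ_mul]
    cases r i m <;> simp <;> omega

theorem length_allCodes_le (c : List Bool) (N : ℕ) (r : ℕ → ℕ → Bool) (n m : ℕ) :
    (allCodes c N r n m).length ≤ m * (n * N) := by
  induction m with
  | zero => simp [allCodes]
  | succ m ih =>
    rw [allCodes_succ, List.length_append, Nat.succ_mul]
    have := length_rowCodes_le c N r m n
    omega

/-- After `2 ^ L` increments a counter is back at its start, so the loops over all vertices leave it
at zero without a reset. -/
theorem natBits_mod (L n : ℕ) : natBits L (2 ^ L + n) = natBits L n := by
  induction L generalizing n with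
  | zero => rfl
  | succ L ih =>
    have h1 : (2 ^ (L + 1) + n) % 2 = n % 2 := by omega
    have h2 : (2 ^ (L + 1) + n) / 2 = 2 ^ L + n / 2 := by omega
    rw [natBits, natBits, h1, h2, ih]

namespace Red

open RedStack

/-- Loop rule in which `F i` describes the store after `i` rounds apart from the loop counter `c`;
the body has to work whatever `c` contains. -/
theorem exec_times_family {M : ℕ} {a c t : RedStack} {p : RCmd} (hac : a ≠ c) (hat : a ≠ t)
    (hct : c ≠ t) {f : Flags} {n : ℕ} (F : ℕ → RedStack → List Sym)
    (ha : F 0 a = List.replicate n tt) (hc : ∀ i, F i c = []) (ht : F 0 t = []) (hM : n ≤ M)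
    (h : ∀ i < n, ∀ l, p.Exec M ⟨f, update (F i) c l⟩ ⟨f, update (F (i + 1)) c l⟩) :
    (times a c t p).Exec M ⟨f, F 0⟩ ⟨f, F n⟩ := by
  refine exec_times hac hat hct ht (by simpa [ha] using hM) ?_
  have := exec_drain_replicate (M := M) (a := c) (g := fun _ : Sym => p) (n := n) (c := tt)
    (fun i => ⟨f, update (F i) c (List.replicate (n - i) tt)⟩) (fun i _ => by simp)
    (fun i hi => by simpa using h i hi _) hM
  convert this using 2
  · simp [ha, hc]
  · have := hc n
    simp [← this]

/-- The store after writing the given codes. -/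
def written (l : List (List Bool)) (s : RedStack → List Sym) : RedStack → List Sym :=
  update (update s out (l.flatten.map .bit ++ s out)) cnt (List.replicate l.length tt ++ s cnt)

theorem written_written (l l' : List (List Bool)) (s : RedStack → List Sym) :
    written l (written l' s) = written (l ++ l') s := by
  funext k
  cases k <;> simp [written, ← List.append_assoc]

@[simp] theorem written_nil (s : RedStack → List Sym) : written [] s = s := by
  funext k
  cases k <;> simp [written]

@[simp] theorem written_apply (l : List (List Bool)) (s : RedStack → List Sym) {k : RedStack}
    (h : k ≠ out) (h' : k ≠ cnt) : written l s k = s k := by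
  simp [written, h, h']

/-- The conditions on the store during the loops over all pairs of partial assignments. -/
structure Ready (S B N : ℕ) (G : List GenGate) (s : RedStack → List Sym) : Prop where
  sS : s sS = List.replicate S tt
  bB : s bB = List.replicate B tt
  rc : s rc = List.replicate N tt
  g : s g = G.flatMap GenGate.encode
  g2 : s g2 = []
  e : s e = []
  y : s y = []
  y2 : s y2 = []
  j : s j = []
  j2 : s j2 = []
  t1 : s t1 = []
  t2 : s t2 = []
  t3 : s t3 = []
  t4 : s t4 = []
  t5 : s t5 = []
  t6 : s t6 = []

/-- Write a word on two qubits as often as there are symbols on the stack `rc`. -/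
def emitPair (c : List Bool) : RCmd :=
  times rc t6 t5 (seq (pushList out (c.map .bit)) (seq (push out fun _ => ff)
    (seq (times nv t1 t2 (push out fun _ => tt)) (seq (push out fun _ => ff)
    (seq (times nu t1 t2 (push out fun _ => tt)) (seq (pushList out [tt, tt, ff])
    (push cnt fun _ => tt)))))))

theorem exec_pushTimes {M : ℕ} {a : RedStack} (ha : a = nu ∨ a = nv) (f : Flags)
    (s : RedStack → List Sym) {n : ℕ} (hs : s a = List.replicate n tt) (h1 : s t1 = [])
    (h2 : s t2 = []) (hM : n ≤ M) :
    (times a t1 t2 (push out fun _ => tt)).Exec M ⟨f, s⟩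
      ⟨f, update s out (List.replicate n tt ++ s out)⟩ := by
  have := exec_times_family (M := M) (a := a) (c := t1) (t := t2) (p := push out fun _ => tt)
    (by rcases ha with rfl | rfl <;> decide) (by rcases ha with rfl | rfl <;> decide) (by decide)
    (f := f) (n := n) (fun i => update s out (List.replicate i tt ++ s out))
    (by rcases ha with rfl | rfl <;> simp [hs]) (by simp [h1]) (by simp [h2]) hM
    (fun i _ l => Exec.of_eq (exec_push _ _ _ _) (Store.congr (by
      funext k
      cases k <;> simp [List.replicate_succ])))
  simpa using this

theorem exec_emitPair {M : ℕ} (c : List Bool) (f : Flags) (s : RedStack → List Sym)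
    {S B N i k : ℕ} {G : List GenGate} (h : Ready S B N G s) (hu : s nu = List.replicate i tt)
    (hv : s nv = List.replicate k tt) (hN : N ≤ M) (hi : i ≤ M) (hk : k ≤ M) :
    (emitPair c).Exec M ⟨f, s⟩ ⟨f, written (List.replicate N (pairCode c i k)) s⟩ := by
  have := exec_times_family (M := M) (a := rc) (c := t6) (t := t5)
    (p := (seq (pushList out (c.map .bit)) (seq (push out fun _ => ff)
    (seq (times nv t1 t2 (push out fun _ => tt)) (seq (push out fun _ => ff)
    (seq (times nu t1 t2 (push out fun _ => tt)) (seq (pushList out [tt, tt, ff])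
    (push cnt fun _ => tt)))))))) (by decide) (by decide) (by decide) (f := f) (n := N)
    (fun m => written (List.replicate m (pairCode c i k)) s) (by simp [h.rc]) (by simp [h.t6])
    (by simp [h.t5]) hN (fun m _ l => by
      refine exec_seq (exec_pushList _ _ _) (exec_seq (exec_push _ _ _ _)
        (exec_seq (exec_pushTimes (.inr rfl) _ _ (n := k) (by simp [hv]) (by simp [h.t1])
        (by simp [h.t2]) hk) (exec_seq (exec_push _ _ _ _) (exec_seq (exec_pushTimes (.inl rfl) _ _
        (n := i) (by simp [hu]) (by simp [h.t1]) (by simp [h.t2]) hi)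
        (exec_seq (exec_pushList _ _ _) (Exec.of_eq (exec_push _ _ _ _) (Store.congr ?_)))))))
      funext k
      cases k <;> simp [written, pairCode, encUnary, List.replicate_succ])
  simp only [List.replicate_zero, written_nil] at this
  exact this

/-- Find out whether the two current partial assignments are different. -/
def testNe : RCmd :=
  seq (copy v j t2) (seq (copy u t1 t2) (seq (load fun f => { f with m := true }) (seq cmp
    (seq (load fun f => { f with ne := !f.m, m := false }) (seq (clear t4) (clear j))))))

theorem exec_testNe {M : ℕ} (s : RedStack → List Sym) {S B N : ℕ} {G : List GenGate}
    (h : Ready S B N G s) {l l' : List Bool} (hu : s u = l.map .bit) (hv : s v = l'.map .bit)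
    (hl : l.length = l'.length) (hM : l.length ≤ M) :
    testNe.Exec M ⟨{}, s⟩ ⟨{ ne := l != l' }, s⟩ := by
  refine exec_seq (exec_copy (by decide) (by decide) (by decide) _ _ h.t2 (by simp [hv]; omega))
    (exec_seq (exec_copy (by decide) (by decide) (by decide) _ _ (by simp [h.t2])
      (by simp [hu]; omega)) (exec_seq rfl (exec_seq (exec_cmp _ _ (l := l) (J := l') (rest := [])
      (by simp [h.t1, hu]) (by simp [h.j, hv]) hl (by simp [h.j2]) (by omega)) (exec_seq rfl
      (exec_seq (exec_clear _ _ (by simp [h.t4, hM])) (Exec.of_eq (exec_clear _ _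
        (by simp [h.j, hv]; omega)) ?_))))))
  simp only [Store.mk.injEq]
  refine ⟨by simp [bne], ?_⟩
  funext k
  cases k <;> simp [h.t1, h.t4, h.j]

/-- Write the terms for the two current partial assignments. -/
def pairBody (c : List Bool) : RCmd :=
  seq testNe (seq (check u u) (seq (check u v)
    (seq (choose fun f => cond (f.ne && (f.same || f.bad)) (emitPair c) skip)
      (load fun _ => {}))))

/-- The bound on the number of iterations of all loops is large enough. -/
structure Enough (S B N n M : ℕ) (G : List GenGate) : Prop where
  bits : S + B * (S + 3) ≤ M
  cells : 2 ^ S * B ≤ M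
  gates : (G.flatMap GenGate.encode).length ≤ M
  copies : N ≤ M
  nodes : n ≤ M

theorem exec_pairBody {M : ℕ} (c : List Bool) (s : RedStack → List Sym) {S B N n i k : ℕ}
    {G : List GenGate} (h : Ready S B N G s) (hM : Enough S B N n M G)
    (hu : s u = (natBits (S + B * (S + 3)) i).map .bit)
    (hv : s v = (natBits (S + B * (S + 3)) k).map .bit)
    (hnu : s nu = List.replicate i tt) (hnv : s nv = List.replicate k tt) (hi : i ≤ n)
    (hk : k ≤ n) :
    (pairBody c).Exec M ⟨{}, s⟩ ⟨{}, written
      (cond (clash G S B i k) (List.replicate N (pairCode c i k)) []) s⟩ := by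
  obtain ⟨h1, h2⟩ := Block.ofBits_spec (s := S) (B := B) (length_natBits _ i)
  obtain ⟨h3, h4⟩ := Block.ofBits_spec (s := S) (B := B) (length_natBits _ k)
  refine exec_seq (exec_testNe s h hu hv (by simp) (by simpa using hM.bits))
    (exec_seq (exec_check (.inl rfl) (.inl rfl) _ _ _ _ h1 h1 (hu.trans (by rw [h2]))
      (hu.trans (by rw [h2])) h.sS h.bB h.g h.g2 h.e h.y h.y2 h.j h.j2 h.t1 h.t2 h.t3 h.t4 h.t5
      h.t6 hM.bits hM.cells hM.gates) (exec_seq (exec_check (.inl rfl) (.inr rfl) _ _ _ _ h1 h3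
      (hu.trans (by rw [h2])) (hv.trans (by rw [h4])) h.sS h.bB h.g h.g2 h.e h.y h.y2 h.j h.j2
      h.t1 h.t2 h.t3 h.t4 h.t5 h.t6 hM.bits hM.cells hM.gates) ?_))
  -- The condition on the flags unfolds to `clash`: the second check has overwritten `same` by the
  -- comparison of the two indices, and `bad` is the disjunction of both refutations.
  change ∃ m, Cmd.Exec M (cond (clash G S B i k) (emitPair c) skip) _ m ∧ _
  cases clash G S B i k
  · exact ⟨_, rfl, by simp [Cmd.Exec]⟩
  · exact ⟨_, exec_emitPair c _ _ h hnu hnv hM.copies (hi.trans hM.nodes) (hk.trans hM.nodes), rfl⟩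

/-- Write the terms for a row of pairs. -/
def row (c : List Bool) : RCmd :=
  seq (drain nvr fun _ => seq (pairBody c) (seq (incr v) (push nv fun _ => tt))) (move nv nvr)

theorem exec_row {M : ℕ} (c : List Bool) (s : RedStack → List Sym) {S B N i : ℕ}
    {G : List GenGate} (h : Ready S B N G s) (hM : Enough S B N (2 ^ (S + B * (S + 3))) M G)
    (hu : s u = (natBits (S + B * (S + 3)) i).map .bit)
    (hv : s v = (natBits (S + B * (S + 3)) 0).map .bit)
    (hnu : s nu = List.replicate i tt) (hnv : s nv = [])
    (hnvr : s nvr = List.replicate (2 ^ (S + B * (S + 3))) tt) (hi : i ≤ 2 ^ (S + B * (S + 3))) :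
    (row c).Exec M ⟨{}, s⟩
      ⟨{}, written (rowCodes c N (clash G S B) i (2 ^ (S + B * (S + 3)))) s⟩ := by
  have e1 := exec_drain_replicate (M := M) (a := nvr)
    (g := fun _ : Sym => seq (pairBody c) (seq (incr v) (push nv fun _ => tt)))
    (n := 2 ^ (S + B * (S + 3))) (c := tt) (fun m => ⟨{}, update (update (update (written
      (rowCodes c N (clash G S B) i m) s) nvr (List.replicate (2 ^ (S + B * (S + 3)) - m) tt))
      v ((natBits (S + B * (S + 3)) m).map .bit)) nv (List.replicate m tt)⟩)
    (fun i _ => by simp) (fun m hm => by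
      refine exec_seq (exec_pairBody c _ (S := S) (B := B) (N := N) (i := i) (k := m) (G := G) ?_ hM
        (by simp [hu]) (by simp) (by simp [hnu]) (by simp) hi hm.le) (exec_seq (exec_incr
        (by decide) _ _ (L := S + B * (S + 3)) (n := m) (by simp) (by simp [h.t1]) hM.bits)
        (Exec.of_eq (exec_push _ _ _ _) (Store.congr ?_)))
      · constructor <;> simp [h.sS, h.bB, h.rc, h.g, h.g2, h.e, h.y, h.y2, h.j, h.j2, h.t1, h.t2,
          h.t3, h.t4, h.t5, h.t6]
      · rw [rowCodes_succ, ← written_written]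
        funext k
        cases k <;> simp [written, List.replicate_succ]) hM.nodes
  have h0 : update (update (update (written (rowCodes c N (clash G S B) i 0) s) nvr
      (List.replicate (2 ^ (S + B * (S + 3)) - 0) tt)) v ((natBits (S + B * (S + 3)) 0).map .bit))
      nv (List.replicate 0 tt) = s := by
    funext k
    cases k <;> simp [rowCodes, hv, hnv, hnvr]
  rw [h0] at e1
  refine exec_seq e1 (Exec.of_eq (exec_move (by decide) _ _ (by simpa using hM.nodes))
    (Store.congr ?_))
  have : natBits (S + B * (S + 3)) (2 ^ (S + B * (S + 3))) = natBits (S + B * (S + 3)) 0 :=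
    natBits_mod _ 0
  rw [this]
  funext k
  cases k <;> simp [hv, hnv, hnvr]

/-- Write the terms for all pairs. -/
def rows (c : List Bool) : RCmd :=
  drain nur fun _ => seq (row c) (seq (incr u) (push nu fun _ => tt))

theorem exec_rows {M : ℕ} (c : List Bool) (s : RedStack → List Sym) {S B N : ℕ}
    {G : List GenGate} (h : Ready S B N G s) (hM : Enough S B N (2 ^ (S + B * (S + 3))) M G)
    (hu : s u = (natBits (S + B * (S + 3)) 0).map .bit)
    (hv : s v = (natBits (S + B * (S + 3)) 0).map .bit)
    (hnu : s nu = []) (hnv : s nv = [])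
    (hnvr : s nvr = List.replicate (2 ^ (S + B * (S + 3))) tt)
    (hnur : s nur = List.replicate (2 ^ (S + B * (S + 3))) tt) :
    (rows c).Exec M ⟨{}, s⟩ ⟨{}, update (update (written (allCodes c N (clash G S B)
      (2 ^ (S + B * (S + 3))) (2 ^ (S + B * (S + 3)))) s) nur [])
      nu (List.replicate (2 ^ (S + B * (S + 3))) tt)⟩ := by
  have e1 := exec_drain_replicate (M := M) (a := nur)
    (g := fun _ : Sym => seq (row c) (seq (incr u) (push nu fun _ => tt)))
    (n := 2 ^ (S + B * (S + 3))) (c := tt) (fun m => ⟨{}, update (update (update (written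
      (allCodes c N (clash G S B) (2 ^ (S + B * (S + 3))) m) s) nur
      (List.replicate (2 ^ (S + B * (S + 3)) - m) tt))
      u ((natBits (S + B * (S + 3)) m).map .bit)) nu (List.replicate m tt)⟩)
    (fun i _ => by simp) (fun m hm => by
      refine exec_seq (exec_row c _ (S := S) (B := B) (N := N) (i := m) (G := G) ?_ hM
        (by simp) (by simp [hv]) (by simp) (by simp [hnv]) (by simp [hnvr]) hm.le)
        (exec_seq (exec_incr
        (by decide) _ _ (L := S + B * (S + 3)) (n := m) (by simp) (by simp [h.t1]) hM.bits)
        (Exec.of_eq (exec_push _ _ _ _) (Store.congr ?_)))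
      · constructor <;> simp [h.sS, h.bB, h.rc, h.g, h.g2, h.e, h.y, h.y2, h.j, h.j2, h.t1, h.t2,
          h.t3, h.t4, h.t5, h.t6]
      · rw [allCodes_succ, ← written_written]
        funext k
        cases k <;> simp [written, List.replicate_succ]) hM.nodes
  have h0 : update (update (update (written (allCodes c N (clash G S B) (2 ^ (S + B * (S + 3))) 0)
      s) nur (List.replicate (2 ^ (S + B * (S + 3)) - 0) tt)) u
      ((natBits (S + B * (S + 3)) 0).map .bit)) nu (List.replicate 0 tt) = s := by
    funext k
    cases k <;> simp [allCodes, hu, hnu, hnur]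
  rw [h0] at e1
  refine Exec.of_eq e1 (Store.congr ?_)
  have : natBits (S + B * (S + 3)) (2 ^ (S + B * (S + 3))) = natBits (S + B * (S + 3)) 0 :=
    natBits_mod _ 0
  rw [this]
  funext k
  cases k <;> simp [hu]

end Red

end StackProg

/-! ### The reduction as a program -/

namespace StackProg

open Function (update)

open Cmd

/-- The size of the blocks when `W` wires are distributed among `2 ^ S` blocks. -/
def blockSize (S W : ℕ) : ℕ := (fun n => (n + 1) / 2)^[S] W

/-- Rounding up at every halving ensures that the blocks cover all wires. Surplus positions carry
claims which `refutes` never looks at. -/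
theorem le_blockSize (S W : ℕ) : W ≤ 2 ^ S * blockSize S W := by
  induction S with
  | zero => simp [blockSize]
  | succ S ih =>
    rw [blockSize, Function.iterate_succ_apply', ← blockSize, pow_succ, mul_assoc]
    exact ih.trans (Nat.mul_le_mul_left _ (by omega))

/-- Repeated rounding costs at most one wire per block in total; this controls the exponent of the
number of vertices. -/
theorem blockSize_le (S W : ℕ) : blockSize S W ≤ W / 2 ^ S + 1 := by
  induction S with
  | zero => simp [blockSize]
  | succ S ih =>
    rw [blockSize, Function.iterate_succ_apply', ← blockSize, pow_succ, ← Nat.div_div_eq_div_mul]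
    omega

theorem blockSize_le_self (S : ℕ) {W : ℕ} (hW : 1 ≤ W) : blockSize S W ≤ W := by
  induction S with
  | zero => simp [blockSize]
  | succ S ih =>
    rw [blockSize, Function.iterate_succ_apply', ← blockSize]
    omega

namespace Red

open RedStack

/-- Repeat a program. -/
def rep : ℕ → RCmd → RCmd
  | 0, _ => skip
  | d + 1, p => seq p (rep d p)

theorem exec_rep_double {M : ℕ} {a : RedStack} (ha : a ≠ t1) (f : Flags) (s : RedStack → List Sym)
    (d : ℕ) {n : ℕ} (hs : s a = List.replicate n tt) (ht : s t1 = []) (hn : 2 ^ d * n ≤ M) :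
    (rep d (double a)).Exec M ⟨f, s⟩ ⟨f, update s a (List.replicate (2 ^ d * n) tt)⟩ := by
  induction d generalizing s n with
  | zero => simp [rep, skip, Cmd.Exec, ← hs]
  | succ d ih =>
    have h1 : 2 ^ d * (2 * n) = 2 ^ (d + 1) * n := by ring
    refine exec_seq (exec_double ha _ _ hs ht ?_) (Exec.of_eq (ih _ (n := 2 * n) (by simp)
      (by simp [ha.symm, ht]) (by rwa [h1])) (Store.congr (by simp [h1])))
    refine le_trans ?_ hn
    rw [← h1]
    exact Nat.le_mul_of_pos_left _ (by positivity)

/-- The store prepared for partial assignments of `p` bits. -/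
def sized (d p : ℕ) (s : RedStack → List Sym) : RedStack → List Sym :=
  update (update (update (update (update s u (List.replicate p ff)) v (List.replicate p ff)) nur
    (List.replicate (2 ^ p) tt)) nvr (List.replicate (2 ^ p) tt)) rc
    (List.replicate ((2 ^ p) ^ d) tt)

/-- Increase the length of partial assignments by one bit. -/
def bitStep (d : ℕ) : RCmd :=
  seq (push u fun _ => ff) (seq (push v fun _ => ff) (seq (double nur) (seq (double nvr)
    (rep d (double rc)))))

/-- One more bit doubles the number `2 ^ p` of vertices and multiplies the number `(2 ^ p) ^ d` of
copies by `2 ^ d`. Repeated doubling thus replaces all arithmetic on these numbers. -/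
theorem exec_bitStep {M : ℕ} (d p : ℕ) (f : Flags) (s : RedStack → List Sym) (h1 : s t1 = [])
    (hM : 2 ^ (p + 1) ≤ M) (hM' : (2 ^ (p + 1)) ^ d ≤ M) :
    (bitStep d).Exec M ⟨f, sized d p s⟩ ⟨f, sized d (p + 1) s⟩ := by
  have h2 : 2 * 2 ^ p = 2 ^ (p + 1) := by ring
  have h3 : 2 ^ d * (2 ^ p) ^ d = (2 ^ (p + 1)) ^ d := by rw [← mul_pow, h2]
  refine exec_seq (exec_push _ _ _ _) (exec_seq (exec_push _ _ _ _) (exec_seq (exec_double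
    (by decide) _ _ (n := 2 ^ p) (by simp [sized]) (by simp [sized, h1]) (by rwa [h2]))
    (exec_seq (exec_double (by decide) _ _ (n := 2 ^ p) (by simp [sized]) (by simp [sized, h1])
    (by rwa [h2])) (Exec.of_eq (exec_rep_double (by decide) _ _ d (n := (2 ^ p) ^ d)
    (by simp [sized]) (by simp [sized, h1]) (by rwa [h3])) (Store.congr ?_)))))
  rw [h2, h3]
  funext k
  cases k <;> simp [sized, List.replicate_succ]

theorem sized_update (d p : ℕ) (s : RedStack → List Sym) {c : RedStack} (hc : c = t5 ∨ c = t6)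
    (l : List Sym) : sized d p (update s c l) = update (sized d p s) c l := by
  funext k
  rcases hc with rfl | rfl <;> cases k <;> simp [sized]

theorem exec_bitSteps {M : ℕ} {c : RedStack} (hc : c = t5 ∨ c = t6) (d p : ℕ) (f : Flags)
    (s : RedStack → List Sym) {S : ℕ} (hS : s sS = List.replicate S tt) (h1 : s t1 = [])
    (h2 : s t2 = []) (hc' : s c = []) (hM : 2 ^ (p + S) ≤ M) (hM' : (2 ^ (p + S)) ^ d ≤ M) :
    (times sS c t2 (bitStep d)).Exec M ⟨f, sized d p s⟩ ⟨f, sized d (p + S) s⟩ := by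
  refine exec_times_family (M := M) (a := sS) (c := c) (t := t2) (p := bitStep d)
    (by rcases hc with rfl | rfl <;> decide) (by decide) (by rcases hc with rfl | rfl <;> decide)
    (fun i => sized d (p + i) s) (by simp [sized, hS])
    (fun i => by rcases hc with rfl | rfl <;> simp [sized, hc']) (by simp [sized, h2]) ?_
    (fun i hi l => ?_)
  · exact (Nat.lt_two_pow_self (n := S)).le.trans ((Nat.pow_le_pow_right (by omega) (by omega)).trans hM)
  · have h3 : 2 ^ (p + i + 1) ≤ 2 ^ (p + S) := Nat.pow_le_pow_right (by omega) (by omega)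
    have := exec_bitStep (M := M) d (p + i) f (update s c l)
      (by rcases hc with rfl | rfl <;> simp [h1]) (h3.trans hM)
      ((Nat.pow_le_pow_left h3 d).trans hM')
    rwa [sized_update _ _ _ hc, sized_update _ _ _ hc] at this

/-- Prepare the store for the loops over all pairs of partial assignments. -/
def prepare (d : ℕ) : RCmd :=
  seq (copy w bB t1) (seq (times sS t6 t2 (halve bB)) (seq (push wt fun _ => tt)
  (seq (times sS t6 t2 (double wt)) (seq (push nur fun _ => tt) (seq (push nvr fun _ => tt)
  (seq (push rc fun _ => tt) (seq (times sS t6 t2 (bitStep d))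
  (times bB t6 t2 (seq (times sS t5 t2 (bitStep d)) (seq (bitStep d) (seq (bitStep d)
    (bitStep d))))))))))))

/-- The number `L` is never computed: one bit is added `S` times for the index, and `S + 3` times
for each of the wires of a block. -/
theorem exec_prepare {M : ℕ} (d : ℕ) (f : Flags) (s : RedStack → List Sym) {S W L : ℕ}
    (hW : 1 ≤ W) (hL : L = S + blockSize S W * (S + 3)) (hS : s sS = List.replicate S tt)
    (hw : s w = List.replicate W tt) (hB : s bB = []) (hwt : s wt = []) (hnur : s nur = [])
    (hnvr : s nvr = []) (hrc : s rc = []) (hu : s u = []) (hv : s v = []) (h1 : s t1 = [])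
    (h2 : s t2 = []) (h5 : s t5 = []) (h6 : s t6 = []) (hWM : W ≤ M) (hM : 2 ^ L ≤ M)
    (hM' : (2 ^ L) ^ d ≤ M) :
    (prepare d).Exec M ⟨f, s⟩ ⟨f, sized d L (update (update s bB
      (List.replicate (blockSize S W) tt)) wt (List.replicate (2 ^ S) tt))⟩ := by
  have hLM : L ≤ M := Nat.lt_two_pow_self.le.trans hM
  have hSM : S ≤ M := by omega
  have hBM : blockSize S W ≤ M := (blockSize_le_self S hW).trans hWM
  have hpow : ∀ {i}, i ≤ L → 2 ^ i ≤ M ∧ (2 ^ i) ^ d ≤ M := fun {i} hi =>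
    have h := Nat.pow_le_pow_right (n := 2) (by omega) hi
    ⟨h.trans hM, (Nat.pow_le_pow_left h d).trans hM'⟩
  have e1 := exec_times_family (M := M) (a := sS) (c := t6) (t := t2) (p := halve bB)
    (by decide) (by decide) (by decide) (f := f) (n := S)
    (fun i => update s bB (List.replicate (blockSize i W) tt))
    (by simp [hS]) (by simp [h6]) (by simp [h2]) hSM (fun i _ l => by
      refine Exec.of_eq (exec_halve (by decide) _ _ (n := blockSize i W) (by simp) (by simp [h1])
        ((blockSize_le_self i hW).trans hWM)) (Store.congr ?_)
      rw [blockSize, blockSize, Function.iterate_succ_apply']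
      funext k
      cases k <;> simp)
  have e2 := exec_times_family (M := M) (a := sS) (c := t6) (t := t2) (p := double wt)
    (by decide) (by decide) (by decide) (f := f) (n := S)
    (fun i => update (update s bB (List.replicate (blockSize S W) tt)) wt
      (List.replicate (2 ^ i) tt))
    (by simp [hS]) (by simp [h6]) (by simp [h2]) hSM (fun i hi l => by
      refine Exec.of_eq (exec_double (by decide) _ _ (n := 2 ^ i) (by simp) (by simp [h1])
        ?_) (Store.congr ?_)
      · rw [mul_comm, ← pow_succ]
        exact (hpow (by omega)).1
      · rw [mul_comm, ← pow_succ]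
        funext k
        cases k <;> simp)
  set s1 := update (update s bB (List.replicate (blockSize S W) tt)) wt
    (List.replicate (2 ^ S) tt) with hs1
  have e3 := exec_bitSteps (M := M) (c := t6) (.inr rfl) d 0 f s1 (S := S) (by simp [hs1, hS])
    (by simp [hs1, h1]) (by simp [hs1, h2]) (by simp [hs1, h6]) (hpow (by omega)).1
    (hpow (by omega)).2
  have e4 := exec_times_family (M := M) (a := bB) (c := t6) (t := t2)
    (p := seq (times sS t5 t2 (bitStep d)) (seq (bitStep d) (seq (bitStep d) (bitStep d))))
    (by decide) (by decide) (by decide) (f := f) (n := blockSize S W)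
    (fun i => sized d (S + i * (S + 3)) s1)
    (by simp [hs1, sized]) (by simp [hs1, sized, h6]) (by simp [hs1, sized, h2]) hBM
    (fun i hi l => by
      have hle : S + i * (S + 3) + S + 3 ≤ L := by
        have := Nat.mul_le_mul_right (S + 3) (Nat.succ_le_of_lt hi)
        rw [Nat.succ_mul] at this
        omega
      simp only [← sized_update _ _ _ (.inr rfl)]
      rw [show S + (i + 1) * (S + 3) = S + i * (S + 3) + S + 1 + 1 + 1 by ring]
      exact exec_seq (exec_bitSteps (.inl rfl) d _ f _ (S := S) (by simp [hs1, hS])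
        (by simp [hs1, h1]) (by simp [hs1, h2]) (by simp [hs1, h5]) (hpow (by omega)).1
        (hpow (by omega)).2) (exec_seq (exec_bitStep d _ f _ (by simp [hs1, h1])
        (hpow (by omega)).1 (hpow (by omega)).2) (exec_seq (exec_bitStep d _ f _
        (by simp [hs1, h1]) (hpow (by omega)).1 (hpow (by omega)).2) (exec_bitStep d _ f _
        (by simp [hs1, h1]) (hpow (by omega)).1 (hpow (by omega)).2))))
  have h0 : sized d (S + 0 * (S + 3)) s1 = sized d (0 + S) s1 := by simp
  rw [h0, ← hL] at e4
  refine exec_seq (t := ⟨f, update s bB (List.replicate (blockSize 0 W) tt)⟩) ?_ (exec_seq e1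
    (exec_seq (t := ⟨f, update (update s bB (List.replicate (blockSize S W) tt)) wt
      (List.replicate (2 ^ 0) tt)⟩) ?_ (exec_seq e2 (exec_seq (exec_push _ _ _ _)
    (exec_seq (exec_push _ _ _ _) (exec_seq (t := ⟨f, sized d 0 s1⟩) ?_ (exec_seq e3
    e4)))))))
  · exact Exec.of_eq (exec_copy (by decide) (by decide) (by decide) _ _ h1 (by simp [hw, hWM]))
      (Store.congr (by simp [hw, hB, blockSize]))
  · exact Exec.of_eq (exec_push _ _ _ _) (Store.congr (by simp [hwt]))
  · refine Exec.of_eq (exec_push _ _ _ _) (Store.congr ?_)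
    funext k
    cases k <;> simp [sized, hs1, hu, hv, hnur, hnvr, hrc]

/-- The reduction. -/
def program (d : ℕ) (c c₀ : List Bool) : RCmd :=
  seq (readUnary sS tt [tt]) (seq readCircuit (seq (prepare d) (seq (rows c)
  (seq (times rc t6 t2 (seq (pushList out (c₀.map .bit)) (push cnt fun _ => tt)))
  (seq (push out fun _ => ff) (seq (move cnt out) (seq (push out fun _ => ff) (seq (move nu out)
  (seq (push out fun _ => ff) (seq (move wt out) (seq (clear sS) (seq (clear w) (seq (clear bB)
  (seq (clear u) (seq (clear v) (seq (clear nvr) (seq (clear rc) (clear g))))))))))))))))))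

/-- The codes of the terms of the Hamiltonian. -/
def termCodes (d : ℕ) (c c₀ : List Bool) (G : List GenGate) (S B : ℕ) : List (List Bool) :=
  List.replicate ((2 ^ (S + B * (S + 3))) ^ d) c₀ ++
    allCodes c ((2 ^ (S + B * (S + 3))) ^ d) (clash G S B) (2 ^ (S + B * (S + 3)))
      (2 ^ (S + B * (S + 3)))

/-- What the reduction writes. -/
def programOutput (d : ℕ) (c c₀ : List Bool) (G : List GenGate) (S B : ℕ) : List Bool :=
  encUnary (2 ^ S) ++ (encUnary (2 ^ (S + B * (S + 3))) ++
    (encUnary (termCodes d c c₀ G S B).length ++ (termCodes d c c₀ G S B).flatten))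

/-- The parameter on the input is `i` with `S = i + 1`, so that there are always at least two
blocks. The output is assembled from its end: terms, their number, the number of qubits, and the
weight. -/
theorem exec_program {M : ℕ} (d : ℕ) (c c₀ : List Bool) (C : BoolCircuit) (i : ℕ) {S W B L : ℕ}
    (hS : S = i + 1) (hW : W = C.inputs + C.size + 1) (hB : B = blockSize S W)
    (hL : L = S + B * (S + 3)) (hM : 2 ^ L ≤ M) (hM' : (2 ^ L) ^ d ≤ M) (hWM : W ≤ M)
    (hG : ((genGates C).flatMap GenGate.encode).length ≤ M)
    (hcodes : (termCodes d c c₀ (genGates C) S B).length ≤ M) :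
    (program d c c₀).Exec M ⟨{}, single inp ((encUnary i ++ C.encode).map .bit)⟩
      ⟨{}, single out ((programOutput d c c₀ (genGates C) S B).map .bit)⟩ := by
  have hLM : L ≤ M := Nat.lt_two_pow_self.le.trans hM
  have hSM : S ≤ M := by omega
  have hBL : S + B ≤ L := by
    rw [hL]
    exact Nat.add_le_add_left (Nat.le_mul_of_pos_right _ (by omega)) _
  set N := (2 ^ L) ^ d with hN
  set G := genGates C with hGdef
  have hcells : 2 ^ S * B ≤ M :=
    (Nat.mul_le_mul_left _ Nat.lt_two_pow_self.le).trans (by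
      rw [← pow_add]
      exact (Nat.pow_le_pow_right (by omega) hBL).trans hM)
  have hpS : 2 ^ S ≤ M := (Nat.pow_le_pow_right (by omega) (by omega)).trans hM
  set s0 : RedStack → List Sym := single inp ((encUnary i ++ C.encode).map .bit) with hs0
  have hz : ∀ k, k ≠ inp → s0 k = [] := fun k hk => by simp [hs0, single, hk]
  set s1 := update (update s0 inp (C.encode.map .bit)) sS (List.replicate S tt) with hs1
  set s2 := update (update (update s1 inp []) w (List.replicate W tt)) g
    (G.flatMap GenGate.encode) with hs2
  set s3 := sized d L (update (update s2 bB (List.replicate B tt)) wt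
    (List.replicate (2 ^ S) tt)) with hs3
  set s4 := update (update (written (allCodes c N (clash G S B) (2 ^ L) (2 ^ L)) s3) nur []) nu
    (List.replicate (2 ^ L) tt) with hs4
  set s5 := written (List.replicate N c₀) s4 with hs5
  have e5 := exec_times_family (M := M) (a := rc) (c := t6) (t := t2)
    (p := seq (pushList out (c₀.map .bit)) (push cnt fun _ => tt))
    (by decide) (by decide) (by decide) (f := {}) (n := N)
    (fun i => written (List.replicate i c₀) s4) (by simp [hs4, hs3, sized, ← hN])
    (by simp [hs4, hs3, hs2, hs1, sized, hz]) (by simp [hs4, hs3, hs2, hs1, sized, hz]) hM'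
    (fun i hi l => exec_seq (exec_pushList _ _ _) (Exec.of_eq (exec_push _ _ _ _) (Store.congr (by
      funext k
      cases k <;> simp [written, List.replicate_succ]))))
  have hcnt : s5 cnt = List.replicate (termCodes d c c₀ G S B).length tt := by
    simp [hs5, hs4, hs3, hs2, hs1, sized, hz, written, termCodes, ← hL, ← hN, List.length_append]
  have hout : s5 out = ((termCodes d c c₀ G S B).flatten).map .bit := by
    simp [hs5, hs4, hs3, hs2, hs1, sized, hz, written, termCodes, ← hL, ← hN]
  have hnu : s5 nu = List.replicate (2 ^ L) tt := by simp [hs5, hs4]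
  have hwt : s5 wt = List.replicate (2 ^ S) tt := by simp [hs5, hs4, hs3, sized]
  -- This records which stacks still have to be emptied, and their lengths, before the value of `s5`
  -- is forgotten.
  have hrest : ∀ k, k ≠ cnt → k ≠ out → k ≠ nu → k ≠ wt → (s5 k).length ≤ M ∧
      (k ≠ sS → k ≠ w → k ≠ bB → k ≠ u → k ≠ v → k ≠ nvr → k ≠ rc → k ≠ g → s5 k = []) := by
    intro k
    cases k <;> simp [hs5, hs4, hs3, hs2, hs1, sized, hz, hSM, hWM, hLM, hM, hM', hG,
      show B ≤ M by omega, ← hN, -List.length_flatMap]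
  refine exec_seq (t := ⟨{}, s1⟩) ?_ (exec_seq (t := ⟨{}, s2⟩) ?_ (exec_seq (t := ⟨{}, s3⟩) ?_
    (exec_seq (t := ⟨{}, s4⟩) ?_ (exec_seq (t := ⟨{}, s5⟩) ?_ ?_))))
  · refine Exec.of_eq (exec_readUnary (by decide) _ _ _ _ (n := i) (rest := C.encode) ?_ (by omega))
      (Store.congr ?_)
    · simp [hs0, single]
    · simp [hs1, hz, hS, List.replicate_succ]
  · refine Exec.of_eq (exec_readCircuit _ _ C (by simp [hs1]) (by simp [hs1, hz])
      (by simp [hs1, hz]) (by simp [hs1, hz]) (by simp [hs1, hz]) (by simp [hs1, hz])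
      (by simp [hs1, hz]) (by omega) hG) (Store.congr ?_)
    rw [hs2, hW]
  · have := exec_prepare (M := M) d {} s2 (S := S) (W := W) (L := L) (by omega)
      (by rw [hL, hB]) (by simp [hs2, hs1]) (by simp [hs2]) (by simp [hs2, hs1, hz])
      (by simp [hs2, hs1, hz]) (by simp [hs2, hs1, hz]) (by simp [hs2, hs1, hz])
      (by simp [hs2, hs1, hz]) (by simp [hs2, hs1, hz]) (by simp [hs2, hs1, hz])
      (by simp [hs2, hs1, hz]) (by simp [hs2, hs1, hz]) (by simp [hs2, hs1, hz])
      (by simp [hs2, hs1, hz]) hWM hM hM'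
    rwa [← hB] at this
  · have hr : Ready S B N G s3 := by
      constructor <;> simp [hs3, hs2, hs1, sized, hz, hN]
    have := exec_rows (M := M) c s3 hr ⟨hL ▸ hLM, hcells, hG, hM', hL ▸ hM⟩
      (by simp [hs3, sized, natBits_zero, ← hL]) (by simp [hs3, sized, natBits_zero, ← hL])
      (by simp [hs3, hs2, hs1, sized, hz]) (by simp [hs3, hs2, hs1, sized, hz])
      (by simp [hs3, sized, ← hL]) (by simp [hs3, sized, ← hL])
    rwa [← hL] at this
  · have h0 : written (List.replicate 0 c₀) s4 = s4 := by simp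
    rw [h0] at e5
    exact e5
  clear_value s5
  refine exec_seq (exec_push _ _ _ _) (exec_seq (exec_move (by decide) _ _ (by simp [hcnt, hcodes]))
    (exec_seq (exec_push _ _ _ _) (exec_seq (exec_move (by decide) _ _ (by simp [hnu, hM]))
    (exec_seq (exec_push _ _ _ _) (exec_seq (exec_move (by decide) _ _ (by simp [hwt, hpS]))
    (exec_seq (exec_clear _ _ (by simp [hrest])) (exec_seq (exec_clear _ _ (by simp [hrest]))
    (exec_seq (exec_clear _ _ (by simp [hrest])) (exec_seq (exec_clear _ _ (by simp [hrest]))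
    (exec_seq (exec_clear _ _ (by simp [hrest])) (exec_seq (exec_clear _ _ (by simp [hrest]))
    (exec_seq (exec_clear _ _ (by simp [hrest])) (Exec.of_eq (exec_clear _ _ (by simp [hrest]))
    (Store.congr ?_))))))))))))))
  funext k
  cases k <;> simp [single, hrest, hcnt, hnu, hwt, hout, programOutput, encUnary, ← hL]

end Red

end StackProg

/-! ### Satisfiability and compatible partial assignments -/

namespace StackProg

/-- The constraint holds for the wires `Y`, the constrained wire having the value `y`. -/
def GenGate.Holds (g : GenGate) (Y : ℕ → Bool) (y : Bool) : Prop :=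
  ∃ A α, g.rel y A α = true ∧ (A = true ↔ ∀ i, g.fst.getD i false = true → Y i ≠ g.pol) ∧
    ∀ i, g.snd.getD i false = true → Y i = α

theorem getD_mark (i j : ℕ) : (mark i).getD j false = true ↔ j = i := by
  rw [mark, List.getD_eq_getElem?_getD, List.getElem?_append]
  rcases lt_trichotomy j i with h | rfl | h
  · simp [h, h.ne]
  · simp
  · simp [h.not_gt, h.ne', Nat.sub_ne_zero_of_lt h]

theorem getD_encSet {w : ℕ} (S : Finset (Fin w)) (j : ℕ) :
    (BoolGate.encSet S).getD j false = true ↔ ∃ h : j < w, (⟨j, h⟩ : Fin w) ∈ S := by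
  by_cases h : j < w
  · simp [BoolGate.encSet, List.getD_eq_getElem?_getD, h]
  · simp [BoolGate.encSet, List.getD_eq_getElem?_getD, h]

/-- For a single marked wire `A` is forced to be its value, for a set it is the conjunction (of the
complements for a disjunction), and `α` is forced to be the second input or the Toffoli target. The
relation then becomes the equation of the gate. -/
theorem GenGate.holds_ofGate {w : ℕ} (b : BoolGate w) (Y : ℕ → Bool) (y : Bool) :
    (GenGate.ofGate b).Holds Y y ↔ y = b.eval fun j => Y j := by
  cases b with
  | unary f i =>
    simp only [Holds, ofGate, getD_mark, beq_iff_eq, BoolGate.eval]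
    constructor
    · rintro ⟨A, α, h, h1, -⟩
      have : A = Y i := by cases A <;> simpa using h1
      rw [h, this]
    · rintro h
      exact ⟨Y i, false, h, by simp, by simp⟩
  | binary f i j =>
    simp only [Holds, ofGate, getD_mark, beq_iff_eq, BoolGate.eval]
    constructor
    · rintro ⟨A, α, h, h1, h2⟩
      have : A = Y i := by cases A <;> simpa using h1
      rw [h, this, h2 j rfl]
    · rintro h
      exact ⟨Y i, Y j, h, by simp, by simp⟩
  | bigAnd S =>
    simp only [Holds, ofGate, getD_encSet, beq_iff_eq, BoolGate.eval]
    constructor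
    · rintro ⟨A, α, h, h1, -⟩
      rw [h, Bool.eq_iff_iff, h1]
      simp only [forall_exists_index, ne_eq, Bool.not_eq_false, decide_eq_true_eq]
      exact ⟨fun H i hi => H i i.2 hi, fun H i hi hi' => H ⟨i, hi⟩ hi'⟩
    · rintro h
      refine ⟨y, false, rfl, ?_, by simp⟩
      rw [h]
      simp only [forall_exists_index, ne_eq, Bool.not_eq_false, decide_eq_true_eq]
      exact ⟨fun H i hi hi' => H ⟨i, hi⟩ hi', fun H i hi => H i i.2 hi⟩
  | bigOr S =>
    simp only [Holds, ofGate, getD_encSet, beq_iff_eq, BoolGate.eval]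
    constructor
    · rintro ⟨A, α, h, h1, -⟩
      rw [h, ← Bool.not_inj_iff, Bool.not_not, Bool.eq_iff_iff, h1]
      simp only [forall_exists_index, ne_eq, Bool.not_eq_true, Bool.not_eq_eq_eq_not, Bool.not_true,
        decide_eq_false_iff_not, not_exists, not_and]
      exact ⟨fun H i hi => by simpa using H i i.2 hi, fun H i hi hi' => by simpa using H ⟨i, hi⟩ hi'⟩
    · rintro h
      refine ⟨!y, false, by simp, ?_, by simp⟩
      rw [h]
      simp only [forall_exists_index, ne_eq, Bool.not_eq_true, Bool.not_eq_eq_eq_not, Bool.not_true,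
        decide_eq_false_iff_not, not_exists, not_and]
      exact ⟨fun H i hi hi' => by simpa using H ⟨i, hi⟩ hi', fun H i hi => by simpa using H i i.2 hi⟩
  | toffoli S t =>
    simp only [Holds, ofGate, getD_encSet, getD_mark, beq_iff_eq, BoolGate.eval]
    have key : (∀ i, (∃ h : i < w, (⟨i, h⟩ : Fin w) ∈ S) → Y i ≠ false) ↔
        decide (∀ i ∈ S, Y i = true) = true := by
      simp only [forall_exists_index, ne_eq, Bool.not_eq_false, decide_eq_true_eq]
      exact ⟨fun H i hi => H i i.2 hi, fun H i hi hi' => H ⟨i, hi⟩ hi'⟩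
    constructor
    · rintro ⟨A, α, h, h1, h2⟩
      rw [key, ← Bool.eq_iff_iff] at h1
      rw [h, h1, h2 t rfl]
    · rintro h
      exact ⟨_, Y t, h, key.symm, by simp⟩

theorem wires_stable (C : BoolCircuit) (x : Fin C.inputs → Bool) {i k : ℕ} (hk : k ≤ C.size)
    (hik : i ≤ k) (w : ℕ) (hw : w < C.inputs + i) :
    C.wires x k hk ⟨w, by omega⟩ = C.wires x i (hik.trans hk) ⟨w, hw⟩ := by
  induction k with
  | zero =>
    obtain rfl : i = 0 := by omega
    rfl
  | succ k ih =>
    rcases Nat.lt_or_ge k i with h | h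
    · obtain rfl : i = k + 1 := by omega
      rfl
    · rw [← ih (by omega) h]
      simp only [BoolCircuit.wires]
      exact Fin.snoc_castSucc (α := fun _ => Bool) _ _ (⟨w, by omega⟩ : Fin (C.inputs + k))

theorem wires_gate (C : BoolCircuit) (x : Fin C.inputs → Bool) (i : Fin C.size) :
    C.wires x C.size le_rfl ⟨C.inputs + i, by omega⟩ =
      (C.gate i).eval (C.wires x i i.2.le) := by
  rw [wires_stable C x le_rfl (i := i + 1) i.2 (C.inputs + i) (by omega)]
  simp only [BoolCircuit.wires]
  exact Fin.snoc_last (α := fun _ => Bool) _ _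

/-- A circuit is satisfiable if and only if the constraints for its wires are. -/
theorem satisfiable_iff (C : BoolCircuit) : C.Satisfiable ↔
    ∃ Y : ℕ → Bool, ∀ p (h : p < (genGates C).length), (genGates C)[p].Holds Y (Y p) := by
  have hlen : (genGates C).length = C.inputs + C.size + 1 := by simp [genGates]; omega
  have hgate : ∀ i : Fin C.size, (genGates C)[C.inputs + i]'(by omega) = .ofGate (C.gate i) := by
    intro i
    have : (List.finRange C.size)[(i : ℕ)]'(by simp) = i := by
      ext
      simp
    simpa [genGates, List.getElem_append] using
      congrArg (fun k => GenGate.ofGate (C.gate k)) this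
  have hout : (genGates C)[C.inputs + C.size]'(by omega) = .accept C.output := by
    simp [genGates, List.getElem_append]
  constructor
  · rintro ⟨x, hx⟩
    let Y : ℕ → Bool := fun w => if h : w < C.inputs + C.size then C.wires x C.size le_rfl ⟨w, h⟩
      else false
    refine ⟨Y, fun p hp => ?_⟩
    rcases Nat.lt_or_ge p C.inputs with h | h
    · have : (genGates C)[p] = .free := by simp [genGates, List.getElem_append, h]
      rw [this]
      exact ⟨true, false, rfl, by simp [GenGate.free], by simp [GenGate.free]⟩
    rcases Nat.lt_or_ge p (C.inputs + C.size) with h' | h'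
    · obtain ⟨i, rfl⟩ := Nat.exists_eq_add_of_le h
      rw [hgate ⟨i, by omega⟩, GenGate.holds_ofGate]
      have := wires_gate C x ⟨i, by omega⟩
      simp only [Y, h', dite_true]
      rw [this]
      congr 1
      funext j
      rw [dif_pos (show (j : ℕ) < C.inputs + C.size by have := j.2; simp only at this; omega)]
      exact (wires_stable C x le_rfl (by simp; omega) j j.2).symm
    · obtain rfl : p = C.inputs + C.size := by omega
      rw [hout]
      refine ⟨true, true, rfl, by simp [GenGate.accept], ?_⟩
      simp only [GenGate.accept, getD_mark, forall_eq]
      simpa [Y] using (show C.wires x C.size le_rfl C.output = true from hx)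
  · rintro ⟨Y, hY⟩
    -- The gate constraints determine the wires one after the other, so `Y` coincides with the
    -- computation of the circuit on its first values.
    have hw : ∀ i (hi : i ≤ C.size), C.wires (fun j => Y j) i hi =
        fun j : Fin (C.inputs + i) => Y j := by
      intro i
      induction i with
      | zero => exact fun _ => rfl
      | succ i ih =>
        intro hi
        funext j
        have h1 := hY (C.inputs + i) (by omega)
        rw [hgate ⟨i, hi⟩, GenGate.holds_ofGate] at h1
        simp only [BoolCircuit.wires, ih (by omega)]
        refine Fin.lastCases ?_ (fun j => ?_) j
        · rw [Fin.snoc_last]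
          exact h1.symm
        · rw [Fin.snoc_castSucc]
          rfl
    refine ⟨fun j => Y j, ?_⟩
    have h1 := hY (C.inputs + C.size) (by omega)
    rw [hout] at h1
    obtain ⟨A, α, h2, -, h3⟩ := h1
    rw [BoolCircuit.eval, hw]
    exact (h3 C.output ((getD_mark _ _).2 rfl)).trans h2

theorem length_marks_le (C : BoolCircuit) {g : GenGate} (hg : g ∈ genGates C) :
    g.fst.length ≤ C.inputs + C.size ∧ g.snd.length ≤ C.inputs + C.size := by
  simp only [genGates, List.mem_append, List.mem_replicate, List.mem_map, List.mem_finRange,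
    true_and, List.mem_singleton] at hg
  rcases hg with ⟨-, rfl⟩ | ⟨i, rfl⟩ | rfl
  · simp [GenGate.free]
  · have hi := i.2
    cases C.gate i with
    | unary f a => have := a.2; simp [GenGate.ofGate, mark]; omega
    | binary f a b => have := a.2; have := b.2; simp [GenGate.ofGate, mark]; omega
    | bigAnd S => simp [GenGate.ofGate, BoolGate.encSet]; try omega
    | bigOr S => simp [GenGate.ofGate, BoolGate.encSet]; try omega
    | toffoli S t => have := t.2; simp [GenGate.ofGate, BoolGate.encSet, mark]; omega
  · have := C.output.2
    simp [GenGate.accept, mark]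

theorem length_encode_genGates_le (C : BoolCircuit) :
    ((genGates C).flatMap GenGate.encode).length ≤
      (C.inputs + C.size + 1) * (2 * (C.inputs + C.size) + 3) := by
  have h : ∀ G : List GenGate, (∀ g ∈ G, g ∈ genGates C) → (G.flatMap GenGate.encode).length ≤
      G.length * (2 * (C.inputs + C.size) + 3) := by
    intro G hG
    induction G with
    | nil => simp
    | cons g G ih =>
      have h1 := length_marks_le C (hG g (by simp))
      have h2 := ih fun g hg => hG g (by simp [hg])
      rw [List.flatMap_cons, List.length_append, List.length_cons, Nat.succ_mul]
      have : g.encode.length ≤ 2 * (C.inputs + C.size) + 3 := by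
        simp [GenGate.encode]
        omega
      omega
  have hlen : (genGates C).length = C.inputs + C.size + 1 := by simp [genGates]; omega
  simpa [hlen] using h (genGates C) fun _ => id

theorem zip_any_iff {α : Type*} (S : List Bool) (Y : List (Option α)) (p : α → Bool) :
    ((S.zip Y).any fun q => q.1 && q.2.elim false p) = true ↔
      ∃ i c, S.getD i false = true ∧ Y.getD i none = some c ∧ p c = true := by
  induction S generalizing Y with
  | nil => simp
  | cons b S ih =>
    rcases Y with _ | ⟨d, Y⟩
    · simp
    · rw [List.zip_cons_cons, List.any_cons, Bool.or_eq_true, ih]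
      constructor
      · rintro (h | ⟨i, c, h⟩)
        · rcases d with _ | d
          · simp at h
          · exact ⟨0, d, by simpa using h⟩
        · exact ⟨i + 1, c, by simpa using h⟩
      · rintro ⟨_ | i, c, h1, h2, h3⟩
        · left
          simp only [List.getD_cons_zero] at h1 h2
          simp [h1, h2, h3]
        · exact .inr ⟨i, c, by simpa using h1, by simpa using h2, h3⟩

/-- The test against one block is asymmetric in `A`: a true `A` must not be contradicted by any
block, but a false `A` needs a counterexample only in the block singled out by `m`. -/
theorem GenGate.ok_iff (g : GenGate) (y A α m : Bool) (Y : List Cell) :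
    g.ok (some (y, A, α, m)) Y = true ↔ g.rel y A α = true ∧
      (∀ i c, g.snd.getD i false = true → Y.getD i none = some c → c.1 = α) ∧
      (A = true → ∀ i c, g.fst.getD i false = true → Y.getD i none = some c → c.1 ≠ g.pol) ∧
      (A = false → m = true → ∃ i c, g.fst.getD i false = true ∧ Y.getD i none = some c ∧
        c.1 = g.pol) := by
  have h1 : seenFalse g.pol g.fst Y = true ↔ _ := zip_any_iff g.fst Y fun c => c.1 == g.pol
  have h2 : seenOther α g.snd Y = true ↔ _ := zip_any_iff g.snd Y fun c => c.1 != α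
  have h3 : (!seenOther α g.snd Y) = true ↔
      ∀ i c, g.snd.getD i false = true → Y.getD i none = some c → c.1 = α := by
    rw [Bool.not_eq_true', ← Bool.not_eq_true, h2]
    push Not
    simp
  have h4 : (!seenFalse g.pol g.fst Y) = true ↔
      ∀ i c, g.fst.getD i false = true → Y.getD i none = some c → c.1 ≠ g.pol := by
    rw [Bool.not_eq_true', ← Bool.not_eq_true, h1]
    push Not
    simp
  simp only [beq_iff_eq] at h1
  simp only [ok, Option.elim, Bool.and_eq_true, and_assoc, h3]
  refine and_congr_right fun _ => and_congr_right fun _ => ?_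
  cases A
  · simp only [cond_false, Bool.or_eq_true, h1, Bool.not_eq_true']
    cases m <;> simp
  · simp only [cond_true, h4]
    simp

theorem refutes_eq_false_iff (G : List GenGate) (w w' : Block) : refutes G w w' = false ↔
    ∀ p (h : p < G.length), G[p].ok ((w.cells w'.idx).getD p none) (w'.cells w'.idx) = true := by
  rw [refutes]
  generalize w'.cells w'.idx = Y
  generalize w.cells w'.idx = E
  induction G generalizing E with
  | nil => simp
  | cons g G ih =>
    rcases E with _ | ⟨c, E⟩
    · simp [GenGate.ok]
    · rw [List.zip_cons_cons, List.any_cons, Bool.or_eq_false_iff, ih]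
      constructor
      · rintro ⟨h1, h2⟩ (_ | p) hp
        · simpa using h1
        · simpa using h2 p (by simpa using hp)
      · intro h
        exact ⟨(Bool.not_eq_false' _).mpr (h 0 (by simp)), fun p hp => h (p + 1) (by simpa using hp)⟩

/-- Each doubling puts the list into the lower or the upper half, so the lowest remaining digit of
`p / l.length` must equal the index bit; the induction continues with lists of twice the length. -/
theorem getD_place {α : Type*} (i : List Bool) (l : List (Option α)) (p : ℕ)
    (hp : p < 2 ^ i.length * l.length) : (place i l).getD p none =
      if natBits i.length (p / l.length) = i then l.getD (p % l.length) none else none := by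
  induction i generalizing l with
  | nil =>
    have : p < l.length := by simpa using hp
    simp [place, natBits, Nat.mod_eq_of_lt this]
  | cons b i ih =>
    have hl : (cond b (List.replicate l.length none ++ l)
        (l ++ List.replicate l.length none)).length = 2 * l.length := by
      cases b <;> simp <;> omega
    have hpos : 0 < l.length := by
      rcases Nat.eq_zero_or_pos l.length with h | h
      · simp [h] at hp
      · exact h
    rw [place, ih _ (by rw [hl]; simp only [List.length_cons, pow_succ] at hp; linarith), hl,
      List.length_cons, natBits, mul_comm 2, ← Nat.div_div_eq_div_mul]
    simp only [List.cons.injEq]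
    have hmod : p % (l.length * 2) = p % l.length + l.length * (p / l.length % 2) := Nat.mod_mul
    have hlt := Nat.mod_lt p hpos
    by_cases h : natBits i.length (p / l.length / 2) = i
    · simp only [h, if_true, and_true]
      rcases Nat.mod_two_eq_zero_or_one (p / l.length) with h2 | h2
      · rw [h2, mul_zero, add_zero] at hmod
        rw [hmod, h2]
        cases b
        · simp [List.getD_eq_getElem?_getD, List.getElem?_append, hlt]
        · simp [List.getD_eq_getElem?_getD, List.getElem?_append, hlt]
      · rw [h2, mul_one] at hmod
        rw [hmod, h2]
        cases b
        · simp [List.getD_eq_getElem?_getD, List.getElem?_append, hlt]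
        · simp [List.getD_eq_getElem?_getD, List.getElem?_append]
    · simp [h]

theorem getD_cells {S B : ℕ} {w : Block} (hw : w.WF S B) (J : List Bool) {p : ℕ}
    (hp : p < 2 ^ S * B) : (w.cells J).getD p none =
      if natBits S (p / B) = w.idx then (w.claims.reverse[p % B]?).bind (Claim.cell J)
      else none := by
  rw [Block.cells, getD_place _ _ _ (by simpa [hw.idx, hw.claims] using hp)]
  simp only [List.length_reverse, List.length_map, hw.claims, hw.idx]
  congr 1
  rw [← List.map_reverse, List.getD_eq_getElem?_getD, List.getElem?_map]
  cases w.claims.reverse[p % B]? <;> simp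

end StackProg

/-! ### The independent sets of the conflict graph -/

namespace StackProg

theorem natBits_vertex {S B i : ℕ} : (vertex S B i).WF S B ∧
    (vertex S B i).bits = natBits (S + B * (S + 3)) i :=
  Block.ofBits_spec (length_natBits _ i)

/-- The constraints are satisfied if there are `2 ^ S` compatible partial assignments. -/
theorem holds_of_clash {G : List GenGate} {S B : ℕ} (hS : 1 ≤ S) (hB : 1 ≤ B)
    (hG : G.length ≤ 2 ^ S * B)
    (hlen : ∀ g ∈ G, g.fst.length ≤ 2 ^ S * B ∧ g.snd.length ≤ 2 ^ S * B)
    (T : Finset (Fin (2 ^ (S + B * (S + 3))))) (hT : T.card = 2 ^ S)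
    (h : ∀ i ∈ T, ∀ j ∈ T, clash G S B i j = false) :
    ∃ Y : ℕ → Bool, ∀ p (h : p < G.length), G[p].Holds Y (Y p) := by
  have hc : ∀ i ∈ T, ∀ j ∈ T, i ≠ j → conflict G (vertex S B i) (vertex S B j) = false := by
    intro i hi j hj hij
    have h1 := h i hi j hj
    rw [clash, Bool.and_eq_false_iff] at h1
    refine h1.resolve_left fun h2 => hij (Fin.ext (natBits_injOn _ i.2 j.2 ?_))
    simpa using h2
  -- With at least two blocks every chosen vertex has a partner, and the conflict test with that
  -- partner also excludes that the vertex refutes itself.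
  have hself : ∀ i ∈ T, ∃ j ∈ T, i ≠ j := by
    intro i hi
    have : 1 < T.card := by
      rw [hT]
      exact Nat.one_lt_two_pow (by omega)
    obtain ⟨j, hj, hij⟩ := Finset.exists_mem_ne this i
    exact ⟨j, hj, hij.symm⟩
  have href : ∀ i ∈ T, ∀ j ∈ T, refutes G (vertex S B i) (vertex S B j) = false := by
    intro i hi j hj
    by_cases hij : i = j
    · subst hij
      obtain ⟨k, hk, hik⟩ := hself i hi
      have := hc i hi k hk hik
      simp only [conflict, Bool.or_eq_false_iff] at this
      exact this.2.1
    · have := hc i hi j hj hij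
      simp only [conflict, Bool.or_eq_false_iff] at this
      exact this.2.2
  have hinj : Set.InjOn (fun i : Fin (2 ^ (S + B * (S + 3))) => (vertex S B i).idx) T := by
    intro i hi j hj hij
    by_contra hne
    have := hc i hi j hj hne
    simp only [conflict, Bool.or_eq_false_iff] at this
    simp [hij] at this
  -- Pigeonhole: `2 ^ S` vertices with distinct indices of length `S` exhaust all indices.
  have himg : T.image (fun i : Fin (2 ^ (S + B * (S + 3))) => (vertex S B i).idx) =
      (Finset.range (2 ^ S)).image (natBits S) := by
    refine Finset.eq_of_subset_of_card_le ?_ ?_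
    · intro l hl
      obtain ⟨i, -, rfl⟩ := Finset.mem_image.1 hl
      obtain ⟨n, hn, h1⟩ := exists_natBits (vertex S B i).idx
      rw [natBits_vertex.1.idx] at hn h1
      exact Finset.mem_image.2 ⟨n, Finset.mem_range.2 hn, h1⟩
    · rw [Finset.card_image_of_injOn hinj, hT]
      exact Finset.card_image_le.trans (by simp)
  have hex : ∀ c, c < 2 ^ S → ∃ i ∈ T, (vertex S B i).idx = natBits S c := by
    intro c hc
    have : natBits S c ∈ (Finset.range (2 ^ S)).image (natBits S) :=
      Finset.mem_image.2 ⟨c, Finset.mem_range.2 hc, rfl⟩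
    rw [← himg] at this
    exact Finset.mem_image.1 this
  -- The block of wire `p` is `p / B`, and the vertex chosen for that block supplies the claim for
  -- `p`. The claims are glued to an assignment by taking their values.
  have hclaim : ∀ p, p < 2 ^ S * B → ∃ i ∈ T, ∃ r : Claim, r.wit.length = S ∧
      ∀ J, ((vertex S B i).cells J).getD p none = r.cell J := by
    intro p hp
    obtain ⟨i, hi, h1⟩ := hex (p / B) (Nat.div_lt_of_lt_mul (by rwa [mul_comm]))
    have hw := (natBits_vertex (S := S) (B := B) (i := i)).1
    have hlt : p % B < (vertex S B i).claims.reverse.length := by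
      rw [List.length_reverse, hw.claims]
      exact Nat.mod_lt _ hB
    refine ⟨i, hi, (vertex S B i).claims.reverse[p % B], hw.wit _ ?_, fun J => ?_⟩
    · exact List.mem_reverse.1 (List.getElem_mem hlt)
    · rw [getD_cells hw J hp, if_pos h1.symm, List.getElem?_eq_getElem hlt]
      rfl
  have : Nonempty Claim := ⟨⟨false, false, false, []⟩⟩
  choose! I hI R hR using hclaim
  have hY : ∀ j, j < 2 ^ S * B → ∀ J, ∃ c, ((vertex S B (I j)).cells J).getD j none = some c ∧
      c.1 = (R j).y := fun j hj J => ⟨_, (hR j hj).2 J, rfl⟩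
  have hmark : ∀ {l : List Bool} {i}, l.length ≤ 2 ^ S * B → l.getD i false = true →
      i < 2 ^ S * B := by
    intro l i hl hi
    by_contra hlt
    rw [List.getD_eq_default _ _ (by omega)] at hi
    exact Bool.false_ne_true hi
  refine ⟨fun p => (R p).y, fun p hp => ?_⟩
  have hp' := hp.trans_le hG
  have hl := hlen G[p] (List.getElem_mem hp)
  have hok : ∀ i ∈ T, _ := fun i hi =>
    (refutes_eq_false_iff _ _ _).1 (href (I p) (hI p hp') i hi) p hp
  simp only [(hR p hp').2, Claim.cell, GenGate.ok_iff] at hok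
  refine ⟨(R p).A, (R p).α, (hok _ (hI p hp')).1, ⟨fun hA i hi => ?_, fun hi => ?_⟩, fun i hi => ?_⟩
  · have hi' := hmark hl.1 hi
    obtain ⟨c, h1, h2⟩ := hY i hi' (vertex S B (I i)).idx
    simp only [← h2]
    exact (hok _ (hI i hi')).2.2.1 hA i c hi h1
  · by_contra hA
    rw [Bool.not_eq_true] at hA
    -- If `A` is claimed to be false, the named block `k` has been chosen too, and compatibility
    -- with it yields a counterexample wire `i` there.
    obtain ⟨n, hn, h1⟩ := exists_natBits (R p).wit
    rw [(hR p hp').1] at hn h1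
    obtain ⟨k, hk, h2⟩ := hex n hn
    obtain ⟨i, c, h3, h4, h5⟩ := (hok k hk).2.2.2 hA (by simp [h2, h1])
    have hi' := hmark hl.1 h3
    rw [getD_cells natBits_vertex.1 _ hi'] at h4
    have hki : natBits S (i / B) = (vertex S B k).idx := by
      by_contra hne
      simp [hne] at h4
    -- Vertex `k` says something about wire `i`, hence has the index of its block; the chosen
    -- vertices have distinct indices, so it is the one defining the value of `i`.
    have h6 : I i = k := by
      refine hinj (hI i hi') hk ?_
      have h7 := (hR i hi').2 []
      rw [getD_cells natBits_vertex.1 _ hi'] at h7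
      by_contra hne
      rw [if_neg (by rw [hki]; exact fun h => hne h.symm)] at h7
      simp [Claim.cell] at h7
    obtain ⟨c', h8, h9⟩ := hY i hi' (vertex S B k).idx
    rw [h6, getD_cells natBits_vertex.1 _ hi', h4] at h8
    refine hi i h3 ?_
    simp only [← h9]
    rw [← h5, Option.some.inj h8]
  · have hi' := hmark hl.2 hi
    obtain ⟨c, h1, h2⟩ := hY i hi' (vertex S B (I i)).idx
    simp only [← h2]
    exact (hok _ (hI i hi')).2.1 i c hi h1

/-- If the constraints can be satisfied then there are `2 ^ S` compatible partial assignments. -/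
theorem clash_of_holds {G : List GenGate} {S B : ℕ} (hB : 1 ≤ B)
    (hG : G.length ≤ 2 ^ S * B)
    (hlen : ∀ g ∈ G, g.fst.length ≤ 2 ^ S * B ∧ g.snd.length ≤ 2 ^ S * B)
    {Y : ℕ → Bool} (hY : ∀ p (h : p < G.length), G[p].Holds Y (Y p)) :
    ∃ T : Finset (Fin (2 ^ (S + B * (S + 3)))), T.card = 2 ^ S ∧
      ∀ i ∈ T, ∀ j ∈ T, clash G S B i j = false := by
  have hmark : ∀ {l : List Bool} {i}, l.length ≤ 2 ^ S * B → l.getD i false = true →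
      i < 2 ^ S * B := by
    intro l i hl hi
    by_contra hlt
    rw [List.getD_eq_default _ _ (by omega)] at hi
    exact Bool.false_ne_true hi
  -- Each wire claims its actual value together with `A` and `α` from its constraint; when `A` is
  -- false, the witness is the block of some wire violating the conjunction. Surplus positions get
  -- arbitrary witnesses.
  have hclaim : ∀ p, ∃ r : Claim, r.y = Y p ∧ r.wit.length = S ∧ ∀ h : p < G.length,
      G[p].rel (Y p) r.A r.α = true ∧ (r.A = true → ∀ i, G[p].fst.getD i false = true →
        Y i ≠ G[p].pol) ∧ (∀ i, G[p].snd.getD i false = true → Y i = r.α) ∧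
      (r.A = false → ∃ i < 2 ^ S * B, G[p].fst.getD i false = true ∧ Y i = G[p].pol ∧
        r.wit = natBits S (i / B)) := by
    intro p
    by_cases h : p < G.length
    · obtain ⟨A, α, h1, h2, h3⟩ := hY p h
      cases A
      · simp only [Bool.false_eq_true, false_iff, not_forall, not_not] at h2
        obtain ⟨i, h4, h5⟩ := h2
        have hi := hmark (hlen G[p] (List.getElem_mem h)).1 h4
        exact ⟨⟨Y p, false, α, natBits S (i / B)⟩, rfl, by simp, fun _ =>
          ⟨h1, by simp, h3, fun _ => ⟨i, hi, h4, h5, rfl⟩⟩⟩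
      · exact ⟨⟨Y p, true, α, natBits S 0⟩, rfl, by simp, fun _ =>
          ⟨h1, fun _ => h2.1 rfl, h3, by simp⟩⟩
    · exact ⟨⟨Y p, false, false, natBits S 0⟩, rfl, by simp, fun h' => absurd h' h⟩
  choose R hRy hRw hR using hclaim
  -- The vertex for block `c`; the claims are reversed to match `Block.cells`.
  set w : ℕ → Block := fun c => ⟨natBits S c, ((List.range B).map fun q => R (c * B + q)).reverse⟩
    with hw
  have hwf : ∀ c, (w c).WF S B := fun c => ⟨by simp [hw], by simp [hw], by
    intro r hr
    simp only [hw, List.mem_reverse, List.mem_map] at hr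
    obtain ⟨q, -, rfl⟩ := hr
    exact hRw _⟩
  have hcells : ∀ c < 2 ^ S, ∀ J p, p < 2 ^ S * B → ((w c).cells J).getD p none =
      if p / B = c then (R p).cell J else none := by
    intro c hc J p hp
    rw [getD_cells (hwf c) J hp]
    have hq := Nat.mod_lt p hB
    have hdiv : p / B < 2 ^ S := Nat.div_lt_of_lt_mul (by rwa [mul_comm])
    by_cases h : p / B = c
    · have h1 : c * B + p % B = p := by rw [← h, mul_comm]; exact Nat.div_add_mod p B
      simp [hw, h, hq, h1]
    · rw [if_neg h, if_neg fun h' => h (natBits_injOn S hdiv hc h')]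
  have hex : ∀ c, ∃ u : Fin (2 ^ (S + B * (S + 3))), natBits (S + B * (S + 3)) u = (w c).bits := by
    intro c
    obtain ⟨n, hn, h⟩ := exists_natBits (w c).bits
    rw [Red.length_bits (hwf c)] at hn h
    exact ⟨⟨n, hn⟩, h⟩
  choose U hU using hex
  have hvertex : ∀ c, vertex S B (U c) = w c := by
    intro c
    rw [vertex, hU, Block.ofBits_bits (hwf c)]
  have hinj : Set.InjOn U (Finset.range (2 ^ S) : Set ℕ) := by
    intro c hc c' hc' h
    have : (w c).idx = (w c').idx := by rw [← hvertex, ← hvertex, h]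
    exact natBits_injOn S (by simpa using hc) (by simpa using hc') this
  refine ⟨(Finset.range (2 ^ S)).image U, by rw [Finset.card_image_of_injOn hinj]; simp, ?_⟩
  -- All cells come from the same assignment `Y`, so nothing is refuted; the case `c = c'` is needed
  -- because a conflict includes self-refutation.
  have href : ∀ c < 2 ^ S, ∀ c' < 2 ^ S, refutes G (w c) (w c') = false := by
    intro c hc c' hc'
    rw [refutes_eq_false_iff]
    intro p hp
    have hp' := hp.trans_le hG
    rw [hcells c hc _ p hp']
    split_ifs with h
    · rw [Claim.cell, GenGate.ok_iff]
      obtain ⟨h1, h2, h3, h4⟩ := hR p hp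
      have hl := hlen G[p] (List.getElem_mem hp)
      have hy : ∀ i x, i < 2 ^ S * B → ((w c').cells (w c').idx).getD i none = some x →
          x.1 = Y i := by
        intro i x hi hx
        rw [hcells c' hc' _ i hi] at hx
        split_ifs at hx
        rw [Claim.cell, Option.some.injEq] at hx
        rw [← hx]
        exact hRy i
      refine ⟨hRy p ▸ h1, fun i x hi hx => ?_, fun hA i x hi hx => ?_, fun hA hm => ?_⟩
      · rw [hy i x (hmark hl.2 hi) hx]
        exact h3 i hi
      · rw [hy i x (hmark hl.1 hi) hx]
        exact h2 hA i hi
      · obtain ⟨i, hi, h5, h6, h7⟩ := h4 hA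
        have hdiv : i / B < 2 ^ S := Nat.div_lt_of_lt_mul (by rwa [mul_comm])
        have h8 : i / B = c' := by
          refine natBits_injOn S hdiv hc' ?_
          rw [← h7]
          simpa using hm
        refine ⟨i, _, h5, by rw [hcells c' hc' _ i hi, if_pos h8, Claim.cell], ?_⟩
        rw [hRy i, h6]
    · rfl
  intro i hi j hj
  obtain ⟨c, hc, rfl⟩ := Finset.mem_image.1 hi
  obtain ⟨c', hc', rfl⟩ := Finset.mem_image.1 hj
  rw [Finset.mem_range] at hc hc'
  by_cases h : c = c'
  · simp [clash, h]
  · rw [clash, hvertex, hvertex, conflict, href c hc c hc, href c hc c' hc']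
    have : natBits S c ≠ natBits S c' := fun h' => h (natBits_injOn S hc hc' h')
    simp [hw, this]

end StackProg

/-! ### The Hamiltonian of a graph -/

namespace StackProg

/-- A term which is diagonal in the computational basis. -/
noncomputable def diagTerm {ℓ n m : ℕ} (hm : m ≤ ℓ) (site : Fin m ↪ Fin n) (D : Bits m → ℚ)
    (hD : ∀ x, |D x| ≤ 1) : LocalTerm ℓ n :=
  have h : complexMatrix (Matrix.diagonal D) 0 = Matrix.diagonal fun x => ((D x : ℚ) : ℂ) := by
    ext x y
    by_cases hxy : x = y
    · subst hxy
      simp [complexMatrix]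
    · simp [complexMatrix, hxy]
  { arity := m
    arity_le := hm
    site := site
    re := Matrix.diagonal D
    im := 0
    hermitian := by
      rw [h, Matrix.isHermitian_diagonal_iff]
      intro x
      simp [isSelfAdjoint_iff]
    norm_le := by
      open scoped Matrix.Norms.L2Operator in
      rw [h, Matrix.l2_opNorm_toEuclideanCLM, Matrix.l2_opNorm_diagonal,
        pi_norm_le_iff_of_nonneg zero_le_one]
      intro x
      have := hD x
      rw [Complex.norm_ratCast]
      exact_mod_cast this }

/-- Basis states that agree outside the sites and also on the sites are equal, so off-diagonal
entries of the extended operator vanish. -/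
theorem op_diagTerm {ℓ n m : ℕ} (hm : m ≤ ℓ) (site : Fin m ↪ Fin n) (D : Bits m → ℚ)
    (hD : ∀ x, |D x| ≤ 1) : (diagTerm hm site D hD).op =
      Matrix.diagonal fun x => (((D (x ∘ site) : ℚ) : ℝ) : ℂ) := by
  ext x y
  by_cases hxy : x = y
  · subst hxy
    simp [LocalTerm.op, diagTerm, complexMatrix]
    rfl
  · rw [Matrix.diagonal_apply_ne _ hxy, LocalTerm.op]
    split_ifs with h
    · have : x ∘ site ≠ y ∘ site := by
        intro h'
        refine hxy (funext fun q => ?_)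
        by_cases hq : q ∈ Set.range site
        · obtain ⟨i, rfl⟩ := hq
          exact congrFun h' i
        · exact h q hq
      have h2 : Matrix.diagonal D (x ∘ site) (y ∘ site) = 0 := Matrix.diagonal_apply_ne _ this
      simp only [complexMatrix, diagTerm, Matrix.zero_apply, Rat.cast_zero, zero_mul, add_zero,
        Rat.cast_eq_zero]
      exact h2
    · rfl

/-- The term `-1/2`. -/
noncomputable def constTerm (ℓ n : ℕ) : LocalTerm ℓ n :=
  diagTerm (m := 0) (Nat.zero_le ℓ) ⟨Fin.elim0, fun i => i.elim0⟩ (fun _ => -1 / 2)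
    (by intro x; norm_num [abs_div])

/-- The projection onto the states in which both qubits are one. -/
noncomputable def pairTerm {ℓ n : ℕ} (hℓ : 2 ≤ ℓ) (i j : Fin n) (h : i ≠ j) : LocalTerm ℓ n :=
  diagTerm (m := 2) hℓ ⟨![i, j], by
    intro a b hab
    fin_cases a <;> fin_cases b <;> simp_all [Ne.symm h]⟩
    (fun x => if x 0 = 1 ∧ x 1 = 1 then 1 else 0) (by intro x; split_ifs <;> norm_num)

theorem op_constTerm (ℓ n : ℕ) :
    (constTerm ℓ n).op = Matrix.diagonal fun _ => (((-1 / 2 : ℝ)) : ℂ) := by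
  rw [constTerm, op_diagTerm]
  push_cast
  rfl

theorem op_pairTerm {ℓ n : ℕ} (hℓ : 2 ≤ ℓ) (i j : Fin n) (h : i ≠ j) :
    (pairTerm hℓ i j h).op =
      Matrix.diagonal fun x => (((if x i = 1 ∧ x j = 1 then 1 else 0 : ℝ)) : ℂ) := by
  rw [pairTerm, op_diagTerm]
  congr 1
  funext x
  change (((if x i = 1 ∧ x j = 1 then 1 else 0 : ℚ) : ℝ) : ℂ) = _
  split_ifs <;> simp

/-- Code of the matrices of `pairTerm`. -/
def pairMatrixCode : List Bool :=
  encMatrix (Matrix.diagonal fun x : Bits 2 => (if x 0 = 1 ∧ x 1 = 1 then 1 else 0 : ℚ)) ++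
    encMatrix (0 : Matrix (Bits 2) (Bits 2) ℚ)

/-- Code of `constTerm`. -/
def constCode : List Bool :=
  encUnary 0 ++ (encMatrix (Matrix.diagonal fun _ : Bits 0 => (-1 / 2 : ℚ)) ++
    encMatrix (0 : Matrix (Bits 0) (Bits 0) ℚ))

/-- The code of the matrices does not depend on the qubits; the reduction contains it as a fixed
word and computes only the two positions. -/
theorem encode_pairTerm {ℓ n : ℕ} (hℓ : 2 ≤ ℓ) (i j : Fin n) (h : i ≠ j) :
    (pairTerm hℓ i j h).encode = pairCode pairMatrixCode i j := by
  simp [pairTerm, diagTerm, LocalTerm.encode, pairCode, pairMatrixCode, List.finRange_succ]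
  rfl

/-- The terms for the pairs of related vertices. -/
noncomputable def pairTerms {ℓ : ℕ} (hℓ : 2 ≤ ℓ) (n N : ℕ) (r : ℕ → ℕ → Bool) :
    List (LocalTerm ℓ n) :=
  (List.finRange n).reverse.flatMap fun i : Fin n => (List.finRange n).reverse.flatMap fun j : Fin n =>
    if h : i ≠ j then cond (r i j) (List.replicate N (pairTerm hℓ i j h)) [] else []

/-- The Hamiltonian of a graph. -/
noncomputable def graphHamiltonian {ℓ : ℕ} (hℓ : 2 ≤ ℓ) (n N : ℕ) (r : ℕ → ℕ → Bool) :
    LocalHamiltonian ℓ :=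
  ⟨n, List.replicate N (constTerm ℓ n) ++ pairTerms hℓ n N r⟩

/-- It links the terms of the Hamiltonian, in order, to the codes written by the program.
Irreflexivity is needed since `pairTerms` omits the diagonal while `allCodes` does not. -/
theorem map_encode_pairTerms {ℓ : ℕ} (hℓ : 2 ≤ ℓ) (n N : ℕ) {r : ℕ → ℕ → Bool}
    (hr : ∀ i, r i i = false) :
    (pairTerms hℓ n N r).map LocalTerm.encode = allCodes pairMatrixCode N r n n := by
  have h : List.range n = (List.finRange n).map Fin.val := List.map_coe_finRange_eq_range.symm
  simp only [pairTerms, allCodes, rowCodes, h, ← List.map_reverse, List.flatMap_map,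
    List.map_flatMap]
  congr 1
  funext i
  congr 1
  funext j
  by_cases hij : i = j
  · simp [hij, hr]
  · simp only [ne_eq, hij, not_false_eq_true, dite_true]
    cases r i j
    · simp
    · simp [encode_pairTerm]

theorem mem_pairTerms {ℓ : ℕ} {hℓ : 2 ≤ ℓ} {n N : ℕ} {r : ℕ → ℕ → Bool} {t : LocalTerm ℓ n} :
    t ∈ pairTerms hℓ n N r → ∃ i j : Fin n, ∃ h : i ≠ j, r i j = true ∧ t = pairTerm hℓ i j h := by
  intro ht
  simp only [pairTerms, List.mem_flatMap, List.mem_reverse, List.mem_finRange, true_and] at ht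
  obtain ⟨i, j, ht⟩ := ht
  split_ifs at ht with h
  · cases hr : r i j
    · simp [hr] at ht
    · rw [hr, cond_true] at ht
      exact ⟨i, j, h, hr, List.eq_of_mem_replicate ht⟩
  · simp at ht

theorem replicate_sublist_pairTerms {ℓ : ℕ} (hℓ : 2 ≤ ℓ) {n : ℕ} (N : ℕ) {r : ℕ → ℕ → Bool}
    {i j : Fin n} (h : i ≠ j) (hr : r i j = true) :
    (List.replicate N (pairTerm hℓ i j h)).Sublist (pairTerms hℓ n N r) := by
  refine List.Sublist.trans ?_ (List.sublist_flatten_of_mem (List.mem_map.2 ⟨i, by simp, rfl⟩))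
  refine List.Sublist.trans ?_ (List.sublist_flatten_of_mem (List.mem_map.2 ⟨j, by simp, rfl⟩))
  simp [h, hr]

/-- The energy of a basis state. -/
noncomputable def basisEnergy {ℓ : ℕ} (H : LocalHamiltonian ℓ) (x : Bits H.n) : ℝ :=
  (H.terms.map fun t => (t.op x x).re).sum

theorem op_eq_diagonal {ℓ : ℕ} (H : LocalHamiltonian ℓ)
    (h : ∀ t ∈ H.terms, ∃ D : Bits H.n → ℝ, t.op = Matrix.diagonal fun x => (D x : ℂ)) :
    H.op = Matrix.diagonal fun x => (basisEnergy H x : ℂ) := by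
  obtain ⟨n, terms⟩ := H
  simp only [LocalHamiltonian.op, basisEnergy] at h ⊢
  induction terms with
  | nil =>
    ext x y
    by_cases hxy : x = y <;> simp [Matrix.diagonal_apply, hxy]
  | cons t l ih =>
    obtain ⟨D, hD⟩ := h t (by simp)
    rw [List.map_cons, List.sum_cons, ih fun t ht => h t (by simp [ht]), hD, Matrix.diagonal_add]
    congr 1
    funext x
    simp [hD]

/-- For a diagonal operator the squared amplitudes are weights, so bounds on weight-`k` basis states
carry over to all weight-`k` states. -/
theorem energy_eq {ℓ : ℕ} (H : LocalHamiltonian ℓ)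
    (h : H.op = Matrix.diagonal fun x => (basisEnergy H x : ℂ))
    (ψ : EuclideanSpace ℂ (Bits H.n)) : H.energy ψ = ∑ x, basisEnergy H x * ‖ψ x‖ ^ 2 := by
  rw [LocalHamiltonian.energy, h, PiLp.inner_apply, Complex.re_sum]
  refine Finset.sum_congr rfl fun x _ => ?_
  rw [Matrix.ofLp_toEuclideanCLM, Matrix.mulVec_diagonal, RCLike.inner_apply, mul_assoc,
    Complex.mul_conj, Complex.normSq_eq_norm_sq]
  norm_cast

/-! ### Energies of independent and of conflicting sets -/

section

variable {ℓ : ℕ} (hℓ : 2 ≤ ℓ) {n : ℕ} (N : ℕ) {r : ℕ → ℕ → Bool}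

theorem op_graphHamiltonian : (graphHamiltonian hℓ n N r).op =
    Matrix.diagonal fun x => (basisEnergy (graphHamiltonian hℓ n N r) x : ℂ) := by
  refine op_eq_diagonal _ fun t ht => ?_
  rcases List.mem_append.1 ht with ht | ht
  · rw [List.eq_of_mem_replicate ht]
    exact ⟨_, op_constTerm ℓ n⟩
  · obtain ⟨i, j, h, -, rfl⟩ := mem_pairTerms ht
    exact ⟨_, op_pairTerm hℓ i j h⟩

theorem basisEnergy_graphHamiltonian (x : Bits n) :
    basisEnergy (graphHamiltonian hℓ n N r) x =
      -(N / 2 : ℝ) + ((pairTerms hℓ n N r).map fun t => (t.op x x).re).sum := by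
  have : ((constTerm ℓ n).op x x).re = -1 / 2 := by
    rw [op_constTerm, Matrix.diagonal_apply_eq, Complex.ofReal_re]
  simp only [basisEnergy, graphHamiltonian, List.map_append, List.sum_append, List.map_replicate,
    List.sum_replicate, this, nsmul_eq_mul]
  ring

theorem basisEnergy_independent (x : Bits n)
    (h : ∀ i j : Fin n, x i = 1 → x j = 1 → r i j = false) :
    basisEnergy (graphHamiltonian hℓ n N r) x = -(N / 2 : ℝ) := by
  rw [basisEnergy_graphHamiltonian, List.sum_eq_zero, add_zero]
  intro e he
  obtain ⟨t, ht, rfl⟩ := List.mem_map.1 he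
  obtain ⟨i, j, hij, hr, rfl⟩ := mem_pairTerms ht
  rw [op_pairTerm, Matrix.diagonal_apply_eq, Complex.ofReal_re, if_neg]
  rintro ⟨h1, h2⟩
  simp [h i j h1 h2] at hr

/-- All pair terms are nonnegative on basis states, so it suffices to keep the `N` copies for one
violated pair, which raise the constant `-N/2` to `N/2`. -/
theorem le_basisEnergy (x : Bits n) {i j : Fin n} (hij : i ≠ j) (hi : x i = 1) (hj : x j = 1)
    (hr : r i j = true) : (N / 2 : ℝ) ≤ basisEnergy (graphHamiltonian hℓ n N r) x := by
  rw [basisEnergy_graphHamiltonian]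
  have h1 := (replicate_sublist_pairTerms hℓ N hij hr).map fun t => (t.op x x).re
  have h2 := h1.sum_le_sum fun e he => by
    obtain ⟨t, ht, rfl⟩ := List.mem_map.1 he
    obtain ⟨i, j, hij, hr, rfl⟩ := mem_pairTerms ht
    rw [op_pairTerm, Matrix.diagonal_apply_eq, Complex.ofReal_re]
    split_ifs <;> norm_num
  have h3 : ((pairTerm hℓ i j hij).op x x).re = 1 := by
    rw [op_pairTerm, Matrix.diagonal_apply_eq, Complex.ofReal_re, if_pos ⟨hi, hj⟩]
  simp only [List.map_replicate, List.sum_replicate, h3, nsmul_eq_mul, mul_one] at h2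
  linarith

/-- An independent set of `k` vertices gives a state of weight `k` and low energy. -/
theorem exists_energy_eq (T : Finset (Fin n)) (h : ∀ i ∈ T, ∀ j ∈ T, r i j = false) :
    ∃ ψ : EuclideanSpace ℂ (Bits n), IsWeightState T.card ψ ∧
      (graphHamiltonian hℓ n N r).energy ψ = -(N / 2 : ℝ) := by
  classical
  set x : Bits n := fun i => if i ∈ T then 1 else 0 with hx
  have hx1 : ∀ i, x i = 1 ↔ i ∈ T := fun i => by by_cases hi : i ∈ T <;> simp [hx, hi]
  refine ⟨EuclideanSpace.single x 1, ⟨by simp, fun y hy => ?_⟩, ?_⟩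
  · rw [PiLp.single_apply, if_neg]
    rintro rfl
    exact hy (congrArg Finset.card (by ext i; simp [hx1]))
  · refine (energy_eq _ (op_graphHamiltonian hℓ N) _).trans ?_
    change ∑ y : Bits n, basisEnergy (graphHamiltonian hℓ n N r) y *
      ‖EuclideanSpace.single x (1 : ℂ) y‖ ^ 2 = _
    rw [Finset.sum_eq_single x]
    · rw [basisEnergy_independent hℓ N x fun i j hi hj =>
        h i ((hx1 i).1 hi) j ((hx1 j).1 hj)]
      simp
    · intro y _ hy
      simp [PiLp.single_apply, hy]
    · simp

/-- All states of weight `k` have a high energy if there is no independent set of `k` vertices. -/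
theorem le_energy {k : ℕ} (hr : ∀ i, r i i = false)
    (h : ∀ T : Finset (Fin n), T.card = k → ∃ i ∈ T, ∃ j ∈ T, r i j = true)
    (ψ : EuclideanSpace ℂ (Bits n)) (hψ : IsWeightState k ψ) :
    (N / 2 : ℝ) ≤ (graphHamiltonian hℓ n N r).energy ψ := by
  refine le_of_le_of_eq ?_ (energy_eq _ (op_graphHamiltonian hℓ N) _).symm
  change _ ≤ ∑ x : Bits n, basisEnergy (graphHamiltonian hℓ n N r) x * ‖ψ x‖ ^ 2
  have h1 : ∑ x, ‖ψ x‖ ^ 2 = 1 := by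
    rw [← EuclideanSpace.norm_sq_eq, hψ.1, one_pow]
  calc (N / 2 : ℝ) = ∑ x, (N / 2 : ℝ) * ‖ψ x‖ ^ 2 := by rw [← Finset.mul_sum, h1, mul_one]
    _ ≤ _ := by
      refine Finset.sum_le_sum fun x _ => ?_
      by_cases hx : (Finset.univ.filter fun i => x i = 1).card = k
      · obtain ⟨i, hi, j, hj, hij⟩ := h _ hx
        refine mul_le_mul_of_nonneg_right (le_basisEnergy hℓ N x ?_ (by simpa using hi)
          (by simpa using hj) hij) (by positivity)
        rintro rfl
        simp [hr] at hij
      · simp [hψ.2 x hx]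

theorem length_terms_le (hr : ∀ i, r i i = false) :
    (graphHamiltonian hℓ n N r).terms.length ≤ N + n * (n * N) := by
  have := congrArg List.length (map_encode_pairTerms hℓ n N hr)
  rw [List.length_map] at this
  simp only [graphHamiltonian, List.length_append, List.length_replicate, this]
  have := length_allCodes_le pairMatrixCode N r n n
  omega

end

end StackProg

/-! ### Correctness and running time of the reduction -/

namespace StackProg

/-- The number of bits of the partial assignments for `W` wires. -/
def bitCount (S W : ℕ) : ℕ := S + blockSize S W * (S + 3)

/-- The number of wires of a circuit, including one for the requirement that it accepts. -/
def wireCount (C : BoolCircuit) : ℕ := C.inputs + C.size + 1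

theorem one_le_blockSize (S : ℕ) {W : ℕ} (hW : 1 ≤ W) : 1 ≤ blockSize S W := by
  have := le_blockSize S W
  by_contra h
  rw [Nat.lt_one_iff.1 (not_le.1 h)] at this
  omega

theorem clash_self (G : List GenGate) (S B i : ℕ) : clash G S B i i = false := by
  simp [clash]

/-- The number of terms of the Hamiltonian as a function of the number of qubits. -/
noncomputable def termPoly (d : ℕ) : Polynomial ℕ := Polynomial.X ^ d + Polynomial.X ^ (d + 2)

/-! ### The instance built from a circuit, and its correctness -/

section

variable {ℓ : ℕ} (hℓ : 2 ≤ ℓ) (d : ℕ) (C : BoolCircuit) (S : ℕ)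

/-- The Hamiltonian to which a circuit is reduced. -/
noncomputable def reductionHamiltonian : LocalHamiltonian ℓ :=
  graphHamiltonian hℓ (2 ^ bitCount S (wireCount C)) ((2 ^ bitCount S (wireCount C)) ^ d)
    (clash (genGates C) S (blockSize S (wireCount C)))

theorem length_reductionHamiltonian : (reductionHamiltonian hℓ d C S).terms.length ≤
    (termPoly d).eval (reductionHamiltonian hℓ d C S).n := by
  refine (length_terms_le hℓ _ (clash_self _ _ _)).trans (le_of_eq ?_)
  simp only [termPoly, reductionHamiltonian, graphHamiltonian, Polynomial.eval_add,
    Polynomial.eval_pow, Polynomial.eval_X]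
  ring

/-- The instance to which a circuit is reduced. -/
noncomputable def reductionInst (a b : ℕ → ℝ) : (weightLocalHamiltonian ℓ (termPoly d) a b).Inst :=
  (⟨reductionHamiltonian hℓ d C S, length_reductionHamiltonian hℓ d C S⟩, 2 ^ S)

/-- The word written by the program is literally the code of the instance, so the guarantees for the
given algorithm apply to it. -/
theorem encode_reductionInst (a b : ℕ → ℝ) :
    (weightLocalHamiltonian ℓ (termPoly d) a b).encode (reductionInst hℓ d C S a b) =
      Red.programOutput d pairMatrixCode constCode (genGates C) S (blockSize S (wireCount C)) := by
  have h : (reductionHamiltonian hℓ d C S).terms.map LocalTerm.encode =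
      Red.termCodes d pairMatrixCode constCode (genGates C) S (blockSize S (wireCount C)) := by
    refine List.map_append.trans (congrArg₂ (· ++ ·) ?_ ?_)
    · exact List.map_replicate
    · exact map_encode_pairTerms hℓ _ _ (clash_self _ _ _)
  have hl := congrArg List.length h
  rw [List.length_map] at hl
  change encUnary (2 ^ S) ++ (encUnary (2 ^ bitCount S (wireCount C)) ++
    (encUnary (reductionHamiltonian hℓ d C S).terms.length ++
      (reductionHamiltonian hℓ d C S).terms.flatMap LocalTerm.encode)) = _
  rw [List.flatMap_def, h, hl]
  rfl

theorem wires_le : (genGates C).length ≤ 2 ^ S * blockSize S (wireCount C) ∧ ∀ g ∈ genGates C,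
    g.fst.length ≤ 2 ^ S * blockSize S (wireCount C) ∧
      g.snd.length ≤ 2 ^ S * blockSize S (wireCount C) := by
  have h := le_blockSize S (wireCount C)
  have hlen : (genGates C).length = wireCount C := by simp [genGates, wireCount]; omega
  refine ⟨hlen ▸ h, fun g hg => ?_⟩
  have := length_marks_le C hg
  simp only [wireCount] at h ⊢
  omega

/-- Compatible vertices give energy `-n ^ d / 2`, which is at most `a n` because of the bound on its
absolute value; that bound is only available for `n ≥ 2`, which holds as `n` is a positive power of
two. -/
theorem reductionInst_mem_yes {a b : ℕ → ℝ} {S : ℕ} (hS : 1 ≤ S)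
    (ha : ∀ n : ℕ, 2 ≤ n → |a n| ≤ (n : ℝ) ^ d / 2) (hC : C.Satisfiable) :
    reductionInst hℓ d C S a b ∈ (weightLocalHamiltonian ℓ (termPoly d) a b).yes := by
  obtain ⟨Y, hY⟩ := (satisfiable_iff C).1 hC
  obtain ⟨h1, h2⟩ := wires_le C S
  obtain ⟨T, hT, hr⟩ : ∃ T : Finset (Fin (2 ^ bitCount S (wireCount C))), T.card = 2 ^ S ∧
      ∀ i ∈ T, ∀ j ∈ T, clash (genGates C) S (blockSize S (wireCount C)) i j = false :=
    clash_of_holds (one_le_blockSize S (by simp [wireCount])) h1 h2 hY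
  obtain ⟨ψ, hψ, he⟩ := exists_energy_eq hℓ (n := 2 ^ bitCount S (wireCount C))
    ((2 ^ bitCount S (wireCount C)) ^ d) T hr
  rw [hT] at hψ
  refine ⟨ψ, hψ, he.trans_le ?_⟩
  have hn : 2 ≤ 2 ^ bitCount S (wireCount C) :=
    Nat.le_self_pow (by simp only [bitCount]; omega) 2
  have := (abs_le.1 (ha _ hn)).1
  push_cast at this ⊢
  exact this

/-- Without a satisfying input every set of `2 ^ S` vertices contains a conflict, so all energies
are at least `n ^ d / 2`. The condition `1 ≤ S` enters through `holds_of_clash`. -/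
theorem reductionInst_mem_no {a b : ℕ → ℝ} {S : ℕ} (hS : 1 ≤ S)
    (hb : ∀ n : ℕ, 2 ≤ n → |b n| ≤ (n : ℝ) ^ d / 2) (hC : ¬ C.Satisfiable) :
    reductionInst hℓ d C S a b ∈ (weightLocalHamiltonian ℓ (termPoly d) a b).no := by
  intro ψ hψ
  obtain ⟨h1, h2⟩ := wires_le C S
  refine le_trans ?_ (le_energy hℓ (n := 2 ^ bitCount S (wireCount C))
    ((2 ^ bitCount S (wireCount C)) ^ d) (clash_self _ _ _) (fun T hT => ?_) ψ hψ)
  · have hn : 2 ≤ 2 ^ bitCount S (wireCount C) :=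
      Nat.le_self_pow (by simp only [bitCount]; omega) 2
    have := (abs_le.1 (hb _ hn)).2
    push_cast at this ⊢
    exact this
  · by_contra h
    push Not at h
    exact hC ((satisfiable_iff C).2 (holds_of_clash hS (one_le_blockSize S (by simp [wireCount]))
      h1 h2 T hT fun i hi j hj => by simpa using h i hi j hj))

end

/-! ### Size estimates for the reduction -/

theorem length_flatten_le {α : Type*} {l : List (List α)} {K : ℕ} (h : ∀ x ∈ l, x.length ≤ K) :
    l.flatten.length ≤ l.length * K := by
  induction l with
  | nil => simp
  | cons x l ih =>
    have h1 := h x (by simp)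
    have h2 := ih fun x hx => h x (by simp [hx])
    rw [List.flatten_cons, List.length_append, List.length_cons, Nat.succ_mul]
    omega

theorem length_termCodes_le (d : ℕ) (c c₀ : List Bool) (G : List GenGate) (S B : ℕ) :
    (Red.termCodes d c c₀ G S B).length ≤ (2 ^ (S + B * (S + 3))) ^ d +
      2 ^ (S + B * (S + 3)) * (2 ^ (S + B * (S + 3)) * (2 ^ (S + B * (S + 3))) ^ d) := by
  simp only [Red.termCodes, List.length_append, List.length_replicate]
  have := length_allCodes_le c ((2 ^ (S + B * (S + 3))) ^ d) (clash G S B)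
    (2 ^ (S + B * (S + 3))) (2 ^ (S + B * (S + 3)))
  omega

theorem length_programOutput_le (d : ℕ) (c c₀ : List Bool) (G : List GenGate) (S B : ℕ) :
    (Red.programOutput d c c₀ G S B).length ≤ 2 * 2 ^ (S + B * (S + 3)) + 3 +
      (Red.termCodes d c c₀ G S B).length *
        (2 * 2 ^ (S + B * (S + 3)) + (c.length + c₀.length) + 6) := by
  have h1 : ∀ x ∈ Red.termCodes d c c₀ G S B,
      x.length ≤ 2 * 2 ^ (S + B * (S + 3)) + (c.length + c₀.length) + 5 := by
    intro x hx
    rcases List.mem_append.1 hx with hx | hx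
    · rw [List.eq_of_mem_replicate hx]
      omega
    · simp only [allCodes, rowCodes, List.mem_flatMap, List.mem_reverse, List.mem_range] at hx
      obtain ⟨i, hi, j, hj, hx⟩ := hx
      cases hr : clash G S B i j
      · simp [hr] at hx
      · rw [hr, cond_true] at hx
        rw [List.eq_of_mem_replicate hx]
        simp [pairCode, encUnary]
        omega
  have h2 := length_flatten_le h1
  have h3 : 2 ^ S ≤ 2 ^ (S + B * (S + 3)) := Nat.pow_le_pow_right (by omega) (by omega)
  simp only [Red.programOutput, encUnary, List.length_append, List.length_replicate,
    List.length_singleton]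
  have h4 := Nat.mul_succ (Red.termCodes d c c₀ G S B).length
    (2 * 2 ^ (S + B * (S + 3)) + (c.length + c₀.length) + 5)
  simp only [Nat.succ_eq_add_one, Nat.add_assoc, Nat.reduceAdd] at h2 h4 ⊢
  omega

theorem length_encode_circuit_le (C : BoolCircuit) :
    C.encode.length ≤ wireCount C * (2 * wireCount C + 12) := by
  have h : ∀ i : Fin C.size, (C.gate i).encode.length ≤ 2 * wireCount C + 9 := by
    intro i
    have hi := i.2
    simp only [wireCount]
    cases C.gate i with
    | unary f a => have := a.2; simp [BoolGate.encode, encUnary]; omega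
    | binary f a b => have := a.2; have := b.2; simp [BoolGate.encode, encUnary]; omega
    | bigAnd T => simp [BoolGate.encode, BoolGate.encSet]; omega
    | bigOr T => simp [BoolGate.encode, BoolGate.encSet]; omega
    | toffoli T t => have := t.2; simp [BoolGate.encode, BoolGate.encSet, encUnary]; omega
  have h1 := length_flatten_le (l := (List.finRange C.size).map fun i => (C.gate i).encode)
    (K := 2 * wireCount C + 9) (by simpa using h)
  have h2 := C.output.2
  rw [← List.flatMap_def, List.length_map, List.length_finRange] at h1
  simp only [BoolCircuit.encode, encUnary, List.length_append, List.length_replicate,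
    List.length_singleton]
  have h3 : C.size * (2 * wireCount C + 9) ≤ wireCount C * (2 * wireCount C + 9) :=
    Nat.mul_le_mul_right _ (by simp only [wireCount]; omega)
  have h4 : wireCount C = C.inputs + C.size + 1 := rfl
  have h5 : wireCount C * (2 * wireCount C + 12) =
    wireCount C * (2 * wireCount C + 9) + 3 * wireCount C := by ring
  omega

/-- A polynomial is bounded by a power. -/
theorem exists_eval_le_pow (p : Polynomial ℕ) : ∃ k, ∀ n : ℕ, 2 ≤ n → p.eval n ≤ n ^ k := by
  induction p using Polynomial.induction_on' with
  | add p q hp hq =>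
    obtain ⟨i, hi⟩ := hp
    obtain ⟨j, hj⟩ := hq
    refine ⟨i + j + 1, fun n hn => ?_⟩
    have h1 : n ^ i ≤ n ^ (i + j) := Nat.pow_le_pow_right (by omega) (by omega)
    have h2 : n ^ j ≤ n ^ (i + j) := Nat.pow_le_pow_right (by omega) (by omega)
    have h3 : 2 * n ^ (i + j) ≤ n * n ^ (i + j) := Nat.mul_le_mul_right _ hn
    have := hi n hn
    have := hj n hn
    rw [Polynomial.eval_add, pow_succ']
    omega
  | monomial m c =>
    -- The coefficient is absorbed by `c ≤ 2 ^ c ≤ n ^ c`.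
    refine ⟨c + m, fun n hn => ?_⟩
    rw [Polynomial.eval_monomial, pow_add]
    exact Nat.mul_le_mul_right _ (Nat.lt_two_pow_self.le.trans (Nat.pow_le_pow_left hn c))

theorem eval_mono (p : Polynomial ℕ) {m n : ℕ} (h : m ≤ n) : p.eval m ≤ p.eval n := by
  induction p using Polynomial.induction_on' with
  | add p q hp hq =>
    rw [Polynomial.eval_add, Polynomial.eval_add]
    exact Nat.add_le_add hp hq
  | monomial i c =>
    rw [Polynomial.eval_monomial, Polynomial.eval_monomial]
    exact Nat.mul_le_mul_left _ (Nat.pow_le_pow_left h i)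

end StackProg

/-! ### The quantum algorithm for satisfiability -/

namespace StackProg

open Cmd

theorem TM2OutputsInTime.mono {tm : Turing.FinTM2} {x : List (tm.Γ tm.k₀)}
    {y : Option (List (tm.Γ tm.k₁))} {m n : ℕ} (hmn : m ≤ n)
    (h : Nonempty (Turing.TM2OutputsInTime tm x y m)) :
    Nonempty (Turing.TM2OutputsInTime tm x y n) := by
  obtain ⟨h⟩ := h
  exact ⟨⟨h.toEvalsTo, h.steps_le_m.trans hmn⟩⟩

/-- The size of the reduction with `2 ^ (s + 1)` blocks. -/
def sizeBound (f : ℕ → ℕ) (C : BoolCircuit) (s : ℕ) : ℕ :=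
  2 + f (2 ^ (s + 1)) + wireCount C + 2 ^ bitCount (s + 1) (wireCount C) + s

theorem sizeBound_spec (f : ℕ → ℕ) (C : BoolCircuit) (s : ℕ) : 2 ≤ sizeBound f C s ∧
    s ≤ sizeBound f C s ∧ f (2 ^ (s + 1)) ≤ sizeBound f C s ∧ wireCount C ≤ sizeBound f C s ∧
      2 ^ bitCount (s + 1) (wireCount C) ≤ sizeBound f C s := by
  simp only [sizeBound]
  generalize 2 ^ bitCount (s + 1) (wireCount C) = n
  omega

/-- The property `P` will be acceptance or rejection of the circuit. It holds for the circuits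
obtained from all `s`, so it does not matter which attempt of the dovetailing succeeds first, while
the time is governed by any chosen `s`. -/
theorem exists_solver (d : ℕ) (A : QuantumAlgorithm) (f : ℕ → ℕ) (p : Polynomial ℕ) :
    ∃ (D : QuantumAlgorithm) (k : ℕ), ∀ (C : BoolCircuit) (P : QCircuit → Prop),
      (∀ s, ∃ Q, A.ProducesInTime (Red.programOutput d pairMatrixCode constCode (genGates C) (s + 1)
        (blockSize (s + 1) (wireCount C))) Q (f (2 ^ (s + 1)) * p.eval (Red.programOutput d
          pairMatrixCode constCode (genGates C) (s + 1)
            (blockSize (s + 1) (wireCount C))).length) ∧ P Q) →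
      ∀ s t, sizeBound f C s ^ k ≤ t → ∃ Q, D.ProducesInTime C.encode Q t ∧ P Q := by
  obtain ⟨tm, e, o, c₁, hpipe⟩ := exists_pipe (Red.program d pairMatrixCode constCode)
    (inp := .inp) (out := .out) (tmp := .t1) (by decide) (bit := Sym.bit) (dec := Sym.toBit)
    (fun _ => rfl) {} A
  obtain ⟨D, c₂, hD⟩ := Dove.exists_dovetail tm e o
  set κ := pairMatrixCode.length + constCode.length with hκ
  -- In terms of `sizeBound`, the polynomials bound the number of terms (`pT`), the length of the
  -- instance (`pY`), the iterations of all loops including the run of `A` (`pM`), and the total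
  -- time (`pA`).
  set pT : Polynomial ℕ := .X ^ d + .X * (.X * .X ^ d) with hpT
  set pY : Polynomial ℕ := 2 * .X + 3 + pT * (2 * .X + .C κ + 6) with hpY
  set pM : Polynomial ℕ := .X + .X ^ d + .X * (2 * .X + 3) + pT + pY + .X * p.comp pY with hpM
  set pA : Polynomial ℕ := (.X + (pM + 2) ^ c₁ + .X * (2 * .X + 12) + 2) ^ c₂ with hpA
  obtain ⟨k, hk⟩ := exists_eval_le_pow pA
  refine ⟨D, k, fun C P hA s₀ t ht => ?_⟩
  choose Q hQ hP using hA
  have hout : ∀ s, Outputs tm ((encUnary s ++ C.encode).map e) ((Q s).encode.map o.symm)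
      ((pM.eval (sizeBound f C s) + 2) ^ c₁) := by
    intro s
    obtain ⟨-, -, hZf, hZw, hZn⟩ := sizeBound_spec f C s
    set Z := sizeBound f C s with hZ
    set B := blockSize (s + 1) (wireCount C) with hB
    have hn : 2 ^ (s + 1 + B * (s + 1 + 3)) ≤ Z := hZn
    have hN := Nat.pow_le_pow_left hn d
    have hT : (Red.termCodes d pairMatrixCode constCode (genGates C) (s + 1) B).length ≤
        pT.eval Z := by
      refine (length_termCodes_le _ _ _ _ _ _).trans ?_
      simp only [hpT, Polynomial.eval_add, Polynomial.eval_mul, Polynomial.eval_pow,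
        Polynomial.eval_X]
      gcongr
    have hY : (Red.programOutput d pairMatrixCode constCode (genGates C) (s + 1) B).length ≤
        pY.eval Z := by
      refine (length_programOutput_le _ _ _ _ _ _).trans ?_
      simp only [hpY, Polynomial.eval_add, Polynomial.eval_mul, Polynomial.eval_C,
        Polynomial.eval_X, Polynomial.eval_ofNat]
      gcongr
    have hM : pM.eval Z = Z + Z ^ d + Z * (2 * Z + 3) + pT.eval Z + pY.eval Z +
        Z * p.eval (pY.eval Z) := by
      simp only [hpM, Polynomial.eval_add, Polynomial.eval_mul, Polynomial.eval_pow,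
        Polynomial.eval_X, Polynomial.eval_comp, Polynomial.eval_ofNat]
    have hMle : Z ≤ pM.eval Z ∧ Z ^ d ≤ pM.eval Z ∧ Z * (2 * Z + 3) ≤ pM.eval Z ∧
        pT.eval Z ≤ pM.eval Z ∧ pY.eval Z ≤ pM.eval Z ∧ Z * p.eval (pY.eval Z) ≤ pM.eval Z := by
      rw [hM]
      generalize Z ^ d = m
      omega
    obtain ⟨hM1, hM2, hM3, hM4, hM5, hM6⟩ := hMle
    have hG := length_encode_genGates_le C
    have hG' : (C.inputs + C.size + 1) * (2 * (C.inputs + C.size) + 3) ≤ Z * (2 * Z + 3) := by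
      have : C.inputs + C.size + 1 ≤ Z := hZw
      gcongr
      · omega
    have hf : f (2 ^ (s + 1)) * p.eval (Red.programOutput d pairMatrixCode constCode (genGates C)
        (s + 1) B).length ≤ Z * p.eval (pY.eval Z) :=
      Nat.mul_le_mul hZf (eval_mono p hY)
    exact hpipe (pM.eval Z) _ {} _ _ _ (Red.exec_program d _ _ C s (S := s + 1)
      (W := wireCount C) rfl rfl hB rfl (hn.trans hM1) (hN.trans hM2) (hZw.trans hM1)
      (hG.trans (hG'.trans hM3)) (hT.trans hM4)) (hQ s) (hY.trans hM5) (hf.trans hM6)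
  obtain ⟨s, hs⟩ := hD C.encode (fun s => (Q s).encode) _ hout s₀
  refine ⟨Q s, TM2OutputsInTime.mono ?_ hs, hP s⟩
  obtain ⟨hZ2, hZs, -, hZw, -⟩ := sizeBound_spec f C s₀
  set Z := sizeBound f C s₀ with hZ
  refine le_trans ?_ ((hk Z hZ2).trans ht)
  simp only [hpA, Polynomial.eval_add, Polynomial.eval_mul, Polynomial.eval_pow, Polynomial.eval_X,
    Polynomial.eval_ofNat]
  have hx : C.encode.length ≤ Z * (2 * Z + 12) := by
    refine (length_encode_circuit_le C).trans ?_
    gcongr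
  refine Nat.pow_le_pow_left ?_ c₂
  gcongr

/-- A bound on the size of the reduction for circuits of description size `m`. -/
def sizeBound' (f : ℕ → ℕ) (m s : ℕ) : ℕ :=
  2 + f (2 ^ (s + 1)) + (2 * m + 1) +
    2 ^ (s + 1 + ((2 * m + 1) / 2 ^ (s + 1) + 1) * (s + 1 + 3)) + s

theorem one_le_sizeBound' (f : ℕ → ℕ) (m s : ℕ) : 1 ≤ sizeBound' f m s := by
  simp only [sizeBound']
  generalize 2 ^ (s + 1 + ((2 * m + 1) / 2 ^ (s + 1) + 1) * (s + 1 + 3)) = n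
  omega

theorem sizeBound_le (f : ℕ → ℕ) (C : BoolCircuit) (s : ℕ) :
    sizeBound f C s ≤ sizeBound' f C.descriptionSize s := by
  have h1 : wireCount C ≤ 2 * C.descriptionSize + 1 := by
    simp only [wireCount, BoolCircuit.descriptionSize]
    omega
  have h2 : bitCount (s + 1) (wireCount C) ≤
      s + 1 + ((2 * C.descriptionSize + 1) / 2 ^ (s + 1) + 1) * (s + 1 + 3) := by
    have := (blockSize_le (s + 1) (wireCount C)).trans
      (Nat.succ_le_succ (Nat.div_le_div_right (c := 2 ^ (s + 1)) h1))
    exact Nat.add_le_add_left (Nat.mul_le_mul_right _ this) _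
  have h3 := Nat.pow_le_pow_right (n := 2) (by omega) h2
  simp only [sizeBound, sizeBound']
  omega

/-- For fixed `s` the only summand linear in `m` has the factor `(s + 4) / 2 ^ (s + 1)`, which
becomes arbitrarily small for large `s`; however fast `f` grows, it only affects the constant. -/
theorem logb_sizeBound'_le (f : ℕ → ℕ) (m s : ℕ) : Real.logb 2 (sizeBound' f m s) ≤
    Real.logb 2 (5 + f (2 ^ (s + 1)) + s) + Real.logb 2 (m + 2) + (2 * s + 5) +
      (2 * m + 1) * ((s + 4) / 2 ^ (s + 1)) := by
  set E := s + 1 + ((2 * m + 1) / 2 ^ (s + 1) + 1) * (s + 1 + 3) with hE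
  -- The constant `5` is `2 + 3`: up to two units of `(m + 2) * 2 ^ E` bound `2 * m + 1`, and one
  -- bounds `2 ^ E`.
  have h1 : sizeBound' f m s ≤ (5 + f (2 ^ (s + 1)) + s) * ((m + 2) * 2 ^ E) := by
    have hp : 1 ≤ 2 ^ E := Nat.one_le_two_pow
    have h2 : 2 ^ E ≤ (m + 2) * 2 ^ E := Nat.le_mul_of_pos_left _ (by omega)
    have h3 : m + 2 ≤ (m + 2) * 2 ^ E := Nat.le_mul_of_pos_right _ (by omega)
    have h4 : (2 + f (2 ^ (s + 1)) + s) * 1 ≤ (2 + f (2 ^ (s + 1)) + s) * ((m + 2) * 2 ^ E) :=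
      Nat.mul_le_mul_left _ (by omega)
    have h5 : (5 + f (2 ^ (s + 1)) + s) * ((m + 2) * 2 ^ E) =
      (2 + f (2 ^ (s + 1)) + s) * ((m + 2) * 2 ^ E) + 3 * ((m + 2) * 2 ^ E) := by ring
    simp only [sizeBound', ← hE]
    omega
  have h2 : (sizeBound' f m s : ℝ) ≤
      (5 + f (2 ^ (s + 1)) + s) * ((m + 2) * 2 ^ E) := by exact_mod_cast h1
  have h3 : (0 : ℝ) < sizeBound' f m s := by
    exact_mod_cast one_le_sizeBound' f m s
  have h4 := Real.logb_le_logb_of_le (b := 2) (by norm_num) h3 h2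
  rw [Real.logb_mul (by positivity) (by positivity), Real.logb_mul (by positivity) (by positivity),
    Real.logb_pow, Real.logb_self_eq_one (by norm_num), mul_one] at h4
  have h5 : (((2 * m + 1) / 2 ^ (s + 1) : ℕ) : ℝ) ≤ (2 * m + 1) / 2 ^ (s + 1) := by
    have := Nat.cast_div_le (α := ℝ) (m := 2 * m + 1) (n := 2 ^ (s + 1))
    push_cast at this
    exact this
  have h6 : (E : ℝ) ≤ (2 * s + 5) + (2 * m + 1) * ((s + 4) / 2 ^ (s + 1)) := by
    have h7 : (E : ℝ) = s + 1 + ((((2 * m + 1) / 2 ^ (s + 1) : ℕ) : ℝ) + 1) * (s + 4) := by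
      rw [hE]
      push_cast
      ring
    rw [h7]
    have h8 : (2 * m + 1 : ℝ) * ((s + 4) / 2 ^ (s + 1)) = (2 * m + 1) / 2 ^ (s + 1) * (s + 4) := by
      ring
    rw [h8]
    have h9 := mul_le_mul_of_nonneg_right h5 (show (0 : ℝ) ≤ s + 4 by positivity)
    linarith
  linarith

/-- A function with such bounds for all `s` is subexponential. -/
theorem isSubexponential_pow (f : ℕ → ℕ) (k : ℕ) {Z : ℕ → ℕ} (h0 : ∀ m, 1 ≤ Z m)
    (hZ : ∀ m s, Z m ≤ sizeBound' f m s) : IsSubexponential fun m => Z m ^ k := by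
  refine ⟨fun m => k * Real.logb 2 (Z m), ?_, fun m => ?_⟩
  · refine Asymptotics.IsLittleO.const_mul_left ?_ _
    rw [Asymptotics.isLittleO_iff]
    intro c hc
    have hlim : Filter.Tendsto (fun s : ℕ => ((s : ℝ) + 4) / 2 ^ (s + 1)) Filter.atTop (nhds 0) := by
      have h1 := tendsto_pow_const_div_const_pow_of_one_lt 1 (r := (2 : ℝ)) (by norm_num)
      have h2 := tendsto_pow_const_div_const_pow_of_one_lt 0 (r := (2 : ℝ)) (by norm_num)
      have h3 := (h1.const_mul (1 / 2)).add (h2.const_mul 2)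
      simp only [mul_zero, add_zero] at h3
      refine h3.congr fun s => ?_
      rw [pow_succ]
      field_simp
      ring
    -- Given `c`, one `s` is fixed with linear coefficient below `c / 8`. Then `(2 * m + 1) * (c /
    -- 8)` is `c / 4 * m` plus a constant put into `K`, and the logarithm and `K` are eventually
    -- below `c / 2 * m`.
    obtain ⟨s, hs⟩ := (hlim.eventually_lt_const (show (0 : ℝ) < c / 8 by positivity)).exists
    set K : ℝ := Real.logb 2 (5 + f (2 ^ (s + 1)) + s) + (2 * s + 5) + c / 8 with hK
    have hlog : (fun m : ℕ => Real.logb 2 ((m : ℝ) + 2) + K) =o[Filter.atTop]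
        fun m : ℕ => (m : ℝ) := by
      refine Asymptotics.IsLittleO.add ?_ ?_
      · have h1 : (fun m : ℕ => Real.log ((m : ℝ) + 2)) =o[Filter.atTop]
            fun m : ℕ => (m : ℝ) + 2 :=
          Real.isLittleO_log_id_atTop.comp_tendsto
            (Filter.tendsto_atTop_add_const_right _ 2 tendsto_natCast_atTop_atTop)
        have h2 : (fun m : ℕ => (m : ℝ) + 2) =O[Filter.atTop] fun m : ℕ => (m : ℝ) := by
          refine Asymptotics.IsBigO.of_bound 3 ?_
          filter_upwards [Filter.eventually_ge_atTop 1] with m hm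
          have : (1 : ℝ) ≤ m := by exact_mod_cast hm
          rw [Real.norm_of_nonneg (by positivity), Real.norm_of_nonneg (by positivity)]
          linarith
        have h3 := (h1.trans_isBigO h2).const_mul_left (Real.log 2)⁻¹
        refine h3.congr_left fun m => ?_
        rw [Real.logb, div_eq_inv_mul]
      · exact (Asymptotics.isLittleO_const_id_atTop K).comp_tendsto tendsto_natCast_atTop_atTop
    filter_upwards [hlog.bound (show (0 : ℝ) < c / 2 by positivity)] with m hm
    have h1 : (1 : ℝ) ≤ Z m := by exact_mod_cast h0 m
    have h2 : Real.logb 2 (Z m) ≤ Real.logb 2 (sizeBound' f m s) :=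
      Real.logb_le_logb_of_le (by norm_num) (by linarith) (by exact_mod_cast hZ m s)
    have h3 := logb_sizeBound'_le f m s
    have h4 := mul_le_mul_of_nonneg_left hs.le (show (0 : ℝ) ≤ 2 * m + 1 by positivity)
    have h5 := (le_abs_self _).trans hm
    rw [Real.norm_of_nonneg (by positivity)] at h5
    rw [Real.norm_of_nonneg (Real.logb_nonneg (by norm_num) h1),
      Real.norm_of_nonneg (by positivity)]
    nlinarith
  · have h1 : (0 : ℝ) < Z m := by exact_mod_cast h0 m
    simp only
    rw [mul_comm, Real.rpow_mul (by norm_num), Real.rpow_logb (by norm_num) (by norm_num) h1,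
      Real.rpow_natCast]
    push_cast
    exact le_rfl

end StackProg

theorem mainTheorem7 (ℓ : ℕ) (hℓ : 2 ≤ ℓ) (a b : ℕ → ℝ) (hab : ∀ n, a n < b n)
    (hpoly : ∃ r : Polynomial ℕ, ∀ n,
      |a n| ≤ ((r.eval n : ℕ) : ℝ) ∧ |b n| ≤ ((r.eval n : ℕ) : ℝ))
    (hLH : ∀ q : Polynomial ℕ, (weightLocalHamiltonian ℓ q a b).InFPQT) :
    ¬ QCETH := by
  obtain ⟨r, hr⟩ := hpoly
  -- The factor two matches the energies `±n ^ d / 2` of the Hamiltonian.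
  obtain ⟨d, hd⟩ := StackProg.exists_eval_le_pow (2 * r)
  have hbound : ∀ n : ℕ, 2 ≤ n → ((r.eval n : ℕ) : ℝ) ≤ (n : ℝ) ^ d / 2 := by
    intro n hn
    have h1 := hd n hn
    simp only [Polynomial.eval_mul, Polynomial.eval_ofNat] at h1
    have : (2 : ℝ) * ((r.eval n : ℕ) : ℝ) ≤ (n : ℝ) ^ d := by exact_mod_cast h1
    linarith
  obtain ⟨A, f, p, -, hyes, hno⟩ := hLH (StackProg.termPoly d)
  obtain ⟨D, k, hD⟩ := StackProg.exists_solver d A f p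
  rw [QCETH, not_not]
  -- The minimum over all `s` is attained. It only occurs in the time bound: the dovetailing
  -- algorithm achieves it without knowing the optimal `s`.
  set Z : ℕ → ℕ := fun m => sInf (Set.range (StackProg.sizeBound' f m)) with hZ
  have hmem : ∀ m, ∃ s, StackProg.sizeBound' f m s = Z m := fun m =>
    Nat.sInf_mem (Set.range_nonempty _)
  refine ⟨D, fun m => Z m ^ k, StackProg.isSubexponential_pow f k (fun m => ?_)
    fun m s => Nat.sInf_le ⟨s, rfl⟩, fun C _ => ?_⟩
  · obtain ⟨s, hs⟩ := hmem m
    rw [← hs]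
    exact StackProg.one_le_sizeBound' f m s
  · obtain ⟨s, hs⟩ := hmem C.descriptionSize
    have ht : StackProg.sizeBound f C s ^ k ≤ Z C.descriptionSize ^ k :=
      Nat.pow_le_pow_left (hs ▸ StackProg.sizeBound_le f C s) k
    refine ⟨fun hC => hD C _ (fun s => ?_) s _ ht, fun hC => hD C _ (fun s => ?_) s _ ht⟩
    · have h := hyes _ (StackProg.reductionInst_mem_yes hℓ d C (S := s + 1) (by omega)
        (fun n hn => ((hr n).1.trans (hbound n hn))) hC)
      rw [StackProg.encode_reductionInst] at h
      exact h
    · have h := hno _ (StackProg.reductionInst_mem_no hℓ d C (S := s + 1) (by omega)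
        (fun n hn => ((hr n).2.trans (hbound n hn))) hC)
      rw [StackProg.encode_reductionInst] at h
      exact h
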